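/- Call an $n$-qubit unitary $C$ $\delta$-peaked if $\max_{s\in\{0,1\}^n}|\langle s|C|0^n\rangle|^2\ge\delta$. Consider random circuits on $n$ qubits whose two-qubit gates are independent and Haar-distributed on $U(4)$, placed according to one of the following architectures. (a) 1D, open chain: $\tau$ brick-wall layers, layer $t=0,\dots,\tau-1$ acting on the neighbouring pairs $(i,i+1)$, $0\le i<n-1$, with $i\equiv t \pmod 2$. (b) 1D, ring ($n$ even): $\tau$ brick-wall layers, layer $t$ acting on the pairs $(i,i+1 \bmod n)$ with $i\equiv t\pmod 2$. (c) Fully connected, layered: $\tau$ layers, each acting on an independent, uniformly random pairing of the qubits (one qubit idles if $n$ is odd). (d) Fully connected, sequential (complete graph): $m$ successive gates, each acting on an independent, uniformly random pair of distinct qubits; the depth is $\tau:=2m/n$. For all constants $c>0$ and $K>0$ there are $\kappa>0$ and $N\ge 2$ such that for every $n\ge N$ and every $\delta\ge K\,2^{-0.49n}$: in each of the architectures (a)–(d), whenever the depth satisfies $\tau\ge c\log n$, the probability that the random circuit is $\delta$-peaked is at most $e^{-\kappa n}$. -/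

import Mathlib

open MeasureTheory
open scoped ENNReal

namespace PeakedCircuits

/-- The group `U(4)` of two-qubit gates; the basis is indexed by pairs of bits. -/
abbrev Gate : Type := Matrix.unitaryGroup (Fin 2 × Fin 2) ℂ

/-- The Borel `σ`-algebra on the group of two-qubit gates. -/
noncomputable instance instMeasurableSpaceGate : MeasurableSpace Gate := borel Gate

instance instBorelSpaceGate : BorelSpace Gate := ⟨rfl⟩

/-- The unitary group `U(4)` is compact, so that its Haar measure can be normalised. -/
instance instCompactSpaceGate : CompactSpace Gate := by
  have hK : IsCompact (Set.pi Set.univ fun _ : Fin 2 × Fin 2 =>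
      Set.pi Set.univ fun _ : Fin 2 × Fin 2 => Metric.closedBall (0 : ℂ) 1) :=
    isCompact_univ_pi fun _ => isCompact_univ_pi fun _ => isCompact_closedBall _ _
  have hC : IsClosed {A : Matrix (Fin 2 × Fin 2) (Fin 2 × Fin 2) ℂ |
      star A * A = 1 ∧ A * star A = 1} :=
    (isClosed_eq (by fun_prop) continuous_const).inter
      (isClosed_eq (by fun_prop) continuous_const)
  have hU : IsCompact
      ((Matrix.unitaryGroup (Fin 2 × Fin 2) ℂ : Set (Matrix (Fin 2 × Fin 2) (Fin 2 × Fin 2) ℂ))) := by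
    refine hK.of_isClosed_subset ?_ ?_
    · have hE : ((Matrix.unitaryGroup (Fin 2 × Fin 2) ℂ :
          Set (Matrix (Fin 2 × Fin 2) (Fin 2 × Fin 2) ℂ))) =
          {A | star A * A = 1 ∧ A * star A = 1} := by
        ext A
        exact Unitary.mem_iff
      rw [hE]
      exact hC
    · intro A hA i _ j _
      rw [mem_closedBall_zero_iff]
      exact entry_norm_bound_of_unitary hA i j
  exact isCompact_iff_compactSpace.mp hU

/-- The Haar probability measure on `U(4)`. -/
noncomputable def haarGate : Measure Gate :=
  Measure.haarMeasure (⊤ : TopologicalSpace.PositiveCompacts Gate)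

/-- The operator on `n` qubits that applies the two-qubit gate `U` to the qubits `p.1` and `p.2`
and the identity to all others, as a matrix in the computational basis `{0,1}ⁿ`. -/
def gateMatrix {n : ℕ} (p : Fin n × Fin n) (U : Gate) :
    Matrix (Fin n → Fin 2) (Fin n → Fin 2) ℂ :=
  Matrix.of fun s s' =>
    if ∀ k, k ≠ p.1 → k ≠ p.2 → s k = s' k then
      U.val (s p.1, s p.2) (s' p.1, s' p.2)
    else 0

/-- The operator of a circuit: `l` lists the pairs of qubits acted on, in order of time (the head
of the list acts first), and `U k` is the gate at the `k`-th place. -/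
def circuitMatrix {n : ℕ} : (l : List (Fin n × Fin n)) → (Fin l.length → Gate) →
    Matrix (Fin n → Fin 2) (Fin n → Fin 2) ℂ
  | [], _ => 1
  | p :: l, U => circuitMatrix l (fun k => U k.succ) * gateMatrix p (U 0)

/-- `C` is `δ`-peaked: some output string `s` satisfies `|⟨s|C|0ⁿ⟩|² ≥ δ`. -/
def IsPeaked {n : ℕ} (δ : ℝ) (C : Matrix (Fin n → Fin 2) (Fin n → Fin 2) ℂ) : Prop :=
  ∃ s : Fin n → Fin 2, δ ≤ ‖C s 0‖ ^ 2

/-- The probability that the circuit with gate placement `l` is `δ`-peaked, when its gates are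
independent and Haar random. -/
noncomputable def peakedProb {n : ℕ} (δ : ℝ) (l : List (Fin n × Fin n)) : ℝ≥0∞ :=
  (Measure.pi fun _ : Fin l.length => haarGate) {U | IsPeaked δ (circuitMatrix l U)}

/-- The same probability when the placement `l ω` is itself random, for `ω` uniformly distributed
on the finite nonempty set `Ω` and independent of the gates. -/
noncomputable def peakedProbAvg {n : ℕ} {Ω : Type} [Fintype Ω] (δ : ℝ)
    (l : Ω → List (Fin n × Fin n)) : ℝ≥0∞ :=
  (∑ ω, peakedProb δ (l ω)) / (Fintype.card Ω : ℝ≥0∞)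

/-- Layer `t` of the brick wall on the open chain `0 - 1 - ... - (n-1)`: the pairs `(i, i + 1)`
of neighbours for which `i` has the parity of `t`. -/
def chainLayer (n t : ℕ) : List (Fin n × Fin n) :=
  ((List.finRange n).filter fun i => i.val % 2 = t % 2 ∧ i.val + 1 < n).map
    fun i => (i, finRotate n i)

/-- Layer `t` of the brick wall on the ring of `n` qubits (`n` even): the pairs
`(i, i + 1 mod n)` for which `i` has the parity of `t`. -/
def ringLayer (n t : ℕ) : List (Fin n × Fin n) :=
  ((List.finRange n).filter fun i => i.val % 2 = t % 2).map fun i => (i, finRotate n i)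

/-- The layer of gates given by a permutation `σ`: it acts on the disjoint pairs
`(σ 0, σ 1), (σ 2, σ 3), ...` (if `n` is odd, one qubit idles). -/
def matchingLayer {n : ℕ} (σ : Equiv.Perm (Fin n)) : List (Fin n × Fin n) :=
  (List.finRange (n / 2)).map fun k =>
    (σ ⟨2 * k.val, by omega⟩, σ ⟨2 * k.val + 1, by omega⟩)

/-- The brick wall of depth `τ` on the open chain of `n` qubits. -/
def chain (n τ : ℕ) : List (Fin n × Fin n) := (List.range τ).flatMap (chainLayer n)

/-- The brick wall of depth `τ` on the ring of `n` qubits. -/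
def ring (n τ : ℕ) : List (Fin n × Fin n) := (List.range τ).flatMap (ringLayer n)

/-- The fully connected circuit of depth `τ` with layers given by the permutations `σ t`. With
uniformly random `σ`, every layer is an independent uniformly random pairing of the qubits. -/
def matchings (n τ : ℕ) (σ : Fin τ → Equiv.Perm (Fin n)) : List (Fin n × Fin n) :=
  (List.finRange τ).flatMap fun t => matchingLayer (σ t)

/-- The fully connected circuit of `m` successive gates, the `k`-th acting on the pair `e k` of
distinct qubits. With uniformly random `e`, all pairs are independent and uniformly random. -/
def completeGraph (n m : ℕ) (e : Fin m → {p : Fin n × Fin n // p.1 ≠ p.2}) :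
    List (Fin n × Fin n) :=
  List.ofFn fun k => (e k).val

end PeakedCircuits

/-!
A circuit `C` that is `δ`-peaked has collision probability `∑ s, |⟨s|C|0ⁿ⟩|⁴ ≥ δ²`, so by Markov's
inequality (`peakedProb_le`) it is peaked with probability at most `Z / δ²`, where `Z` is the mean
collision probability. Since `δ² ≥ K² 2^(-0.98 n)`, it is enough to show `Z ≤ poly(n) 0.503ⁿ`:
a constant depth `τ` already achieves this, and `c log n` exceeds every constant.

*Second moments.* `Z` is the expectation of a two-copy observable. Left invariance of Haar measure
and unitarity determine the second moments on `U(4)` (`moment_formula`). In the basis `2I - S`,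
`2S - I` of single-qubit observables (`S` the swap of the two copies), averaging over a gate on two
qubits keeps equal labels, and `Z` becomes `(3/2)^u 3^(-n)` times the total mass of a nonnegative
evolution on `{0,1}ⁿ` (`pushList_none`), where `u` is the number of qubits that no gate acts on.
The evolution starts with mass one on each configuration; a gate at `p` moves configurations that
differ at `p` to the two configurations where they agree, with `2/5` of the mass each. It has the
invariants `2^(-#{k : τ k ≠ b})`, so that a constant configuration never holds more than mass
`(3/2)ⁿ` (`evolve_const_le`). If there were no other mass, `Z` would be of order `2⁻ⁿ`.

*One dimension.* In terms of domain walls, a gate moves the wall at its bond to a neighbouring bond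
and loses a fifth of its mass. Hence the ratio `ρ b` by which a further wall at the bond `b` changes
the mass (`WallRatio`) is `O((4/5)^t)` after `t` layers (`wallRatio_brick`), except that it stays
bounded by `9` at the bond that closes an open chain to a ring, and the total mass is at most twice
the mass of the wall-free configuration times `∏ b, (1 + ρ b)`.

*Fully connected circuits.* The total mass is also that of the adjoint evolution of the constant `1`,
which is controlled by the potential `a^k + a^(n-k)`, `k` the number of labels `true`. A gate across
the cut multiplies it by `2/5 (a + 1/a)`, which is less than `1` for `1/2 < a ≤ 1`; after averaging
over the random placement the loss can be absorbed into a smaller `a`. For random pairings each layer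
takes `a` to `a exp(-1/4000)` at the cost of a factor `2 (n + 1)`
(`avgOp_matching_potential_le`); the average over pairings is a generating function, computed by
comparison with independent labels of bias `k / n`. For single random pairs, a gate takes `a` to
`a exp(-1/(1000 n))` at the cost of a factor `1 + O(1/n)` (`avgOp_pair_potential_le`), so that `O(n)`
gates suffice. At `a = 0.501` the sum of the potential is `2 · 1.501ⁿ`, whence `Z` is at most about
`(1.501/3)ⁿ`. In the sequential model a union bound excludes that more than `n / 1000` qubits are
idle (`card_idle_le`).
-/

namespace PeakedCircuits

/-! ### Second moments of the Haar measure on `U(4)` -/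

instance instIsHaarMeasureHaarGate : haarGate.IsHaarMeasure := by
  unfold haarGate; infer_instance

instance instIsProbabilityMeasureHaarGate : IsProbabilityMeasure haarGate := by
  refine ⟨?_⟩
  have h := Measure.haarMeasure_self (K₀ := (⊤ : TopologicalSpace.PositiveCompacts Gate))
  simpa [haarGate] using h

instance instSecondCountableTopologyGate : SecondCountableTopology Gate := by
  have : SecondCountableTopology (Matrix (Fin 2 × Fin 2) (Fin 2 × Fin 2) ℂ) :=
    inferInstanceAs (SecondCountableTopology (Fin 2 × Fin 2 → Fin 2 × Fin 2 → ℂ))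
  exact Topology.IsInducing.subtypeVal.secondCountableTopology

lemma integrable_of_continuous_gate {E : Type*} [NormedAddCommGroup E] {f : Gate → E}
    [SecondCountableTopology E]
    (hf : Continuous f) : Integrable f haarGate :=
  hf.integrable_of_hasCompactSupport (HasCompactSupport.of_compactSpace f)

/-- Complex conjugation on the last two of four tensor factors, the identity on the first two:
the pattern of conjugations in `U ⊗ U ⊗ Ū ⊗ Ū`. -/
noncomputable def conjLast (i : Fin 4) : ℂ →+* ℂ := if i < 2 then RingHom.id ℂ else starRingEnd ℂ

lemma continuous_conjLast (i : Fin 4) : Continuous (conjLast i) := by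
  unfold conjLast; split_ifs
  · exact continuous_id
  · exact Complex.continuous_conj

lemma continuous_entry (q r : Fin 2 × Fin 2) : Continuous fun U : Gate => U.val q r :=
  (continuous_apply r).comp ((continuous_apply q).comp continuous_subtype_val)

/-- The mixed moment `E[U_{q₀r₀} U_{q₁r₁} Ū_{q₂r₂} Ū_{q₃r₃}]` of a Haar random gate. -/
noncomputable def moment (q r : Fin 4 → Fin 2 × Fin 2) : ℂ :=
  ∫ U : Gate, ∏ i, conjLast i (U.val (q i) (r i)) ∂haarGate

lemma continuous_monomial (q r : Fin 4 → Fin 2 × Fin 2) :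
    Continuous fun U : Gate => ∏ i, conjLast i (U.val (q i) (r i)) :=
  continuous_finsetProd _ fun i _ => (continuous_conjLast i).comp (continuous_entry _ _)

/-- Left invariance of Haar measure, for the moments. -/
lemma moment_eq_sum (V : Gate) (q r : Fin 4 → Fin 2 × Fin 2) :
    moment q r = ∑ p : Fin 4 → Fin 2 × Fin 2, (∏ i, conjLast i (V.val (q i) (p i))) * moment p r := by
  have h := integral_mul_left_eq_self (μ := haarGate)
    (fun U : Gate => ∏ i, conjLast i (U.val (q i) (r i))) V
  unfold moment
  rw [← h]
  simp_rw [← integral_const_mul]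
  rw [← integral_finsetSum]
  · congr 1
    ext U
    have : ∀ i, conjLast i ((V * U).val (q i) (r i))
        = ∑ p, conjLast i (V.val (q i) p) * conjLast i (U.val p (r i)) := by
      intro i
      rw [Submonoid.coe_mul, Matrix.mul_apply, map_sum]
      simp
    simp_rw [this, Finset.prod_univ_sum, Fintype.piFinset_univ, Finset.prod_mul_distrib]
  · intro p _
    exact (integrable_of_continuous_gate (continuous_monomial p r)).const_mul _

/-- Invariance under monomial gates `|π j⟩ ↦ v_j |j⟩`. -/
lemma moment_eq_phase_mul (π : Equiv.Perm (Fin 2 × Fin 2)) (v : Fin 2 × Fin 2 → ℂ)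
    (hv : ∀ j, v j * star (v j) = 1) (q r : Fin 4 → Fin 2 × Fin 2) :
    moment q r = (∏ i, conjLast i (v (q i))) * moment (fun i => π (q i)) r := by
  let A : Matrix (Fin 2 × Fin 2) (Fin 2 × Fin 2) ℂ :=
    Matrix.of fun i j => if j = π i then v i else 0
  have hA : A ∈ Matrix.unitaryGroup (Fin 2 × Fin 2) ℂ := by
    rw [Matrix.mem_unitaryGroup_iff]
    ext i j
    simp only [A, Matrix.mul_apply, Matrix.star_apply, Matrix.of_apply, Matrix.one_apply]
    by_cases hij : i = j
    · subst hij
      simpa [apply_ite star] using hv i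
    · simp only [hij, if_false]
      refine Finset.sum_eq_zero fun x _ => ?_
      by_cases hx : x = π i
      · have : x ≠ π j := fun h => hij (π.injective (hx.symm.trans h))
        simp [this]
      · simp [hx]
  rw [moment_eq_sum ⟨A, hA⟩]
  rw [Finset.sum_eq_single (fun i => π (q i))]
  · simp [A]
  · intro p _ hp
    obtain ⟨i, hi⟩ := Function.ne_iff.mp hp
    rw [Finset.prod_eq_zero (Finset.mem_univ i), zero_mul]
    simp [A, hi]
  · simp

/-- A moment vanishes unless each index occurs as often without as with a conjugation. -/
lemma moment_eq_zero (q r : Fin 4 → Fin 2 × Fin 2)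
    (h : ¬ ((q 0 = q 2 ∧ q 1 = q 3) ∨ (q 0 = q 3 ∧ q 1 = q 2))) : moment q r = 0 := by
  have key : ∃ j, (if q 0 = j then Complex.I else 1) * (if q 1 = j then Complex.I else 1) *
      (if q 2 = j then -Complex.I else 1) * (if q 3 = j then -Complex.I else 1) ≠ 1 := by
    by_contra! hc
    have hI : Complex.I ≠ 1 := by simp [Complex.ext_iff]
    have hI' : -Complex.I ≠ 1 := by simp [Complex.ext_iff]
    have hI2 : (-1 : ℂ) ≠ 1 := by norm_num
    have h0 : q 0 = q 2 ∨ q 0 = q 3 := by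
      by_contra! hn
      have := hc (q 0)
      rw [if_pos rfl, if_neg hn.1.symm, if_neg hn.2.symm] at this
      split_ifs at this <;> simp_all
    have h1 : q 1 = q 2 ∨ q 1 = q 3 := by
      by_contra! hn
      have := hc (q 1)
      rw [if_pos (rfl : q 1 = q 1), if_neg hn.1.symm, if_neg hn.2.symm] at this
      split_ifs at this <;> simp_all
    have h2 : q 2 = q 0 ∨ q 2 = q 1 := by
      by_contra! hn
      have := hc (q 2)
      rw [if_pos (rfl : q 2 = q 2), if_neg hn.1.symm, if_neg hn.2.symm] at this
      split_ifs at this <;> simp_all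
    have h3 : q 3 = q 0 ∨ q 3 = q 1 := by
      by_contra! hn
      have := hc (q 3)
      rw [if_pos (rfl : q 3 = q 3), if_neg hn.1.symm, if_neg hn.2.symm] at this
      split_ifs at this <;> simp_all
    apply h
    grind
  obtain ⟨j, hj⟩ := key
  have := moment_eq_phase_mul 1 (fun k => if k = j then Complex.I else 1)
    (by intro k; split_ifs <;> simp) q r
  simp only [Fin.prod_univ_four, conjLast] at this
  simp only [Equiv.Perm.coe_one, id_eq] at this
  have h2 : (if (2 : Fin 4) < 2 then RingHom.id ℂ else starRingEnd ℂ) = starRingEnd ℂ := by simp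
  have h3 : (if (3 : Fin 4) < 2 then RingHom.id ℂ else starRingEnd ℂ) = starRingEnd ℂ := by simp
  have h0 : (if (0 : Fin 4) < 2 then RingHom.id ℂ else starRingEnd ℂ) = RingHom.id ℂ := by simp
  have h1 : (if (1 : Fin 4) < 2 then RingHom.id ℂ else starRingEnd ℂ) = RingHom.id ℂ := by simp
  simp only [h0, h1, h2, h3, RingHom.id_apply, apply_ite (starRingEnd ℂ), Complex.conj_I, map_one] at this
  have h4 : (1 - (if q 0 = j then Complex.I else 1) * (if q 1 = j then Complex.I else 1) *
      (if q 2 = j then -Complex.I else 1) * (if q 3 = j then -Complex.I else 1)) * moment q r = 0 := by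
    rw [sub_mul, one_mul]; exact sub_eq_zero.mpr this
  rcases mul_eq_zero.mp h4 with h | h
  · exact absurd (sub_eq_zero.mp h).symm hj
  · exact h

/-- The reflection with rows `(3/5, 4/5)` and `(4/5, -3/5)` on the first of the two qubits. -/
noncomputable def reflectionGate : Gate :=
  ⟨Matrix.of fun i j => if i.2 = j.2 then
      (if i.1 = j.1 then (if i.1 = 0 then 3 / 5 else -(3 / 5)) else 4 / 5) else 0, by
    rw [Matrix.mem_unitaryGroup_iff]
    ext ⟨i, i'⟩ ⟨j, j'⟩
    simp only [Matrix.mul_apply, Matrix.star_apply, Matrix.of_apply, Matrix.one_apply,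
      Fintype.sum_prod_type, Fin.sum_univ_two]
    fin_cases i <;> fin_cases i' <;> fin_cases j <;> fin_cases j' <;> norm_num⟩

lemma conjLast_zero : conjLast 0 = RingHom.id ℂ := by simp [conjLast]
lemma conjLast_one : conjLast 1 = RingHom.id ℂ := by simp [conjLast]
lemma conjLast_two : conjLast 2 = starRingEnd ℂ := by simp [conjLast]
lemma conjLast_three : conjLast 3 = starRingEnd ℂ := by simp [conjLast]

/-- The moments with all row indices equal are sums of moments of the two pairings. -/
lemma moment_const (r : Fin 4 → Fin 2 × Fin 2) :
    moment ![(0, 0), (0, 0), (0, 0), (0, 0)] r =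
      moment ![(0, 0), (1, 0), (0, 0), (1, 0)] r + moment ![(0, 0), (1, 0), (1, 0), (0, 0)] r := by
  have swapEq : ∀ q q' : Fin 4 → Fin 2 × Fin 2,
      (∀ i, q' i = Equiv.swap ((0, 0) : Fin 2 × Fin 2) (1, 0) (q i)) →
      moment q r = moment q' r := by
    intro q q' h
    rw [moment_eq_phase_mul (Equiv.swap (0, 0) (1, 0)) (fun _ => 1) (by simp) q r]
    simp only [map_one, Finset.prod_const_one, one_mul]
    congr 1
    ext1 i
    exact (h i).symm
  have e := moment_eq_sum reflectionGate ![(0, 0), (0, 0), (0, 0), (0, 0)] r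
  -- The index patterns that the reflection reaches from the constant one and that have a nonzero
  -- moment.
  let S : Finset (Fin 4 → Fin 2 × Fin 2) :=
    {![(0, 0), (0, 0), (0, 0), (0, 0)], ![(1, 0), (1, 0), (1, 0), (1, 0)],
      ![(0, 0), (1, 0), (0, 0), (1, 0)], ![(1, 0), (0, 0), (1, 0), (0, 0)],
      ![(0, 0), (1, 0), (1, 0), (0, 0)], ![(1, 0), (0, 0), (0, 0), (1, 0)]}
  rw [← Finset.sum_subset (Finset.subset_univ S)] at e
  · rw [Finset.sum_insert (by decide), Finset.sum_insert (by decide), Finset.sum_insert (by decide),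
      Finset.sum_insert (by decide), Finset.sum_insert (by decide), Finset.sum_singleton] at e
    have e1 := swapEq ![(0, 0), (0, 0), (0, 0), (0, 0)] ![(1, 0), (1, 0), (1, 0), (1, 0)] (by decide)
    have e2 := swapEq ![(0, 0), (1, 0), (0, 0), (1, 0)] ![(1, 0), (0, 0), (1, 0), (0, 0)] (by decide)
    have e3 := swapEq ![(0, 0), (1, 0), (1, 0), (0, 0)] ![(1, 0), (0, 0), (0, 0), (1, 0)] (by decide)
    rw [← e1, ← e2, ← e3] at e
    simp only [Fin.prod_univ_four, conjLast_zero, conjLast_one, conjLast_two, conjLast_three,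
      reflectionGate, Matrix.of_apply, Matrix.cons_val] at e
    norm_num [Complex.conj_ofNat] at e
    linear_combination (625 / 288 : ℂ) * e
  · intro p _ hp
    by_cases h2 : ∀ i, (p i).2 = 0
    · have : moment p r = 0 := by
        apply moment_eq_zero
        rintro h
        apply hp
        have hpi : ∀ i, p i = (0, 0) ∨ p i = (1, 0) := by
          intro i
          have := h2 i
          rcases hq : p i with ⟨u, v⟩
          rw [hq] at this
          simp only at this
          subst this
          fin_cases u <;> simp
        have hv : p = ![p 0, p 1, p 2, p 3] := by
          ext i : 1
          fin_cases i <;> rfl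
        rw [hv]
        rcases h with ⟨a, b⟩ | ⟨a, b⟩ <;> rcases hpi 0 with c | c <;> rcases hpi 1 with d | d <;>
          rw [← a, ← b, c, d] <;> decide
      rw [this, mul_zero]
    · push Not at h2
      obtain ⟨i, hi⟩ := h2
      rw [Finset.prod_eq_zero (Finset.mem_univ i), zero_mul]
      have : (![(0, 0), (0, 0), (0, 0), (0, 0)] : Fin 4 → Fin 2 × Fin 2) i = (0, 0) := by
        fin_cases i <;> rfl
      rw [this]
      simp [reflectionGate, Ne.symm hi]

/-- The indicator of the pairing of indices that matches each qubit copy with itself. -/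
def idPairing {ι R : Type*} [DecidableEq ι] [Zero R] [One R] (q : Fin 4 → ι) : R :=
  if q 0 = q 2 ∧ q 1 = q 3 then 1 else 0

/-- The indicator of the pairing of indices that exchanges the two copies. -/
def swapPairing {ι R : Type*} [DecidableEq ι] [Zero R] [One R] (q : Fin 4 → ι) : R :=
  if q 0 = q 3 ∧ q 1 = q 2 then 1 else 0

lemma exists_perm_pair {ι : Type*} [DecidableEq ι] {a b c d : ι} (hab : a ≠ b) (hcd : c ≠ d) :
    ∃ π : Equiv.Perm ι, π a = c ∧ π b = d := by
  refine ⟨(Equiv.swap a c).trans (Equiv.swap (Equiv.swap a c b) d), ?_, ?_⟩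
  · rw [Equiv.trans_apply, Equiv.swap_apply_left, Equiv.swap_apply_of_ne_of_ne _ hcd]
    intro h
    apply hab
    have := congrArg (Equiv.swap a c) h
    simpa using this
  · simp

/-- A left-invariant tensor is a combination of the two pairings (Schur-Weyl duality for two
copies). -/
lemma moment_eq_pairings (q r : Fin 4 → Fin 2 × Fin 2) :
    moment q r = idPairing q * moment ![(0, 0), (1, 0), (0, 0), (1, 0)] r +
      swapPairing q * moment ![(0, 0), (1, 0), (1, 0), (0, 0)] r := by
  have perm : ∀ (π : Equiv.Perm (Fin 2 × Fin 2)) (q' : Fin 4 → Fin 2 × Fin 2),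
      (∀ i, π (q i) = q' i) → moment q r = moment q' r := by
    intro π q' h
    rw [moment_eq_phase_mul π (fun _ => 1) (by simp) q r]
    simp only [map_one, Finset.prod_const_one, one_mul]
    congr 1
    ext1 i
    exact h i
  unfold idPairing swapPairing
  by_cases h1 : q 0 = q 2 ∧ q 1 = q 3
  · by_cases h2 : q 0 = q 3 ∧ q 1 = q 2
    · rw [if_pos h1, if_pos h2, one_mul, one_mul, ← moment_const]
      apply perm (Equiv.swap (q 0) (0, 0))
      intro i
      have : q i = q 0 := by fin_cases i <;> grind
      rw [this, Equiv.swap_apply_left]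
      fin_cases i <;> rfl
    · rw [if_pos h1, if_neg h2, one_mul, zero_mul, add_zero]
      have hne : q 0 ≠ q 1 := by grind
      obtain ⟨π, ha, hb⟩ := exists_perm_pair (c := ((0, 0) : Fin 2 × Fin 2)) (d := (1, 0)) hne (by decide)
      apply perm π
      intro i
      fin_cases i
      · exact ha
      · exact hb
      · exact h1.1 ▸ ha
      · exact h1.2 ▸ hb
  · by_cases h2 : q 0 = q 3 ∧ q 1 = q 2
    · rw [if_neg h1, if_pos h2, zero_mul, one_mul, zero_add]
      have hne : q 0 ≠ q 1 := by grind
      obtain ⟨π, ha, hb⟩ := exists_perm_pair (c := ((0, 0) : Fin 2 × Fin 2)) (d := (1, 0)) hne (by decide)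
      apply perm π
      intro i
      fin_cases i
      · exact ha
      · exact hb
      · exact h2.2 ▸ hb
      · exact h2.1 ▸ ha
    · rw [if_neg h1, if_neg h2, zero_mul, zero_mul, add_zero]
      exact moment_eq_zero q r (by tauto)

lemma sum_entry_mul_conj (U : Gate) (r s : Fin 2 × Fin 2) :
    ∑ a, U.val a r * starRingEnd ℂ (U.val a s) = if r = s then 1 else 0 := by
  have h := Matrix.mem_unitaryGroup_iff'.mp U.2
  have h' := congrFun (congrFun h s) r
  rw [Matrix.mul_apply, Matrix.one_apply] at h'
  simp only [Matrix.star_apply] at h'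
  rw [show (if r = s then (1 : ℂ) else 0) = if s = r then 1 else 0 by simp [eq_comm], ← h']
  exact Finset.sum_congr rfl fun a _ => mul_comm _ _

lemma sum_moment_id (r : Fin 4 → Fin 2 × Fin 2) :
    ∑ a, ∑ b, moment ![a, b, a, b] r = idPairing r := by
  have : ∀ U : Gate, ∑ a, ∑ b, ∏ i, conjLast i (U.val ((![a, b, a, b] : Fin 4 → _) i) (r i))
      = idPairing r := by
    intro U
    have h := congrArg₂ (· * ·) (sum_entry_mul_conj U (r 0) (r 2)) (sum_entry_mul_conj U (r 1) (r 3))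
    simp only [Finset.sum_mul_sum] at h
    rw [idPairing, ite_and, ← show (if r 0 = r 2 then (1 : ℂ) else 0) * (if r 1 = r 3 then 1 else 0) =
      if r 0 = r 2 then (if r 1 = r 3 then 1 else 0) else 0 by split_ifs <;> simp, ← h]
    refine Finset.sum_congr rfl fun a _ => Finset.sum_congr rfl fun b _ => ?_
    simp only [Fin.prod_univ_four, conjLast_zero, conjLast_one, conjLast_two, conjLast_three,
      RingHom.id_apply, Matrix.cons_val]
    ring
  unfold moment
  simp_rw [← integral_finsetSum Finset.univ
    (fun b _ => integrable_of_continuous_gate (continuous_monomial _ r))]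
  rw [← integral_finsetSum _ fun a _ => integrable_of_continuous_gate
    (continuous_finsetSum _ fun b _ => continuous_monomial _ r)]
  simp [this]

lemma sum_moment_swap (r : Fin 4 → Fin 2 × Fin 2) :
    ∑ a, ∑ b, moment ![a, b, b, a] r = swapPairing r := by
  have : ∀ U : Gate, ∑ a, ∑ b, ∏ i, conjLast i (U.val ((![a, b, b, a] : Fin 4 → _) i) (r i))
      = swapPairing r := by
    intro U
    have h := congrArg₂ (· * ·) (sum_entry_mul_conj U (r 0) (r 3)) (sum_entry_mul_conj U (r 1) (r 2))
    simp only [Finset.sum_mul_sum] at h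
    rw [swapPairing, ite_and, ← show (if r 0 = r 3 then (1 : ℂ) else 0) * (if r 1 = r 2 then 1 else 0) =
      if r 0 = r 3 then (if r 1 = r 2 then 1 else 0) else 0 by split_ifs <;> simp, ← h]
    refine Finset.sum_congr rfl fun a _ => Finset.sum_congr rfl fun b _ => ?_
    simp only [Fin.prod_univ_four, conjLast_zero, conjLast_one, conjLast_two, conjLast_three,
      RingHom.id_apply, Matrix.cons_val]
    ring
  unfold moment
  simp_rw [← integral_finsetSum Finset.univ
    (fun b _ => integrable_of_continuous_gate (continuous_monomial _ r))]
  rw [← integral_finsetSum _ fun a _ => integrable_of_continuous_gate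
    (continuous_finsetSum _ fun b _ => continuous_monomial _ r)]
  simp [this]

/-- The second moments of the Haar measure on `U(4)` (the Weingarten formula for two copies). -/
lemma moment_formula (q r : Fin 4 → Fin 2 × Fin 2) :
    moment q r = idPairing q * (1 / 15 * idPairing r - 1 / 60 * swapPairing r) +
      swapPairing q * (1 / 15 * swapPairing r - 1 / 60 * idPairing r) := by
  have hI := sum_moment_id r
  have hS := sum_moment_swap r
  have a1 : ∀ a b : Fin 2 × Fin 2, idPairing (R := ℂ) ![a, b, a, b] = 1 := by
    intro a b; exact if_pos ⟨rfl, rfl⟩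
  have a2 : ∀ a b : Fin 2 × Fin 2, swapPairing (R := ℂ) ![a, b, a, b] = if a = b then 1 else 0 := by
    intro a b
    simp only [swapPairing, Matrix.cons_val]
    congr 1
    exact propext ⟨fun h => h.1, fun h => ⟨h, h.symm⟩⟩
  have a3 : ∀ a b : Fin 2 × Fin 2, swapPairing (R := ℂ) ![a, b, b, a] = 1 := by
    intro a b; exact if_pos ⟨rfl, rfl⟩
  have a4 : ∀ a b : Fin 2 × Fin 2, idPairing (R := ℂ) ![a, b, b, a] = if a = b then 1 else 0 := by
    intro a b
    simp only [idPairing, Matrix.cons_val]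
    congr 1
    exact propext ⟨fun h => h.1, fun h => ⟨h, h.symm⟩⟩
  obtain ⟨A, B, hAB⟩ : ∃ A B : ℂ, ∀ q, moment q r = idPairing q * A + swapPairing q * B :=
    ⟨_, _, fun q => moment_eq_pairings q r⟩
  simp_rw [hAB, a1, a2, Finset.sum_add_distrib] at hI
  simp_rw [hAB, a3, a4, Finset.sum_add_distrib] at hS
  simp only [one_mul, ite_mul, zero_mul, Finset.sum_ite_eq, Finset.mem_univ, if_true,
    Finset.sum_const, Finset.card_univ, Fintype.card_prod, Fintype.card_fin, nsmul_eq_mul] at hI hS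
  rw [hAB]
  push_cast at hI hS
  rw [← hI, ← hS]
  ring

/-! ### Resetting two coordinates -/

/-- The configuration `s` with its values at the two places `p.1`, `p.2` reset to `q.1`, `q.2`. -/
def setPair {n : ℕ} {α : Type*} (p : Fin n × Fin n) (s : Fin n → α) (q : α × α) : Fin n → α :=
  fun k => if k = p.1 then q.1 else if k = p.2 then q.2 else s k

section setPair
variable {n : ℕ} {α : Type*} (p : Fin n × Fin n) (s : Fin n → α) (q : α × α)

@[simp] lemma setPair_fst : setPair p s q p.1 = q.1 := if_pos rfl

lemma setPair_snd (hp : p.1 ≠ p.2) : setPair p s q p.2 = q.2 := by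
  simp [setPair, hp.symm]

lemma setPair_of_ne {k : Fin n} (h1 : k ≠ p.1) (h2 : k ≠ p.2) : setPair p s q k = s k := by
  simp [setPair, h1, h2]

@[simp] lemma setPair_setPair (q' : α × α) : setPair p (setPair p s q) q' = setPair p s q' := by
  ext k; simp only [setPair]; split_ifs <;> rfl

@[simp] lemma setPair_self : setPair p s (s p.1, s p.2) = s := by
  ext k; simp only [setPair]; split_ifs with h1 h2
  · rw [h1]
  · rw [h2]
  · rfl

end setPair

lemma prod_eq_mul_mul_prod_erase {n : ℕ} {M : Type*} [CommMonoid M] {p : Fin n × Fin n}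
    (hp : p.1 ≠ p.2) (f : Fin n → M) :
    ∏ k, f k = f p.1 * f p.2 * ∏ k ∈ (Finset.univ.erase p.1).erase p.2, f k := by
  rw [← Finset.mul_prod_erase Finset.univ f (Finset.mem_univ p.1),
    ← Finset.mul_prod_erase (Finset.univ.erase p.1) f (a := p.2) (by simp [hp.symm]), mul_assoc]

lemma gateMatrix_mulVec {n : ℕ} {p : Fin n × Fin n} (hp : p.1 ≠ p.2) (U : Gate)
    (ψ : (Fin n → Fin 2) → ℂ) (s : Fin n → Fin 2) :
    (gateMatrix p U).mulVec ψ s = ∑ q, U.val (s p.1, s p.2) q * ψ (setPair p s q) := by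
  simp only [Matrix.mulVec, dotProduct, gateMatrix, Matrix.of_apply, ite_mul, zero_mul]
  rw [← Finset.sum_filter]
  refine Finset.sum_nbij' (fun s' => (s' p.1, s' p.2)) (fun q => setPair p s q) ?_ ?_ ?_ ?_ ?_
  · simp
  · intro q _
    simp only [Finset.mem_filter, Finset.mem_univ, true_and]
    intro k h1 h2
    rw [setPair_of_ne _ _ _ h1 h2]
  · intro s' hs'
    simp only [Finset.mem_filter, Finset.mem_univ, true_and] at hs'
    ext k : 1
    simp only [setPair]; split_ifs with h1 h2
    · rw [h1]
    · rw [h2]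
    · exact hs' k h1 h2
  · intro q _
    simp [setPair_snd _ _ _ hp]
  · intro s' hs'
    simp only [Finset.mem_filter, Finset.mem_univ, true_and] at hs'
    congr 2
    ext k : 1
    simp only [setPair]; split_ifs with h1 h2
    · rw [h1]
    · rw [h2]
    · exact (hs' k h1 h2).symm

/-! ### Two-copy observables -/

/-- The single-qubit two-copy observables, by their matrix entries: with `I` the identity and `S`
the swap of the two copies, `some false` stands for `2 I - S`, `some true` for `2 S - I`, and
`none` for the collision observable `∑ s, |ss⟩⟨ss|`. The first two form the basis dual to
`I`, `S` for the trace pairing, up to a factor `6`. -/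
def kernel : Option Bool → (Fin 4 → Fin 2) → ℤ
  | some false, z => 2 * idPairing z - swapPairing z
  | some true, z => 2 * swapPairing z - idPairing z
  | none, z => if z 0 = z 1 ∧ z 0 = z 2 ∧ z 0 = z 3 then 1 else 0

/-- The expectation of the observable `⨂ₖ kernel (c k)` in two copies of the state `ψ`. -/
noncomputable def expectation {n : ℕ} (ψ : (Fin n → Fin 2) → ℂ) (c : Fin n → Option Bool) : ℂ :=
  ∑ X : Fin 4 → Fin n → Fin 2,
    ((∏ k, kernel (c k) fun i => X i k : ℤ) : ℂ) * ∏ i, conjLast i (ψ (X i))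

/-- The trace pairings of the single-qubit observables with the identity. -/
def traceId : Option Bool → ℤ
  | some false => 6
  | some true => 0
  | none => 2

/-- The trace pairings of the single-qubit observables with the swap. -/
def traceSwap : Option Bool → ℤ
  | some false => 0
  | some true => 6
  | none => 2

lemma sum_kernel_mul_idPairing (c : Option Bool) :
    ∑ z, kernel c z * idPairing z = traceId c := by
  rcases c with _ | _ | _ <;> decide

lemma sum_kernel_mul_swapPairing (c : Option Bool) :
    ∑ z, kernel c z * swapPairing z = traceSwap c := by
  rcases c with _ | _ | _ <;> decide

lemma idPairing_prod {R : Type*} [CommRing R] (q : Fin 4 → Fin 2 × Fin 2) :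
    (idPairing q : R) = idPairing (fun i => (q i).1) * idPairing (fun i => (q i).2) := by
  simp only [idPairing, Prod.ext_iff]
  split_ifs <;> first | (exfalso; tauto) | simp

lemma swapPairing_prod {R : Type*} [CommRing R] (q : Fin 4 → Fin 2 × Fin 2) :
    (swapPairing q : R) = swapPairing (fun i => (q i).1) * swapPairing (fun i => (q i).2) := by
  simp only [swapPairing, Prod.ext_iff]
  split_ifs <;> first | (exfalso; tauto) | simp

lemma kernel_false_cast (z : Fin 4 → Fin 2) :
    ((kernel (some false) z : ℤ) : ℂ) = 2 * idPairing z - swapPairing z := by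
  simp [kernel, idPairing, swapPairing]

lemma kernel_true_cast (z : Fin 4 → Fin 2) :
    ((kernel (some true) z : ℤ) : ℂ) = 2 * swapPairing z - idPairing z := by
  simp [kernel, idPairing, swapPairing]

/-- The coefficient with which a label takes part in the basis label `b`, once the qubit is acted
on by a gate: the collision observable averages to `((2I - S) + (2S - I)) / 3`. -/
noncomputable def weight (b : Bool) : Option Bool → ℝ
  | none => 1 / 3
  | some b' => if b' = b then 1 else 0

/-- The action on functions of labels of averaging over a Haar random gate at `p`. On the basis
labels, two different labels at `p` are annihilated. -/
noncomputable def push {n : ℕ} (p : Fin n × Fin n) (F : (Fin n → Option Bool) → ℝ)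
    (c : Fin n → Option Bool) : ℝ :=
  ∑ b : Bool, weight b (c p.1) * weight b (c p.2) *
    (F (setPair p c (some b, some b)) + 2 / 5 * (F (setPair p c (some b, some !b)) +
      F (setPair p c (some !b, some b))))

/-- The average over a Haar random gate of a product of two single-qubit observables. -/
lemma sum_kernel_mul_moment (c d : Option Bool) (r : Fin 4 → Fin 2 × Fin 2) :
    ∑ q : Fin 4 → Fin 2 × Fin 2,
      ((kernel c (fun i => (q i).1) : ℤ) : ℂ) * (kernel d fun i => (q i).2 : ℤ) * moment q r =
    ∑ b : Bool, ((weight b c * weight b d : ℝ) : ℂ) *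
      (kernel (some b) (fun i => (r i).1) * kernel (some b) (fun i => (r i).2) +
        2 / 5 * (kernel (some b) (fun i => (r i).1) * kernel (some !b) (fun i => (r i).2) +
          kernel (some !b) (fun i => (r i).1) * kernel (some b) (fun i => (r i).2))) := by
  have hI : ∑ q : Fin 4 → Fin 2 × Fin 2, kernel c (fun i => (q i).1) * kernel d (fun i => (q i).2) *
      idPairing q = traceId c * traceId d := by
    rw [← sum_kernel_mul_idPairing, ← sum_kernel_mul_idPairing, Finset.sum_mul_sum,
      ← Fintype.sum_prod_type']
    refine Fintype.sum_equiv (Equiv.arrowProdEquivProdArrow _ _ _) _ _ fun q => ?_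
    rw [idPairing_prod]
    simp only [Equiv.arrowProdEquivProdArrow, Equiv.coe_fn_mk]
    ring
  have hS : ∑ q : Fin 4 → Fin 2 × Fin 2, kernel c (fun i => (q i).1) * kernel d (fun i => (q i).2) *
      swapPairing q = traceSwap c * traceSwap d := by
    rw [← sum_kernel_mul_swapPairing, ← sum_kernel_mul_swapPairing, Finset.sum_mul_sum,
      ← Fintype.sum_prod_type']
    refine Fintype.sum_equiv (Equiv.arrowProdEquivProdArrow _ _ _) _ _ fun q => ?_
    rw [swapPairing_prod]
    simp only [Equiv.arrowProdEquivProdArrow, Equiv.coe_fn_mk]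
    ring
  have cI : ∀ {ι : Type} [DecidableEq ι] (q : Fin 4 → ι), ((idPairing q : ℤ) : ℂ) = idPairing q := by
    intro ι _ q; simp [idPairing]
  have cS : ∀ {ι : Type} [DecidableEq ι] (q : Fin 4 → ι), ((swapPairing q : ℤ) : ℂ) = swapPairing q := by
    intro ι _ q; simp [swapPairing]
  have hI' := congrArg (Int.cast : ℤ → ℂ) hI
  have hS' := congrArg (Int.cast : ℤ → ℂ) hS
  push_cast [cI, cS] at hI' hS'
  simp_rw [moment_formula, mul_add, Finset.sum_add_distrib, ← mul_assoc, ← Finset.sum_mul]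
  rw [hI', hS', idPairing_prod r, swapPairing_prod r, Fintype.sum_bool]
  rcases c with _ | _ | _ <;> rcases d with _ | _ | _ <;>
    norm_num [traceId, traceSwap, weight, kernel_false_cast, kernel_true_cast] <;> ring

lemma prod_kernel_setPair {n : ℕ} {p : Fin n × Fin n} (hp : p.1 ≠ p.2) (c : Fin n → Option Bool)
    (X : Fin 4 → Fin n → Fin 2) (q : Fin 4 → Fin 2 × Fin 2) :
    ∏ k, kernel (c k) (fun i => setPair p (X i) (q i) k) =
      kernel (c p.1) (fun i => (q i).1) * kernel (c p.2) (fun i => (q i).2) *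
      ∏ k ∈ (Finset.univ.erase p.1).erase p.2, kernel (c k) (fun i => X i k) := by
  rw [prod_eq_mul_mul_prod_erase hp]
  simp only [setPair_fst, setPair_snd _ _ _ hp]
  congr 1
  refine Finset.prod_congr rfl fun k hk => ?_
  simp only [Finset.mem_erase] at hk
  simp only [setPair_of_ne _ _ _ hk.2.1 hk.1]

lemma prod_kernel_setPair_label {n : ℕ} {p : Fin n × Fin n} (hp : p.1 ≠ p.2)
    (c : Fin n → Option Bool) (X : Fin 4 → Fin n → Fin 2) (u v : Option Bool) :
    ∏ k, kernel (setPair p c (u, v) k) (fun i => X i k) =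
      kernel u (fun i => X i p.1) * kernel v (fun i => X i p.2) *
      ∏ k ∈ (Finset.univ.erase p.1).erase p.2, kernel (c k) (fun i => X i k) := by
  rw [prod_eq_mul_mul_prod_erase hp]
  simp only [setPair_fst, setPair_snd _ _ _ hp]
  congr 1
  refine Finset.prod_congr rfl fun k hk => ?_
  simp only [Finset.mem_erase] at hk
  simp only [setPair_of_ne _ _ _ hk.2.1 hk.1]

/-- Exchanging, in each of the four copies, the pair of bits at `p` with an external pair. -/
def exchange {n : ℕ} (p : Fin n × Fin n) (hp : p.1 ≠ p.2) :
    ((Fin 4 → Fin n → Fin 2) × (Fin 4 → Fin 2 × Fin 2)) ≃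
      ((Fin 4 → Fin n → Fin 2) × (Fin 4 → Fin 2 × Fin 2)) :=
  Function.Involutive.toPerm
    (fun Z => (fun i => setPair p (Z.1 i) (Z.2 i), fun i => (Z.1 i p.1, Z.1 i p.2))) (by
      rintro ⟨X, Q⟩
      simp [setPair_snd _ _ _ hp])

lemma prod_conjLast_gate {n : ℕ} {p : Fin n × Fin n} (hp : p.1 ≠ p.2) (U : Gate)
    (ψ : (Fin n → Fin 2) → ℂ) (X : Fin 4 → Fin n → Fin 2) :
    ∏ i, conjLast i ((gateMatrix p U).mulVec ψ (X i)) =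
      ∑ Q : Fin 4 → Fin 2 × Fin 2, (∏ i, conjLast i (U.val (X i p.1, X i p.2) (Q i))) *
        ∏ i, conjLast i (ψ (setPair p (X i) (Q i))) := by
  simp_rw [gateMatrix_mulVec hp, map_sum, map_mul, Finset.prod_univ_sum, Fintype.piFinset_univ,
    Finset.prod_mul_distrib]

/-- The average over one Haar random gate, on the level of expectations. -/
lemma integral_expectation_gate {n : ℕ} {p : Fin n × Fin n} (hp : p.1 ≠ p.2)
    (ψ : (Fin n → Fin 2) → ℂ) (c : Fin n → Option Bool) :
    ∫ U, expectation ((gateMatrix p U).mulVec ψ) c ∂haarGate =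
      ∑ b : Bool, ((weight b (c p.1) * weight b (c p.2) : ℝ) : ℂ) *
        (expectation ψ (setPair p c (some b, some b)) + 2 / 5 *
          (expectation ψ (setPair p c (some b, some !b)) +
            expectation ψ (setPair p c (some !b, some b)))) := by
  have h1 : ∫ U, expectation ((gateMatrix p U).mulVec ψ) c ∂haarGate =
      ∑ X : Fin 4 → Fin n → Fin 2, ∑ Q : Fin 4 → Fin 2 × Fin 2,
        ((∏ k, kernel (c k) fun i => X i k : ℤ) : ℂ) *
        (moment (fun i => (X i p.1, X i p.2)) Q * ∏ i, conjLast i (ψ (setPair p (X i) (Q i)))) := by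
    simp only [expectation, prod_conjLast_gate hp]
    have hint : ∀ (X : Fin 4 → Fin n → Fin 2) (Q : Fin 4 → Fin 2 × Fin 2), Integrable (fun U : Gate =>
        (∏ i, conjLast i (U.val (X i p.1, X i p.2) (Q i))) *
          ∏ i, conjLast i (ψ (setPair p (X i) (Q i)))) haarGate := fun X Q =>
      (integrable_of_continuous_gate (continuous_monomial _ _)).mul_const _
    rw [integral_finsetSum _ fun X _ => (integrable_finsetSum _ fun Q _ => hint X Q).const_mul _]
    refine Finset.sum_congr rfl fun X _ => ?_
    rw [integral_const_mul, integral_finsetSum _ fun Q _ => hint X Q, Finset.mul_sum]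
    refine Finset.sum_congr rfl fun Q _ => ?_
    rw [integral_mul_const]
    rfl
  rw [h1, ← Fintype.sum_prod_type', ← Equiv.sum_comp (exchange p hp), Fintype.sum_prod_type]
  have h2 : ∀ X : Fin 4 → Fin n → Fin 2, ∑ Q : Fin 4 → Fin 2 × Fin 2,
      (fun X Q => ((∏ k, kernel (c k) fun i => X i k : ℤ) : ℂ) *
        (moment (fun i => (X i p.1, X i p.2)) Q * ∏ i, conjLast i (ψ (setPair p (X i) (Q i)))))
        (exchange p hp (X, Q)).1 (exchange p hp (X, Q)).2 =
      (∏ k ∈ (Finset.univ.erase p.1).erase p.2, kernel (c k) (fun i => X i k) : ℤ) *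
        (∏ i, conjLast i (ψ (X i))) * ∑ Q : Fin 4 → Fin 2 × Fin 2,
          (((kernel (c p.1) fun i => (Q i).1) : ℤ) : ℂ) * ((kernel (c p.2) fun i => (Q i).2) : ℤ) *
            moment Q fun i => (X i p.1, X i p.2) := by
    intro X
    rw [Finset.mul_sum]
    refine Finset.sum_congr rfl fun Q _ => ?_
    have hex : exchange p hp (X, Q) =
        (fun i => setPair p (X i) (Q i), fun i => (X i p.1, X i p.2)) := rfl
    simp only [hex, setPair_fst, setPair_snd _ _ _ hp, setPair_setPair, setPair_self,
      prod_kernel_setPair hp]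
    push_cast
    ring
  rw [Finset.sum_congr rfl fun X _ => h2 X]
  simp only [expectation, Finset.mul_sum, ← Finset.sum_add_distrib, prod_kernel_setPair_label hp,
    sum_kernel_mul_moment]
  rw [Finset.sum_comm]
  refine Finset.sum_congr rfl fun b _ => Finset.sum_congr rfl fun X _ => ?_
  push_cast
  ring

lemma continuous_gateMatrix {n : ℕ} (p : Fin n × Fin n) : Continuous fun U : Gate => gateMatrix p U := by
  refine continuous_matrix fun s s' => ?_
  simp only [gateMatrix, Matrix.of_apply]
  split_ifs
  · exact continuous_entry _ _
  · exact continuous_const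

lemma continuous_circuitMatrix {n : ℕ} (l : List (Fin n × Fin n)) :
    Continuous fun U : Fin l.length → Gate => circuitMatrix l U := by
  induction l with
  | nil => exact continuous_const
  | cons p l ih =>
    simp only [circuitMatrix]
    have h : Continuous fun (U : Fin (l.length + 1) → Gate) (k : Fin l.length) => U k.succ :=
      continuous_pi fun k => continuous_apply k.succ
    have h0 : Continuous fun U : Fin (l.length + 1) → Gate => U 0 := continuous_apply 0
    exact (ih.comp h).matrix_mul ((continuous_gateMatrix p).comp h0)

lemma continuous_expectation {n : ℕ} (c : Fin n → Option Bool) :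
    Continuous fun ψ : (Fin n → Fin 2) → ℂ => expectation ψ c :=
  continuous_finsetSum _ fun _ _ => continuous_const.mul <| continuous_finsetProd _ fun i _ =>
    (continuous_conjLast i).comp (continuous_apply _)

lemma continuous_expectation_circuit {n : ℕ} (l : List (Fin n × Fin n)) (c : Fin n → Option Bool)
    (ψ : (Fin n → Fin 2) → ℂ) :
    Continuous fun U : Fin l.length → Gate => expectation ((circuitMatrix l U).mulVec ψ) c :=
  (continuous_expectation c).comp ((continuous_circuitMatrix l).matrix_mulVec continuous_const)

/-- The operator by which averaging over all gates of a circuit acts on functions of labels; the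
observables are evolved backwards, so the last gate acts on the label first. -/
noncomputable def pushList {n : ℕ} (l : List (Fin n × Fin n)) (F : (Fin n → Option Bool) → ℝ) :
    (Fin n → Option Bool) → ℝ :=
  l.foldl (fun F p => push p F) F

/-- The expansion coefficients of `pushList l` as a linear operator. -/
lemma exists_pushList_eq_sum {n : ℕ} (l : List (Fin n × Fin n)) (c : Fin n → Option Bool) :
    ∃ a : (Fin n → Option Bool) → ℝ, ∀ F, pushList l F c = ∑ d, a d * F d := by
  induction l using List.reverseRecOn generalizing c with
  | nil => exact ⟨fun d => if c = d then 1 else 0, fun F => by simp [pushList]⟩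
  | append_singleton l p ih =>
    choose a ha using ih
    refine ⟨fun d => ∑ b : Bool, weight b (c p.1) * weight b (c p.2) *
      (a (setPair p c (some b, some b)) d + 2 / 5 * (a (setPair p c (some b, some !b)) d +
        a (setPair p c (some !b, some b)) d)), fun F => ?_⟩
    have : pushList (l ++ [p]) F = push p (pushList l F) := by simp [pushList]
    rw [this]
    simp only [push, ha, Finset.mul_sum, ← Finset.sum_add_distrib, Finset.sum_mul]
    rw [Finset.sum_comm]
    refine Finset.sum_congr rfl fun d _ => Finset.sum_congr rfl fun b _ => by ring

lemma integrable_of_continuous_gates {k : ℕ} {f : (Fin k → Gate) → ℝ} (hf : Continuous f) :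
    Integrable f (Measure.pi fun _ => haarGate) :=
  hf.integrable_of_hasCompactSupport (HasCompactSupport.of_compactSpace f)

lemma integral_re_expectation_gate {n : ℕ} {p : Fin n × Fin n} (hp : p.1 ≠ p.2)
    (ψ : (Fin n → Fin 2) → ℂ) (c : Fin n → Option Bool) :
    ∫ U, (expectation ((gateMatrix p U).mulVec ψ) c).re ∂haarGate =
      push p (fun d => (expectation ψ d).re) c := by
  have hi : Integrable (fun U : Gate => expectation ((gateMatrix p U).mulVec ψ) c) haarGate :=
    integrable_of_continuous_gate ((continuous_expectation c).comp
      ((continuous_gateMatrix p).matrix_mulVec continuous_const))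
  have h := Complex.reCLM.integral_comp_comm hi
  simp only [Complex.reCLM_apply] at h
  rw [h, integral_expectation_gate hp, push, Complex.re_sum]
  refine Finset.sum_congr rfl fun b _ => ?_
  rw [Complex.re_ofReal_mul, Complex.add_re,
    show (2 / 5 : ℂ) = ((2 / 5 : ℝ) : ℂ) by push_cast; rfl, Complex.re_ofReal_mul, Complex.add_re]

/-- The average of an expectation over all gates of a circuit. -/
lemma integral_re_expectation_circuit {n : ℕ} (l : List (Fin n × Fin n))
    (hl : ∀ p ∈ l, p.1 ≠ p.2) (c : Fin n → Option Bool) (ψ : (Fin n → Fin 2) → ℂ) :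
    ∫ U, (expectation ((circuitMatrix l U).mulVec ψ) c).re ∂(Measure.pi fun _ => haarGate) =
      pushList l (fun d => (expectation ψ d).re) c := by
  induction l generalizing ψ with
  | nil => simp [pushList, circuitMatrix]
  | cons p l ih =>
    have hmp := (measurePreserving_piFinSuccAbove (fun _ : Fin (l.length + 1) => haarGate) 0).symm
    have e := hmp.integral_comp' (g := fun U : Fin (l.length + 1) → Gate =>
      (expectation ((circuitMatrix (p :: l) U).mulVec ψ) c).re)
    refine Eq.trans e.symm ?_
    rw [integral_prod]
    · have h1 : ∀ V : Gate, ∫ W : Fin l.length → Gate, (expectation ((circuitMatrix (p :: l)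
          ((MeasurableEquiv.piFinSuccAbove (fun _ : Fin (l.length + 1) => Gate) 0).symm (V, W))).mulVec
            ψ) c).re ∂(Measure.pi fun _ => haarGate) =
          pushList l (fun d => (expectation ((gateMatrix p V).mulVec ψ) d).re) c := by
        intro V
        rw [← ih (fun q hq => hl q (List.mem_cons_of_mem _ hq)) ((gateMatrix p V).mulVec ψ)]
        refine integral_congr_ae (Filter.Eventually.of_forall fun W => ?_)
        simp only [circuitMatrix, Matrix.mulVec_mulVec]
        rfl
      refine Eq.trans (integral_congr_ae (Filter.Eventually.of_forall h1)) ?_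
      obtain ⟨a, ha⟩ := exists_pushList_eq_sum l c
      have hint : ∀ d, Integrable
          (fun V : Gate => (expectation ((gateMatrix p V).mulVec ψ) d).re) haarGate := fun d =>
        integrable_of_continuous_gate (Complex.continuous_re.comp ((continuous_expectation d).comp
          ((continuous_gateMatrix p).matrix_mulVec continuous_const)))
      simp only [ha]
      rw [integral_finsetSum _ fun d _ => (hint d).const_mul _]
      simp_rw [integral_const_mul, integral_re_expectation_gate (hl p (List.mem_cons_self ..))]
      rw [← ha]
      rfl
    · have hc : Continuous fun U : Fin (l.length + 1) → Gate =>
          (expectation ((circuitMatrix (p :: l) U).mulVec ψ) c).re :=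
        Complex.continuous_re.comp (continuous_expectation_circuit (p :: l) c ψ)
      exact (hmp.integrable_comp_emb (MeasurableEquiv.measurableEmbedding _)).mpr
        (integrable_of_continuous_gates hc)

lemma expectation_none {n : ℕ} (ψ : (Fin n → Fin 2) → ℂ) :
    (expectation ψ fun _ => none).re = ∑ s, ‖ψ s‖ ^ 4 := by
  have hk : ∀ X : Fin 4 → Fin n → Fin 2, (∏ k, kernel none fun i => X i k) =
      if X 0 = X 1 ∧ X 0 = X 2 ∧ X 0 = X 3 then 1 else 0 := by
    intro X
    simp only [kernel]
    split_ifs with h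
    · exact Finset.prod_eq_one fun k _ =>
        if_pos ⟨congrFun h.1 k, congrFun h.2.1 k, congrFun h.2.2 k⟩
    · have : ∃ k, ¬(X 0 k = X 1 k ∧ X 0 k = X 2 k ∧ X 0 k = X 3 k) := by
        by_contra! hc
        exact h ⟨funext fun k => (hc k).1, funext fun k => (hc k).2.1, funext fun k => (hc k).2.2⟩
      obtain ⟨k, hk⟩ := this
      exact Finset.prod_eq_zero (Finset.mem_univ k) (if_neg hk)
  have : expectation ψ (fun _ => none) = ((∑ s, ‖ψ s‖ ^ 4 : ℝ) : ℂ) := by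
    simp only [expectation, hk, Int.cast_ite, Int.cast_one, Int.cast_zero, ite_mul, one_mul,
      zero_mul]
    rw [← Finset.sum_filter]
    push_cast
    refine Finset.sum_nbij' (fun X => X 0) (fun s _ => s) (by simp) (by simp) ?_ (by simp) ?_
    · intro X hX
      simp only [Finset.mem_filter, Finset.mem_univ, true_and] at hX
      ext1 i
      fin_cases i
      · rfl
      · exact hX.1
      · exact hX.2.1
      · exact hX.2.2
    · intro X hX
      simp only [Finset.mem_filter, Finset.mem_univ, true_and] at hX
      rw [Fin.prod_univ_four, ← hX.1, ← hX.2.1, ← hX.2.2, conjLast_zero, conjLast_one,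
        conjLast_two, conjLast_three, RingHom.id_apply]
      have h := Complex.mul_conj' (ψ (X 0))
      linear_combination (ψ (X 0) * starRingEnd ℂ (ψ (X 0)) + (‖ψ (X 0)‖ : ℂ) ^ 2) * h
  rw [this, Complex.ofReal_re]

/-- All the observables have expectation `1` in the computational basis state `|0ⁿ⟩`. -/
lemma expectation_single_zero {n : ℕ} (c : Fin n → Option Bool) :
    expectation (Pi.single 0 1) c = 1 := by
  have h0 : ∀ d, kernel d (fun _ => 0) = 1 := by
    intro d; rcases d with _ | _ | _ <;> decide
  rw [expectation, Finset.sum_eq_single (fun _ => 0)]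
  · simp [h0]
  · intro X _ hX
    obtain ⟨i, hi⟩ := Function.ne_iff.mp hX
    rw [Finset.prod_eq_zero (i := i) (Finset.mem_univ i) (by rw [Pi.single_eq_of_ne hi, map_zero]),
      mul_zero]
  · simp

/-- The mean collision probability of the output of a random circuit, in terms of the averaging
operators. -/
lemma integral_sum_norm_pow_four {n : ℕ} (l : List (Fin n × Fin n)) (hl : ∀ p ∈ l, p.1 ≠ p.2) :
    ∫ U, ∑ s, ‖circuitMatrix l U s 0‖ ^ 4 ∂(Measure.pi fun _ => haarGate) =
      pushList l (fun _ => 1) (fun _ => none) := by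
  have h := integral_re_expectation_circuit l hl (fun _ => none) (Pi.single 0 1)
  simp only [expectation_none, expectation_single_zero, Complex.one_re,
    Matrix.mulVec_single_one] at h
  exact h

/-- Markov's inequality for the collision probability. -/
lemma peakedProb_le {n : ℕ} (l : List (Fin n × Fin n)) (hl : ∀ p ∈ l, p.1 ≠ p.2) {δ : ℝ}
    (hδ : 0 < δ) :
    peakedProb δ l ≤ ENNReal.ofReal (pushList l (fun _ => 1) (fun _ => none) / δ ^ 2) := by
  have hcont : Continuous fun U : Fin l.length → Gate => ∑ s, ‖circuitMatrix l U s 0‖ ^ 4 :=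
    continuous_finsetSum _ fun s _ => (((continuous_apply _).comp ((continuous_apply s).comp
      (continuous_circuitMatrix l))).norm).pow 4
  have h := mul_meas_ge_le_integral_of_nonneg
    (μ := Measure.pi fun _ : Fin l.length => haarGate)
    (f := fun U => ∑ s, ‖circuitMatrix l U s 0‖ ^ 4)
    (Filter.Eventually.of_forall fun U => Finset.sum_nonneg fun s _ => by positivity)
    (integrable_of_continuous_gates hcont) (δ ^ 2)
  rw [integral_sum_norm_pow_four l hl] at h
  have hsub : {U | IsPeaked δ (circuitMatrix l U)} ⊆
      {U | δ ^ 2 ≤ ∑ s, ‖circuitMatrix l U s 0‖ ^ 4} := by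
    rintro U ⟨s, hs⟩
    calc δ ^ 2 ≤ (‖circuitMatrix l U s 0‖ ^ 2) ^ 2 := by gcongr
      _ = ‖circuitMatrix l U s 0‖ ^ 4 := by ring
      _ ≤ _ := Finset.single_le_sum (f := fun s => ‖circuitMatrix l U s 0‖ ^ 4)
        (fun s _ => by positivity) (Finset.mem_univ s)
  refine (measure_mono hsub).trans ?_
  rw [← ofReal_measureReal]
  apply ENNReal.ofReal_le_ofReal
  rw [le_div_iff₀ (by positivity), mul_comm]
  exact h

lemma peakedProb_le_one {n : ℕ} (l : List (Fin n × Fin n)) (δ : ℝ) : peakedProb δ l ≤ 1 :=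
  prob_le_one

/-! ### Reduction to two labels per qubit -/

/-- The restriction of `push` to the two basis labels: at each gate, a configuration whose labels
at `p` differ loses a fifth of its mass and moves with equal probabilities to the two
configurations where they agree. -/
noncomputable def push₂ {n : ℕ} (p : Fin n × Fin n) (f : (Fin n → Bool) → ℝ) (τ : Fin n → Bool) : ℝ :=
  if τ p.1 = τ p.2 then
    f τ + 2 / 5 * (f (setPair p τ (τ p.1, !τ p.1)) + f (setPair p τ (!τ p.1, τ p.1)))
  else 0

/-- The mass distribution on configurations after the circuit `l`, started with mass one in each
configuration. -/
noncomputable def evolve {n : ℕ} (l : List (Fin n × Fin n)) : (Fin n → Bool) → ℝ :=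
  l.foldl (fun f p => push₂ p f) fun _ => 1

lemma evolve_append_singleton {n : ℕ} (l : List (Fin n × Fin n)) (p : Fin n × Fin n) :
    evolve (l ++ [p]) = push₂ p (evolve l) := by
  simp [evolve]

lemma some_comp_setPair {n : ℕ} (p : Fin n × Fin n) (τ : Fin n → Bool) (u v : Bool) :
    setPair p (fun k => some (τ k)) (some u, some v) = fun k => some (setPair p τ (u, v) k) := by
  ext1 k; simp only [setPair]; split_ifs <;> rfl

lemma push_some {n : ℕ} {p : Fin n × Fin n}
    (F : (Fin n → Option Bool) → ℝ) (τ : Fin n → Bool) :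
    push p F (fun k => some (τ k)) = push₂ p (fun σ => F fun k => some (σ k)) τ := by
  simp only [push, push₂, some_comp_setPair, weight, Fintype.sum_bool]
  have h : setPair p τ (τ p.1, τ p.2) = τ := setPair_self p τ
  cases h1 : τ p.1 <;> cases h2 : τ p.2 <;> rw [h1, h2] at h <;> simp [h]

lemma pushList_some {n : ℕ} (l : List (Fin n × Fin n)) (τ : Fin n → Bool) :
    pushList l (fun _ => 1) (fun k => some (τ k)) = evolve l τ := by
  induction l using List.reverseRecOn generalizing τ with
  | nil => rfl
  | append_singleton l p ih =>
    rw [evolve_append_singleton,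
      show pushList (l ++ [p]) (fun _ => 1) = push p (pushList l fun _ => 1) by simp [pushList],
      push_some]
    congr 1
    ext1 σ
    exact ih σ

lemma sum_sum_update {n : ℕ} (k : Fin n) (g : (Fin n → Bool) → ℝ) :
    ∑ τ, ∑ b, g (Function.update τ k b) = 2 * ∑ τ, g τ := by
  have h1 : ∀ τ : Fin n → Bool, ∑ b, g (Function.update τ k b) =
      g τ + g (Function.update τ k (!τ k)) := by
    intro τ
    rw [Fintype.sum_bool]
    have h := Function.update_eq_self k τ
    cases hk : τ k <;> rw [hk] at h <;> simp [h, add_comm]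
  have hinv : Function.Involutive fun τ : Fin n → Bool => Function.update τ k (!τ k) := by
    intro τ; simp
  rw [Finset.sum_congr rfl fun τ _ => h1 τ, Finset.sum_add_distrib, two_mul]
  congr 1
  exact Equiv.sum_comp (hinv.toPerm _) g

/-- The set of qubits on which no gate of `l` acts. -/
def untouched {n : ℕ} (l : List (Fin n × Fin n)) : Finset (Fin n) :=
  Finset.univ.filter fun k => ∀ p ∈ l, k ≠ p.1 ∧ k ≠ p.2

lemma mem_untouched {n : ℕ} {l : List (Fin n × Fin n)} {k : Fin n} :
    k ∈ untouched l ↔ ∀ p ∈ l, k ≠ p.1 ∧ k ≠ p.2 := by simp [untouched]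

lemma setPair_update_of_ne {n : ℕ} {α : Type*} {p : Fin n × Fin n} {k : Fin n} (h1 : k ≠ p.1)
    (h2 : k ≠ p.2) (c : Fin n → α) (x : α) (q : α × α) :
    setPair p (Function.update c k x) q = Function.update (setPair p c q) k x := by
  ext1 j
  by_cases hj : j = k
  · subst hj; simp [setPair_of_ne _ _ _ h1 h2]
  · simp [setPair, Function.update_of_ne hj]

lemma setPair_update_of_mem {n : ℕ} {α : Type*} {p : Fin n × Fin n} {k : Fin n}
    (h : k = p.1 ∨ k = p.2) (c : Fin n → α) (x : α) (q : α × α) :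
    setPair p (Function.update c k x) q = setPair p c q := by
  ext1 j
  by_cases hj : j = k
  · subst hj; rcases h with h | h <;> simp [setPair, ← h]
  · simp [setPair, Function.update_of_ne hj]

/-- The collision label at a qubit may be replaced by the sum of the two basis labels, with a
coefficient that depends on whether a gate acts on the qubit. -/
lemma pushList_eq_of_none {n : ℕ} (l : List (Fin n × Fin n)) (hl : ∀ p ∈ l, p.1 ≠ p.2) (k : Fin n)
    (c : Fin n → Option Bool) (hc : c k = none) :
    pushList l (fun _ => 1) c = (if k ∈ untouched l then 1 / 2 else 1 / 3) *
      ∑ b, pushList l (fun _ => 1) (Function.update c k (some b)) := by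
  induction l using List.reverseRecOn generalizing c with
  | nil => simp [pushList, untouched]
  | append_singleton l p ih =>
    have hp : p.1 ≠ p.2 := hl p (by simp)
    have e : pushList (l ++ [p]) (fun _ => 1) = push p (pushList l fun _ => 1) := by simp [pushList]
    rw [e]
    by_cases hk : k = p.1 ∨ k = p.2
    · have hu : k ∉ untouched (l ++ [p]) := by
        rw [mem_untouched]; intro h; have := h p (by simp); tauto
      rw [if_neg hu]
      simp only [push, Fintype.sum_bool, setPair_update_of_mem hk]
      rcases hk with hk | hk
      · subst hk
        rw [hc, Function.update_self, Function.update_of_ne hp.symm, Function.update_self,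
          Function.update_of_ne hp.symm]
        simp [weight]
        ring
      · subst hk
        rw [hc, Function.update_self, Function.update_of_ne hp, Function.update_self,
          Function.update_of_ne hp]
        simp [weight]
        ring
    · push Not at hk
      have hu : k ∈ untouched (l ++ [p]) ↔ k ∈ untouched l := by
        simp only [mem_untouched, List.mem_append, List.mem_singleton]
        constructor
        · exact fun h q hq => h q (Or.inl hq)
        · rintro h q (hq | rfl)
          · exact h q hq
          · exact hk
      simp only [hu]
      have ih' := ih fun q hq => hl q (by simp [hq])
      have hs : ∀ q : Option Bool × Option Bool, setPair p c q k = none := fun q => by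
        rw [setPair_of_ne _ _ _ hk.1 hk.2, hc]
      simp only [push, setPair_update_of_ne hk.1 hk.2, Function.update_of_ne hk.1.symm,
        Function.update_of_ne hk.2.symm]
      simp only [ih' _ (hs _)]
      simp only [Fintype.sum_bool]
      ring

/-- A function of labels in which the collision label is a multiple of the sum of the basis labels
is determined by its values on the basis labels. -/
lemma eq_prod_mul_sum {n : ℕ} (F : (Fin n → Option Bool) → ℝ) (κ : Fin n → ℝ)
    (h : ∀ k c, c k = none → F c = κ k * ∑ b, F (Function.update c k (some b))) :
    F (fun _ => none) = (∏ k, κ k) * ∑ τ : Fin n → Bool, F fun k => some (τ k) := by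
  have key : ∀ s : Finset (Fin n), (2 : ℝ) ^ n * F (fun _ => none) =
      (∏ k ∈ s, 2 * κ k) * ∑ τ : Fin n → Bool, F fun k => if k ∈ s then some (τ k) else none := by
    intro s
    induction s using Finset.induction_on with
    | empty => simp
    | insert k s hk ih =>
      rw [ih, Finset.prod_insert hk]
      have : ∀ τ : Fin n → Bool, (F fun j => if j ∈ s then some (τ j) else none) =
          κ k * ∑ b, (fun σ : Fin n → Bool => F fun j => if j ∈ insert k s then some (σ j) else none)
            (Function.update τ k b) := by
        intro τ
        rw [h k _ (by simp [hk])]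
        congr 1
        refine Finset.sum_congr rfl fun b _ => ?_
        congr 1
        ext1 j
        by_cases hj : j = k
        · subst hj; simp
        · simp [hj]
      rw [Finset.sum_congr rfl fun τ _ => this τ, ← Finset.mul_sum, sum_sum_update k
        fun σ : Fin n → Bool => F fun j => if j ∈ insert k s then some (σ j) else none]
      ring
  have := key Finset.univ
  simp only [Finset.mem_univ, if_true, Finset.prod_mul_distrib, Finset.prod_const, Finset.card_univ,
    Fintype.card_fin, mul_assoc] at this
  exact mul_left_cancel₀ (by positivity) this

/-- The mean collision probability in terms of the total mass. -/
lemma pushList_none {n : ℕ} (l : List (Fin n × Fin n)) (hl : ∀ p ∈ l, p.1 ≠ p.2) :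
    pushList l (fun _ => 1) (fun _ => none) =
      (3 / 2) ^ (untouched l).card * (1 / 3) ^ n * ∑ τ, evolve l τ := by
  rw [eq_prod_mul_sum _ _ (pushList_eq_of_none l hl)]
  simp only [pushList_some]
  congr 1
  have : ∀ k : Fin n, (if k ∈ untouched l then (1 / 2 : ℝ) else 1 / 3) =
      (if k ∈ untouched l then (3 / 2 : ℝ) else 1) * (1 / 3) := by
    intro k; split_ifs <;> norm_num
  simp only [this, Finset.prod_mul_distrib, Finset.prod_const, Finset.card_univ, Fintype.card_fin,
    Finset.prod_ite_mem, Finset.univ_inter]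

/-! ### The adjoint evolution -/

/-- The adjoint of `push₂`. -/
noncomputable def pull {n : ℕ} (p : Fin n × Fin n) (w : (Fin n → Bool) → ℝ) (τ : Fin n → Bool) : ℝ :=
  if τ p.1 = τ p.2 then w τ
  else 2 / 5 * (w (setPair p τ (false, false)) + w (setPair p τ (true, true)))

lemma sum_eq_sum_setPair {n : ℕ} {p : Fin n × Fin n} (hp : p.1 ≠ p.2) (g : (Fin n → Bool) → ℝ) :
    ∑ τ, g τ = 1 / 4 * ∑ τ, (g (setPair p τ (false, false)) + g (setPair p τ (false, true)) +
      g (setPair p τ (true, false)) + g (setPair p τ (true, true))) := by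
  have h : ∀ (τ : Fin n → Bool) (u v : Bool), setPair p τ (u, v) =
      Function.update (Function.update τ p.2 v) p.1 u := by
    intro τ u v
    ext1 k
    by_cases h1 : k = p.1
    · subst h1; simp
    · by_cases h2 : k = p.2
      · subst h2; simp [setPair_snd _ _ _ hp, hp.symm]
      · simp [setPair_of_ne _ _ _ h1 h2, h1, h2]
  have h1 := sum_sum_update p.2 fun τ => ∑ b, g (Function.update τ p.1 b)
  rw [sum_sum_update] at h1
  have h2 : ∑ τ : Fin n → Bool, (g (setPair p τ (false, false)) + g (setPair p τ (false, true)) +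
      g (setPair p τ (true, false)) + g (setPair p τ (true, true))) =
      ∑ τ : Fin n → Bool, ∑ b, ∑ b', g (Function.update (Function.update τ p.2 b) p.1 b') := by
    refine Finset.sum_congr rfl fun τ _ => ?_
    simp only [h, Fintype.sum_bool]
    ring
  rw [h2, h1]
  ring

lemma sum_push₂_mul {n : ℕ} {p : Fin n × Fin n} (hp : p.1 ≠ p.2) (f w : (Fin n → Bool) → ℝ) :
    ∑ τ, push₂ p f τ * w τ = ∑ τ, f τ * pull p w τ := by
  rw [sum_eq_sum_setPair hp, sum_eq_sum_setPair hp (fun τ => f τ * pull p w τ)]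
  congr 1
  refine Finset.sum_congr rfl fun τ _ => ?_
  simp [push₂, pull, setPair_snd _ _ _ hp]
  ring

lemma push₂_nonneg {n : ℕ} (p : Fin n × Fin n) {f : (Fin n → Bool) → ℝ} (hf : ∀ τ, 0 ≤ f τ)
    (τ : Fin n → Bool) : 0 ≤ push₂ p f τ := by
  unfold push₂
  split_ifs
  · have := hf τ; have := hf (setPair p τ (τ p.1, !τ p.1)); have := hf (setPair p τ (!τ p.1, τ p.1))
    positivity
  · exact le_rfl

lemma evolve_nonneg {n : ℕ} (l : List (Fin n × Fin n)) (τ : Fin n → Bool) : 0 ≤ evolve l τ := by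
  induction l using List.reverseRecOn generalizing τ with
  | nil => simp [evolve]
  | append_singleton l p ih => rw [evolve_append_singleton]; exact push₂_nonneg p ih τ

/-- A product weight on configurations. -/
def prodWeight {n : ℕ} (v : Bool → ℝ) (τ : Fin n → Bool) : ℝ := ∏ k, v (τ k)

lemma prodWeight_setPair {n : ℕ} {p : Fin n × Fin n} (hp : p.1 ≠ p.2) (v : Bool → ℝ)
    (τ : Fin n → Bool) (x y : Bool) : prodWeight v (setPair p τ (x, y)) =
      v x * v y * ∏ k ∈ (Finset.univ.erase p.1).erase p.2, v (τ k) := by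
  rw [prodWeight, prod_eq_mul_mul_prod_erase hp]
  simp only [setPair_fst, setPair_snd _ _ _ hp]
  congr 1
  refine Finset.prod_congr rfl fun k hk => ?_
  simp only [Finset.mem_erase] at hk
  rw [setPair_of_ne _ _ _ hk.2.1 hk.1]

lemma pull_prodWeight {n : ℕ} {p : Fin n × Fin n} (hp : p.1 ≠ p.2) {v : Bool → ℝ} {θ : ℝ}
    (h : 2 / 5 * (v false ^ 2 + v true ^ 2) = θ * (v false * v true)) (τ : Fin n → Bool) :
    pull p (prodWeight v) τ = (if τ p.1 = τ p.2 then 1 else θ) * prodWeight v τ := by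
  unfold pull
  split_ifs with hτ
  · rw [one_mul]
  · rw [prodWeight_setPair hp, prodWeight_setPair hp]
    have e := prodWeight_setPair hp v τ (τ p.1) (τ p.2)
    rw [setPair_self] at e
    have hv : v (τ p.1) * v (τ p.2) = v false * v true := by
      cases h1 : τ p.1 <;> cases h2 : τ p.2 <;> simp_all [mul_comm]
    rw [e, hv]
    linear_combination (∏ k ∈ (Finset.univ.erase p.1).erase p.2, v (τ k)) * h

lemma sum_prodWeight {n : ℕ} (v : Bool → ℝ) :
    ∑ τ : Fin n → Bool, prodWeight v τ = (v false + v true) ^ n := by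
  unfold prodWeight
  rw [← Fintype.piFinset_univ, ← Finset.prod_univ_sum (fun _ => Finset.univ) fun _ b => v b]
  simp [add_comm]

/-- The weights `2^{-#{k : τ k ≠ b}}` are invariant under the adjoint evolution; this bounds the mass
of the two constant configurations. -/
lemma evolve_const_le {n : ℕ} (l : List (Fin n × Fin n)) (hl : ∀ p ∈ l, p.1 ≠ p.2) (b : Bool) :
    evolve l (fun _ => b) ≤ (3 / 2) ^ n := by
  let v : Bool → ℝ := fun x => if x = b then 1 else 1 / 2
  have hv : 2 / 5 * (v false ^ 2 + v true ^ 2) = 1 * (v false * v true) := by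
    cases b <;> norm_num [v]
  have key : ∑ τ, evolve l τ * prodWeight v τ = (3 / 2) ^ n := by
    induction l using List.reverseRecOn with
    | nil =>
      simp only [evolve, List.foldl_nil, one_mul, sum_prodWeight]
      congr 1
      cases b <;> norm_num [v]
    | append_singleton l p ih =>
      rw [evolve_append_singleton, sum_push₂_mul (hl p (by simp)),
        ← ih fun q hq => hl q (by simp [hq])]
      refine Finset.sum_congr rfl fun τ _ => ?_
      rw [pull_prodWeight (hl p (by simp)) hv]
      simp
  rw [← key]
  have h1 : evolve l (fun _ => b) = evolve l (fun _ => b) * prodWeight v fun _ : Fin n => b := by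
    simp [prodWeight, v]
  rw [h1]
  refine Finset.single_le_sum (f := fun τ => evolve l τ * prodWeight v τ)
    (fun τ _ => mul_nonneg (evolve_nonneg l τ) ?_) (Finset.mem_univ _)
  exact Finset.prod_nonneg fun k _ => by simp only [v]; split_ifs <;> norm_num

/-! ### Domain walls in one dimension -/

lemma val_finRotate {n : ℕ} (i : Fin n) :
    (finRotate n i).val = if i.val + 1 < n then i.val + 1 else 0 := by
  obtain ⟨m, rfl⟩ : ∃ m, n = m + 1 := ⟨n - 1, by have := i.2; omega⟩
  split_ifs with h
  · rw [coe_finRotate_of_ne_last]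
    intro hi
    rw [hi, Fin.val_last] at h
    omega
  · have : i = Fin.last m := Fin.ext (by rw [Fin.val_last]; have := i.2; omega)
    rw [this, finRotate_last]
    rfl

lemma finRotate_ne_self {n : ℕ} (hn : 3 ≤ n) (i : Fin n) : finRotate n i ≠ i := by
  intro h
  have := congrArg Fin.val h
  rw [val_finRotate] at this
  split_ifs at this <;> omega

lemma finRotate_finRotate_ne_self {n : ℕ} (hn : 3 ≤ n) (i : Fin n) :
    finRotate n (finRotate n i) ≠ i := by
  intro h
  have := congrArg Fin.val h
  rw [val_finRotate, val_finRotate] at this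
  split_ifs at this <;> omega

/-- The configuration with its value at `b` negated. -/
def toggle {n : ℕ} (b : Fin n) (w : Fin n → Bool) : Fin n → Bool := Function.update w b (!w b)

section toggle
variable {n : ℕ} (w : Fin n → Bool)

lemma toggle_self (b : Fin n) : toggle b w b = !w b := by simp [toggle]

lemma toggle_of_ne {b c : Fin n} (h : c ≠ b) : toggle b w c = w c := by simp [toggle, h]

lemma toggle_toggle (b : Fin n) : toggle b (toggle b w) = w := by simp [toggle]

lemma toggle_comm (b c : Fin n) : toggle b (toggle c w) = toggle c (toggle b w) := by
  by_cases h : b = c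
  · rw [h]
  · ext1 k
    by_cases hb : k = b
    · subst hb; rw [toggle_self, toggle_of_ne _ h, toggle_of_ne _ h, toggle_self]
    · by_cases hc : k = c
      · subst hc; rw [toggle_of_ne _ hb, toggle_self, toggle_self, toggle_of_ne _ hb]
      · rw [toggle_of_ne _ hb, toggle_of_ne _ hc, toggle_of_ne _ hc, toggle_of_ne _ hb]

end toggle

/-- The domain walls of a configuration on the ring: bond `i` joins the sites `i` and `i + 1`. -/
def walls {n : ℕ} (τ : Fin n → Bool) (i : Fin n) : Bool := xor (τ i) (τ (finRotate n i))

/-- The evolution `push₂` at the bond `g`, on functions of the domain walls: a wall at `g` moves to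
one of the two neighbouring bonds. -/
noncomputable def pushWalls {n : ℕ} (g : Fin n) (f : (Fin n → Bool) → ℝ) (w : Fin n → Bool) : ℝ :=
  if w g = false then
    f w + 2 / 5 * (f (toggle g (toggle (finRotate n g) w)) +
      f (toggle g (toggle ((finRotate n).symm g) w)))
  else 0

/-- The mass distribution on sets of domain walls after gates at the bonds in `gs`. All sets of
bonds are admitted, not only those of even size that come from a configuration. -/
noncomputable def evolveWalls {n : ℕ} (gs : List (Fin n)) : (Fin n → Bool) → ℝ :=
  gs.foldl (fun f g => pushWalls g f) fun _ => 1

lemma walls_flip_right {n : ℕ} (hn : 3 ≤ n) (i : Fin n) (τ : Fin n → Bool) :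
    walls (toggle (finRotate n i) τ) = toggle i (toggle (finRotate n i) (walls τ)) := by
  have h1 := finRotate_ne_self hn
  ext1 j
  by_cases hj : j = i
  · subst hj
    rw [toggle_self, toggle_of_ne _ (h1 j).symm, walls, toggle_of_ne _ (h1 j).symm, toggle_self, walls]
    simp
  · rw [toggle_of_ne _ hj]
    by_cases hj' : j = finRotate n i
    · subst hj'
      rw [toggle_self, walls, toggle_self, toggle_of_ne _ (h1 _), walls]
      simp
    · rw [toggle_of_ne _ hj', walls, walls, toggle_of_ne _ hj', toggle_of_ne]
      exact fun h => hj ((finRotate n).injective h)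

lemma walls_flip_left {n : ℕ} (hn : 3 ≤ n) (i : Fin n) (τ : Fin n → Bool) :
    walls (toggle i τ) = toggle i (toggle ((finRotate n).symm i) (walls τ)) := by
  have h := walls_flip_right hn ((finRotate n).symm i) τ
  rw [Equiv.apply_symm_apply] at h
  rw [h, toggle_comm]

lemma evolve_eq_evolveWalls {n : ℕ} (hn : 3 ≤ n) (gs : List (Fin n)) (τ : Fin n → Bool) :
    evolve (gs.map fun i => (i, finRotate n i)) τ = evolveWalls gs (walls τ) := by
  induction gs using List.reverseRecOn generalizing τ with
  | nil => rfl
  | append_singleton gs g ih =>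
    rw [List.map_append, List.map_singleton, evolve_append_singleton,
      show evolveWalls (gs ++ [g]) = pushWalls g (evolveWalls gs) by simp [evolveWalls],
      push₂, pushWalls]
    have hne := finRotate_ne_self hn g
    by_cases hw : τ g = τ (finRotate n g)
    · have hs1 : setPair (g, finRotate n g) τ (τ g, !τ g) = toggle (finRotate n g) τ := by
        ext1 k
        by_cases h1 : k = finRotate n g
        · subst h1; rw [setPair_snd _ _ _ hne.symm, toggle_self, hw]
        · rw [toggle_of_ne _ h1]
          by_cases h2 : k = g
          · subst h2; simp [setPair]
          · rw [setPair_of_ne _ _ _ h2 h1]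
      have hs2 : setPair (g, finRotate n g) τ (!τ g, τ g) = toggle g τ := by
        ext1 k
        by_cases h1 : k = g
        · subst h1; rw [toggle_self]; simp [setPair]
        · rw [toggle_of_ne _ h1]
          by_cases h2 : k = finRotate n g
          · subst h2; rw [setPair_snd _ _ _ hne.symm, ← hw]
          · rw [setPair_of_ne _ _ _ h1 h2]
      rw [if_pos hw, if_pos (by simp [walls, hw])]
      simp only
      rw [hs1, hs2, ih, ih, ih, walls_flip_right hn, walls_flip_left hn]
    · rw [if_neg hw, if_neg (by simpa [walls] using hw)]

lemma pushWalls_nonneg {n : ℕ} (g : Fin n) {f : (Fin n → Bool) → ℝ} (hf : ∀ w, 0 ≤ f w)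
    (w : Fin n → Bool) : 0 ≤ pushWalls g f w := by
  unfold pushWalls
  split_ifs
  · have := hf w
    have := hf (toggle g (toggle (finRotate n g) w))
    have := hf (toggle g (toggle ((finRotate n).symm g) w))
    positivity
  · exact le_rfl

/-- Adding a domain wall at the bond `b` changes the mass by at most the factor `ρ b`. -/
def WallRatio {n : ℕ} (f : (Fin n → Bool) → ℝ) (ρ : Fin n → ℝ) : Prop :=
  ∀ w b, w b = false → f (toggle b w) ≤ ρ b * f w

lemma WallRatio.mono {n : ℕ} {f : (Fin n → Bool) → ℝ} {ρ ρ' : Fin n → ℝ} (h : WallRatio f ρ)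
    (hf : ∀ w, 0 ≤ f w) (hρ : ∀ b, ρ b ≤ ρ' b) : WallRatio f ρ' := fun w b hw =>
  (h w b hw).trans (mul_le_mul_of_nonneg_right (hρ b) (hf w))

/-- A gate at the bond `g` removes the walls at `g`, and adds two fifths of the ratio there to the
ratio at each of the two neighbouring bonds. -/
lemma WallRatio.pushWalls {n : ℕ} (hn : 3 ≤ n) {f : (Fin n → Bool) → ℝ} {ρ : Fin n → ℝ}
    (h : WallRatio f ρ) (hf : ∀ w, 0 ≤ f w) (hρ : ∀ b, 0 ≤ ρ b) (g : Fin n) :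
    WallRatio (pushWalls g f) fun b => if b = g then 0 else
      ρ b + 2 / 5 * ((if (finRotate n).symm b = g then ρ g else 0) +
        if finRotate n b = g then ρ g else 0) := by
  set r := finRotate n with hr
  intro w b hw
  have hrg : r g ≠ g := finRotate_ne_self hn g
  have hrg' : r.symm g ≠ g := fun e => hrg ((Equiv.symm_apply_eq r).mp e).symm
  have hrr : r g ≠ r.symm g := fun e =>
    finRotate_finRotate_ne_self hn g (by rw [← hr, e]; simp)
  by_cases hbg : b = g
  · subst hbg
    simp [PeakedCircuits.pushWalls, toggle_self, hw]
  · simp only [if_neg hbg]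
    unfold PeakedCircuits.pushWalls
    rw [toggle_of_ne _ (Ne.symm hbg), ← hr]
    by_cases hg : w g = false
    · rw [if_pos hg, if_pos hg]
      have n1 := hf w
      have n2 := hf (toggle g (toggle (r g) w))
      have n3 := hf (toggle g (toggle (r.symm g) w))
      have e0 := h w b hw
      have eg := h w g hg
      have away : ∀ c, b ≠ c → f (toggle g (toggle c (toggle b w))) ≤
          ρ b * f (toggle g (toggle c w)) := by
        intro c hc
        rw [toggle_comm _ c b, toggle_comm _ g b]
        exact h _ _ (by rw [toggle_of_ne _ hbg, toggle_of_ne _ hc, hw])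
      have hρb := hρ b
      have hρg := hρ g
      by_cases h1 : b = r g
      · have a1 := away (r.symm g) (h1 ▸ hrr)
        have hb1 : r.symm b = g := by rw [h1]; simp
        have hb2 : r b ≠ g := by
          rw [h1]; exact finRotate_finRotate_ne_self hn g
        rw [if_pos hb1, if_neg hb2, ← h1, toggle_toggle]
        rw [← h1] at n2
        nlinarith [mul_nonneg hρg n2, mul_nonneg hρg n3, mul_nonneg hρb n2]
      · have a1 := away (r g) h1
        by_cases h2 : b = r.symm g
        · have hb1 : r b = g := by rw [h2]; simp
          have hb2 : r.symm b ≠ g := fun e => h1 (by rw [← e]; simp)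
          rw [if_neg hb2, if_pos hb1, ← h2, toggle_toggle]
          rw [← h2] at n3
          nlinarith [mul_nonneg hρg n2, mul_nonneg hρg n3, mul_nonneg hρb n3]
        · have a2 := away (r.symm g) h2
          have hb1 : r.symm b ≠ g := fun e => h1 (by rw [← e]; simp)
          have hb2 : r b ≠ g := fun e => h2 (by rw [← e]; simp)
          rw [if_neg hb1, if_neg hb2]
          linarith
    · rw [if_neg hg, if_neg hg, mul_zero]

lemma foldl_pushWalls_nonneg {n : ℕ} (gs : List (Fin n)) {f : (Fin n → Bool) → ℝ}
    (hf : ∀ w, 0 ≤ f w) (w : Fin n → Bool) : 0 ≤ gs.foldl (fun f g => PeakedCircuits.pushWalls g f) f w := by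
  induction gs generalizing f with
  | nil => exact hf w
  | cons g gs ih => exact ih (pushWalls_nonneg g hf)

/-- The effect on the ratios of a layer of gates at pairwise distinct, non-neighbouring bonds. -/
lemma WallRatio.layer {n : ℕ} (hn : 3 ≤ n) {f : (Fin n → Bool) → ℝ} {ρ : Fin n → ℝ}
    (h : WallRatio f ρ) (hf : ∀ w, 0 ≤ f w) (hρ : ∀ b, 0 ≤ ρ b) (gs : List (Fin n))
    (hgs : gs.Pairwise fun a b => a ≠ b ∧ finRotate n a ≠ b ∧ finRotate n b ≠ a) :
    WallRatio (gs.foldl (fun f g => PeakedCircuits.pushWalls g f) f) fun b => if b ∈ gs then 0 else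
      ρ b + 2 / 5 * ((if (finRotate n).symm b ∈ gs then ρ ((finRotate n).symm b) else 0) +
        if finRotate n b ∈ gs then ρ (finRotate n b) else 0) := by
  induction gs generalizing f ρ with
  | nil => simpa using h
  | cons g gs ih =>
    rw [List.pairwise_cons] at hgs
    have h1 := h.pushWalls hn hf hρ g
    set r := finRotate n with hr
    have h2 := ih h1 (pushWalls_nonneg g hf) (fun b => by
      have := hρ b; have := hρ g; positivity) hgs.2
    rw [List.foldl_cons]
    refine h2.mono (foldl_pushWalls_nonneg gs (pushWalls_nonneg g hf)) fun b => le_of_eq ?_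
    have far : ∀ c ∈ gs, (if c = g then 0 else ρ c + 2 / 5 * ((if r.symm c = g then ρ g else 0) +
        if r c = g then ρ g else 0)) = ρ c := by
      intro c hc
      obtain ⟨a1, a2, a3⟩ := hgs.1 c hc
      rw [if_neg (Ne.symm a1), if_neg, if_neg a3]
      · ring
      · exact fun e => a2 ((Equiv.symm_apply_eq r).mp e).symm
    by_cases hb : b ∈ gs
    · simp [hb]
    · rw [if_neg hb]
      by_cases hbg : b = g
      · subst hbg
        have c1 : r.symm b ∉ gs := fun hc => (hgs.1 _ hc).2.2 (by simp)
        have c2 : r b ∉ gs := fun hc => (hgs.1 _ hc).2.1 rfl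
        simp [c1, c2]
      · rw [if_neg hbg, if_neg (show b ∉ g :: gs by simp [hb, hbg])]
        have e1 : (if r.symm b ∈ gs then (if r.symm b = g then 0 else ρ (r.symm b) + 2 / 5 *
            ((if r.symm (r.symm b) = g then ρ g else 0) + if r (r.symm b) = g then ρ g else 0)) else 0)
            = if r.symm b ∈ gs then ρ (r.symm b) else 0 := by
          by_cases hc : r.symm b ∈ gs
          · rw [if_pos hc, if_pos hc, far _ hc]
          · rw [if_neg hc, if_neg hc]
        have e2 : (if r b ∈ gs then (if r b = g then 0 else ρ (r b) + 2 / 5 *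
            ((if r.symm (r b) = g then ρ g else 0) + if r (r b) = g then ρ g else 0)) else 0)
            = if r b ∈ gs then ρ (r b) else 0 := by
          by_cases hc : r b ∈ gs
          · rw [if_pos hc, if_pos hc, far _ hc]
          · rw [if_neg hc, if_neg hc]
        rw [e1, e2]
        have d1 : (if r.symm b ∈ g :: gs then ρ (r.symm b) else 0) =
            (if r.symm b = g then ρ g else 0) + if r.symm b ∈ gs then ρ (r.symm b) else 0 := by
          by_cases hc : r.symm b = g
          · have : g ∉ gs := fun hc => (hgs.1 _ hc).1 rfl
            simp [hc, this]
          · simp [hc]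
        have d2 : (if r b ∈ g :: gs then ρ (r b) else 0) =
            (if r b = g then ρ g else 0) + if r b ∈ gs then ρ (r b) else 0 := by
          by_cases hc : r b = g
          · have : g ∉ gs := fun hc => (hgs.1 _ hc).1 rfl
            simp [hc, this]
          · simp [hc]
        rw [d1, d2]
        ring

/-! ### Brick walls -/

/-- The mass of a set of walls, relative to the mass of the empty set. -/
lemma WallRatio.le_prod {n : ℕ} {f : (Fin n → Bool) → ℝ} {ρ : Fin n → ℝ} (h : WallRatio f ρ)
    (hρ : ∀ b, 0 ≤ ρ b) (w : Fin n → Bool) :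
    f w ≤ f (fun _ => false) * ∏ b, if w b then ρ b else 1 := by
  have key : ∀ s : Finset (Fin n), f (fun b => decide (b ∈ s)) ≤
      f (fun _ => false) * ∏ b ∈ s, ρ b := by
    intro s
    induction s using Finset.induction_on with
    | empty => simp
    | insert a s ha ih =>
      have e : (fun b => decide (b ∈ insert a s)) = toggle a fun b => decide (b ∈ s) := by
        ext1 b
        by_cases hb : b = a
        · subst hb; simp [toggle_self, ha]
        · simp [toggle_of_ne _ hb, hb]
      rw [e, Finset.prod_insert ha]
      calc _ ≤ ρ a * f (fun b => decide (b ∈ s)) := h _ _ (by simp [ha])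
        _ ≤ ρ a * (f (fun _ => false) * ∏ b ∈ s, ρ b) := mul_le_mul_of_nonneg_left ih (hρ a)
        _ = _ := by ring
  have := key (Finset.univ.filter fun b => w b = true)
  rw [Finset.prod_filter] at this
  simpa using this

lemma walls_injective {n : ℕ} (k : Fin n) (hk : k.val = 0) :
    Function.Injective fun τ : Fin n → Bool => (τ k, walls τ) := by
  intro τ σ h
  simp only [Prod.mk.injEq] at h
  obtain ⟨h0, hw⟩ := h
  have key : ∀ j : ℕ, ∀ hj : j < n, τ ⟨j, hj⟩ = σ ⟨j, hj⟩ := by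
    intro j
    induction j with
    | zero =>
      intro hj
      have : (⟨0, hj⟩ : Fin n) = k := Fin.ext hk.symm
      rw [this, h0]
    | succ j ih =>
      intro hj
      have e := congrFun hw ⟨j, by omega⟩
      have hr : finRotate n ⟨j, by omega⟩ = ⟨j + 1, hj⟩ :=
        Fin.ext (by rw [val_finRotate, if_pos hj])
      simp only [walls, hr, ih (by omega)] at e
      exact Bool.xor_right_inj.mp e
  ext1 i
  exact key i.val i.2

/-- A configuration is determined by its walls and one of its values. -/
lemma sum_walls_le {n : ℕ} (hn : 0 < n) {g : (Fin n → Bool) → ℝ} (hg : ∀ w, 0 ≤ g w) :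
    ∑ τ : Fin n → Bool, g (walls τ) ≤ 2 * ∑ w, g w := by
  have h := Finset.sum_le_univ_sum_of_nonneg (s := Finset.univ.image fun τ : Fin n → Bool =>
    (τ ⟨0, hn⟩, walls τ)) (f := fun z : Bool × (Fin n → Bool) => g z.2) fun z => hg z.2
  rw [Finset.sum_image fun τ _ σ _ h => walls_injective ⟨0, hn⟩ rfl h, Fintype.sum_prod_type] at h
  simpa [two_mul] using h

/-- The bonds of layer `t` of a brick wall all of whose bonds satisfy `A`. -/
def layerBonds {n : ℕ} (A : Fin n → Prop) [DecidablePred A] (t : ℕ) : List (Fin n) :=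
  (List.finRange n).filter fun i => i.val % 2 = t % 2 ∧ A i

lemma mem_layerBonds {n : ℕ} {A : Fin n → Prop} [DecidablePred A] {t : ℕ} {i : Fin n} :
    i ∈ layerBonds A t ↔ i.val % 2 = t % 2 ∧ A i := by
  simp [layerBonds]

/-- The wall ratios after the layers `0, ..., t` of a brick wall: they decay like `(4/5)^t`, except at
the bonds where no gates act, where they stay bounded. -/
noncomputable def brickRatio {n : ℕ} (A : Fin n → Prop) [DecidablePred A] (t : ℕ) (b : Fin n) : ℝ :=
  if A b then (if b.val % 2 = t % 2 then 0 else 9 / 5 * (4 / 5) ^ t) else 9 * (1 - (4 / 5) ^ (t + 1))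

lemma brickRatio_nonneg {n : ℕ} (A : Fin n → Prop) [DecidablePred A] (t : ℕ) (b : Fin n) :
    0 ≤ brickRatio A t b := by
  unfold brickRatio
  have : ((4 : ℝ) / 5) ^ (t + 1) ≤ 1 := pow_le_one₀ (by norm_num) (by norm_num)
  split_ifs
  · exact le_rfl
  · positivity
  · linarith

lemma layerBonds_pairwise {n : ℕ} {A : Fin n → Prop} [DecidablePred A]
    (hA : ∀ i, A i → (finRotate n i).val % 2 ≠ i.val % 2) (t : ℕ) :
    (layerBonds A t).Pairwise fun a b => a ≠ b ∧ finRotate n a ≠ b ∧ finRotate n b ≠ a := by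
  have hnd : (layerBonds A t).Nodup := (List.nodup_finRange n).filter _
  refine List.Pairwise.imp_of_mem ?_ hnd
  intro a b ha hb hab
  rw [mem_layerBonds] at ha hb
  refine ⟨hab, fun e => hA a ha.2 ?_, fun e => hA b hb.2 ?_⟩
  · rw [e, ha.1, hb.1]
  · rw [e, ha.1, hb.1]

lemma wallRatio_brick {n : ℕ} (hn : 3 ≤ n) {A : Fin n → Prop} [DecidablePred A]
    (hA : ∀ i, A i → (finRotate n i).val % 2 ≠ i.val % 2) (t : ℕ) :
    (∀ w, 0 ≤ evolveWalls ((List.range (t + 1)).flatMap (layerBonds A)) w) ∧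
    WallRatio (evolveWalls ((List.range (t + 1)).flatMap (layerBonds A))) (brickRatio A t) := by
  have step : ∀ t, evolveWalls ((List.range (t + 1)).flatMap (layerBonds A)) =
      (layerBonds A t).foldl (fun f g => pushWalls g f)
        (evolveWalls ((List.range t).flatMap (layerBonds A))) := by
    intro t
    simp [List.range_succ, evolveWalls, List.flatMap_append]
  have nonneg : ∀ t w, 0 ≤ evolveWalls ((List.range t).flatMap (layerBonds A)) w := fun t w =>
    foldl_pushWalls_nonneg _ (fun _ => zero_le_one) w
  refine ⟨nonneg _, ?_⟩
  induction t with
  | zero =>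
    rw [step]
    have h0 : WallRatio (evolveWalls ((List.range 0).flatMap (layerBonds A))) fun _ => 1 := by
      intro w b _
      simp [evolveWalls]
    refine (h0.layer hn (nonneg 0) (fun _ => zero_le_one) _ (layerBonds_pairwise hA 0)).mono
      (by rw [← step]; exact nonneg _) fun b => ?_
    have hb : (if b ∈ layerBonds A 0 then (0 : ℝ) else 1 + 2 / 5 *
        ((if (finRotate n).symm b ∈ layerBonds A 0 then 1 else 0) +
          if finRotate n b ∈ layerBonds A 0 then 1 else 0)) ≤
        if b ∈ layerBonds A 0 then 0 else 9 / 5 := by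
      split_ifs <;> norm_num
    refine hb.trans ?_
    unfold brickRatio
    simp only [mem_layerBonds]
    split_ifs <;> first | tauto | norm_num
  | succ t ih =>
    rw [step]
    refine (ih.layer hn (nonneg _) (brickRatio_nonneg A t) _ (layerBonds_pairwise hA (t + 1))).mono
      (by rw [← step]; exact nonneg _) fun b => ?_
    have hv : ∀ c, (if c ∈ layerBonds A (t + 1) then brickRatio A t c else 0) ≤
        9 / 5 * (4 / 5) ^ t := by
      intro c
      split_ifs with hc
      · rw [mem_layerBonds] at hc
        rw [brickRatio, if_pos hc.2, if_neg (by omega)]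
      · positivity
    have h1 := hv ((finRotate n).symm b)
    have h2 := hv (finRotate n b)
    by_cases hb : b ∈ layerBonds A (t + 1)
    · rw [if_pos hb]; exact brickRatio_nonneg _ _ _
    · rw [if_neg hb]
      rw [mem_layerBonds] at hb
      by_cases hAb : A b
      · have e1 : brickRatio A t b = 0 := by
          rw [brickRatio, if_pos hAb, if_pos]
          have : ¬ b.val % 2 = (t + 1) % 2 := fun h => hb ⟨h, hAb⟩
          omega
        have e2 : brickRatio A (t + 1) b = 9 / 5 * (4 / 5) ^ (t + 1) := by
          rw [brickRatio, if_pos hAb, if_neg fun h => hb ⟨h, hAb⟩]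
        rw [e1, e2, pow_succ]
        linarith
      · have e1 : brickRatio A t b = 9 * (1 - (4 / 5) ^ (t + 1)) := by rw [brickRatio, if_neg hAb]
        have e2 : brickRatio A (t + 1) b = 9 * (1 - (4 / 5) ^ (t + 1 + 1)) := by
          rw [brickRatio, if_neg hAb]
        rw [e1, e2]
        simp only [pow_succ]
        linarith

/-- The collision bound for a brick wall on the chain or the ring. -/
lemma pushList_brick_le {n : ℕ} (hn : 3 ≤ n) {A : Fin n → Prop} [DecidablePred A]
    (hA : ∀ i, A i → (finRotate n i).val % 2 ≠ i.val % 2) (hA' : ∀ i : Fin n, i.val + 1 < n → A i)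
    (t : ℕ) :
    pushList (((List.range (t + 1)).flatMap (layerBonds A)).map fun i => (i, finRotate n i))
      (fun _ => 1) (fun _ => none) ≤ 30 * (1 / 2) ^ n * (1 + 9 / 5 * (4 / 5) ^ t) ^ n := by
  set gs := (List.range (t + 1)).flatMap (layerBonds A) with hgs
  have hl : ∀ p ∈ gs.map fun i => (i, finRotate n i), p.1 ≠ p.2 := by
    intro p hp
    obtain ⟨i, _, rfl⟩ := List.mem_map.mp hp
    exact (finRotate_ne_self hn i).symm
  rw [pushList_none _ hl]
  -- Every qubit except possibly the last is acted on in layer `0`.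
  have hu : (untouched (gs.map fun i => (i, finRotate n i))).card ≤ 1 := by
    rw [Finset.card_le_one]
    have last : ∀ k ∈ untouched (gs.map fun i => (i, finRotate n i)), k.val + 1 = n := by
      intro k hk
      rw [mem_untouched] at hk
      by_contra hne
      have hkn := k.2
      have hmem : ∀ i : Fin n, i.val % 2 = 0 → i.val + 1 < n → (i, finRotate n i) ∈
          gs.map fun i => (i, finRotate n i) := by
        intro i hi hi'
        refine List.mem_map_of_mem (List.mem_flatMap.mpr ⟨0, by simp, ?_⟩)
        rw [mem_layerBonds]
        exact ⟨by simpa using hi, hA' i hi'⟩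
      rcases Nat.mod_two_eq_zero_or_one k.val with h | h
      · exact (hk _ (hmem k h (by omega))).1 rfl
      · have hv : (⟨k.val - 1, by omega⟩ : Fin n).val = k.val - 1 := rfl
        refine (hk _ (hmem ⟨k.val - 1, by omega⟩ (by omega) (by omega))).2 (Fin.ext ?_)
        simp only [val_finRotate]
        split_ifs <;> omega
    intro a ha b hb
    exact Fin.ext (by have := last a ha; have := last b hb; omega)
  have hu' : ((3 : ℝ) / 2) ^ (untouched (gs.map fun i => (i, finRotate n i))).card ≤ 3 / 2 := by
    calc _ ≤ ((3 : ℝ) / 2) ^ 1 := pow_le_pow_right₀ (by norm_num) hu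
      _ = _ := by norm_num
  obtain ⟨hnn, hr⟩ := wallRatio_brick hn hA t
  rw [← hgs] at hnn hr
  have hempty : evolveWalls gs (fun _ => false) ≤ (3 / 2) ^ n := by
    have h := evolve_const_le (gs.map fun i => (i, finRotate n i)) hl false
    have hw : walls (fun _ : Fin n => false) = fun _ => false := by ext1 i; simp [walls]
    rwa [evolve_eq_evolveWalls hn, hw] at h
  set β : ℝ := 9 / 5 * (4 / 5) ^ t with hβ
  have hβ0 : 0 ≤ β := by positivity
  -- At most one bond of the ring, the last, carries no gates.
  have hprod : ∏ b : Fin n, (1 + brickRatio A t b) ≤ 10 * (1 + β) ^ n := by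
    have hlast : ∀ b : Fin n, 1 + brickRatio A t b ≤
        (if b = ⟨n - 1, by omega⟩ then 10 else 1) * (1 + β) := by
      intro b
      by_cases hb : A b
      · have h1 : brickRatio A t b ≤ β := by
          rw [brickRatio, if_pos hb]; split_ifs <;> [exact hβ0; exact le_rfl]
        split_ifs <;> linarith
      · have hbn : b = ⟨n - 1, by omega⟩ := by
          refine Fin.ext ?_
          have := b.2
          have h2 : ¬ (b.val + 1 < n) := fun h => hb (hA' b h)
          simp only
          omega
        rw [if_pos hbn, brickRatio, if_neg hb]
        have : (0 : ℝ) ≤ (4 / 5) ^ (t + 1) := by positivity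
        linarith
    calc _ ≤ ∏ b : Fin n, (if b = ⟨n - 1, by omega⟩ then (10 : ℝ) else 1) * (1 + β) :=
          Finset.prod_le_prod (fun b _ => by have := brickRatio_nonneg A t b; positivity)
            fun b _ => hlast b
      _ = _ := by rw [Finset.prod_mul_distrib]; simp
  have hmass : ∑ τ, evolve (gs.map fun i => (i, finRotate n i)) τ ≤
      2 * ((3 / 2) ^ n * (10 * (1 + β) ^ n)) := by
    have e : ∀ τ : Fin n → Bool, evolve (gs.map fun i => (i, finRotate n i)) τ =
        evolveWalls gs (walls τ) := evolve_eq_evolveWalls hn gs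
    rw [Finset.sum_congr rfl fun τ _ => e τ]
    refine (sum_walls_le (by omega) hnn).trans ?_
    gcongr
    calc ∑ w, evolveWalls gs w ≤ ∑ w : Fin n → Bool, evolveWalls gs (fun _ => false) *
          ∏ b, (if w b then brickRatio A t b else 1) :=
          Finset.sum_le_sum fun w _ => hr.le_prod (brickRatio_nonneg A t) w
      _ = evolveWalls gs (fun _ => false) * ∏ b, (1 + brickRatio A t b) := by
          rw [← Finset.mul_sum, ← Fintype.piFinset_univ, ← Finset.prod_univ_sum
            (fun _ => Finset.univ) fun b (x : Bool) => if x then brickRatio A t b else 1]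
          simp [add_comm]
      _ ≤ _ := mul_le_mul hempty hprod (Finset.prod_nonneg fun b _ => by
          have := brickRatio_nonneg A t b; positivity) (by positivity)
  calc _ ≤ 3 / 2 * (1 / 3) ^ n * (2 * ((3 / 2) ^ n * (10 * (1 + β) ^ n))) :=
        mul_le_mul (mul_le_mul_of_nonneg_right hu' (by positivity)) hmass
          (Finset.sum_nonneg fun τ _ => evolve_nonneg _ τ) (by positivity)
    _ = 30 * ((1 / 3) ^ n * (3 / 2) ^ n) * (1 + β) ^ n := by ring
    _ = _ := by rw [← mul_pow]; norm_num

lemma chain_eq {n : ℕ} (τ : ℕ) : chain n τ = ((List.range τ).flatMap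
    (layerBonds fun i : Fin n => i.val + 1 < n)).map fun i => (i, finRotate n i) := by
  rw [List.map_flatMap]
  rfl

lemma ring_eq {n : ℕ} (τ : ℕ) : ring n τ = ((List.range τ).flatMap
    (layerBonds fun _ : Fin n => True)).map fun i => (i, finRotate n i) := by
  rw [List.map_flatMap]
  simp only [ring, layerBonds, and_true]
  rfl

lemma pushList_chain_le {n : ℕ} (hn : 3 ≤ n) (t : ℕ) : pushList (chain n (t + 1)) (fun _ => 1)
    (fun _ => none) ≤ 30 * (1 / 2) ^ n * (1 + 9 / 5 * (4 / 5) ^ t) ^ n := by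
  rw [chain_eq]
  refine pushList_brick_le hn (fun i hi => ?_) (fun i hi => hi) t
  rw [val_finRotate, if_pos hi]
  omega

lemma pushList_ring_le {n : ℕ} (hn : 3 ≤ n) (he : Even n) (t : ℕ) : pushList (ring n (t + 1))
    (fun _ => 1) (fun _ => none) ≤ 30 * (1 / 2) ^ n * (1 + 9 / 5 * (4 / 5) ^ t) ^ n := by
  rw [ring_eq]
  refine pushList_brick_le hn (fun i _ => ?_) (fun i _ => trivial) t
  obtain ⟨m, hm⟩ := he
  have := i.2
  rw [val_finRotate]
  split_ifs <;> omega

/-! ### Averages over random placements -/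

/-- The adjoint evolution along a list of gates; the first gate of the list acts last. -/
noncomputable def pullList {n : ℕ} (l : List (Fin n × Fin n)) (w : (Fin n → Bool) → ℝ) :
    (Fin n → Bool) → ℝ :=
  l.foldr pull w

lemma pullList_append {n : ℕ} (l l' : List (Fin n × Fin n)) (w : (Fin n → Bool) → ℝ) :
    pullList (l ++ l') w = pullList l (pullList l' w) := by simp [pullList]

lemma sum_evolve_mul {n : ℕ} (l : List (Fin n × Fin n)) (hl : ∀ p ∈ l, p.1 ≠ p.2)
    (w : (Fin n → Bool) → ℝ) : ∑ τ, evolve l τ * w τ = ∑ τ, pullList l w τ := by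
  induction l using List.reverseRecOn generalizing w with
  | nil => simp [evolve, pullList]
  | append_singleton l p ih =>
    rw [evolve_append_singleton, sum_push₂_mul (hl p (by simp)),
      ih (fun q hq => hl q (by simp [hq])), pullList_append]
    rfl

lemma pull_mono {n : ℕ} (p : Fin n × Fin n) {w w' : (Fin n → Bool) → ℝ} (h : ∀ τ, w τ ≤ w' τ)
    (τ : Fin n → Bool) : pull p w τ ≤ pull p w' τ := by
  unfold pull
  split_ifs
  · exact h τ
  · linarith [h (setPair p τ (false, false)), h (setPair p τ (true, true))]

lemma pullList_mono {n : ℕ} (l : List (Fin n × Fin n)) {w w' : (Fin n → Bool) → ℝ}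
    (h : ∀ τ, w τ ≤ w' τ) (τ : Fin n → Bool) : pullList l w τ ≤ pullList l w' τ := by
  induction l generalizing τ with
  | nil => exact h τ
  | cons p l ih => exact pull_mono p ih τ

lemma pull_linear {n : ℕ} {ι : Type*} (s : Finset ι) (p : Fin n × Fin n) (a : ι → ℝ)
    (w : ι → (Fin n → Bool) → ℝ) (τ : Fin n → Bool) :
    pull p (fun σ => ∑ i ∈ s, a i * w i σ) τ = ∑ i ∈ s, a i * pull p (w i) τ := by
  unfold pull
  split_ifs
  · rfl
  · rw [← Finset.sum_add_distrib, Finset.mul_sum]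
    exact Finset.sum_congr rfl fun i _ => by ring

lemma pullList_linear {n : ℕ} {ι : Type*} (s : Finset ι) (l : List (Fin n × Fin n)) (a : ι → ℝ)
    (w : ι → (Fin n → Bool) → ℝ) (τ : Fin n → Bool) :
    pullList l (fun σ => ∑ i ∈ s, a i * w i σ) τ = ∑ i ∈ s, a i * pullList l (w i) τ := by
  induction l generalizing τ with
  | nil => rfl
  | cons p l ih =>
    have : pullList l (fun σ => ∑ i ∈ s, a i * w i σ) =
      fun σ => ∑ i ∈ s, a i * pullList l (w i) σ := funext ih
    change pull p (pullList l fun σ => ∑ i ∈ s, a i * w i σ) τ = _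
    rw [this, pull_linear]
    rfl

lemma pullList_const_mul {n : ℕ} (l : List (Fin n × Fin n)) (a : ℝ)
    (w : (Fin n → Bool) → ℝ) (τ : Fin n → Bool) :
    pullList l (fun σ => a * w σ) τ = a * pullList l w τ := by
  simpa using pullList_linear {()} l (fun _ => a) (fun _ => w) τ

lemma pullList_add {n : ℕ} (l : List (Fin n × Fin n))
    (w w' : (Fin n → Bool) → ℝ) (τ : Fin n → Bool) :
    pullList l (fun σ => w σ + w' σ) τ = pullList l w τ + pullList l w' τ := by
  simpa using pullList_linear Finset.univ l (fun _ : Bool => 1) (fun b => if b then w else w') τ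

lemma pullList_one_le {n : ℕ} (l : List (Fin n × Fin n)) (τ : Fin n → Bool) :
    pullList l (fun _ => 1) τ ≤ 1 := by
  induction l generalizing τ with
  | nil => exact le_rfl
  | cons p l ih =>
    refine (pull_mono p ih τ).trans ?_
    unfold pull
    split_ifs <;> norm_num

section avgOp
variable {n : ℕ} {α : Type} [Fintype α]

/-- The adjoint evolution averaged over a uniformly random layer. -/
noncomputable def avgOp (layer : α → List (Fin n × Fin n)) (w : (Fin n → Bool) → ℝ)
    (τ : Fin n → Bool) : ℝ :=
  (∑ x, pullList (layer x) w τ) / Fintype.card α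

lemma avgOp_mono (layer : α → List (Fin n × Fin n)) {w w' : (Fin n → Bool) → ℝ}
    (h : ∀ τ, w τ ≤ w' τ) (τ : Fin n → Bool) : avgOp layer w τ ≤ avgOp layer w' τ :=
  div_le_div_of_nonneg_right (Finset.sum_le_sum fun x _ => pullList_mono (layer x) h τ)
    (Nat.cast_nonneg _)

lemma avgOp_const_mul (layer : α → List (Fin n × Fin n)) (a : ℝ) (w : (Fin n → Bool) → ℝ)
    (τ : Fin n → Bool) : avgOp layer (fun σ => a * w σ) τ = a * avgOp layer w τ := by
  simp only [avgOp, pullList_const_mul, ← Finset.mul_sum, mul_div_assoc]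

/-- The adjoint evolution averaged over `m` independent random layers, applied to the constant
function `1`. -/
noncomputable def avgMass (layer : α → List (Fin n × Fin n)) (m : ℕ) : (Fin n → Bool) → ℝ :=
  (avgOp layer)^[m] fun _ => 1

lemma avgMass_succ (layer : α → List (Fin n × Fin n)) (m : ℕ) :
    avgMass layer (m + 1) = avgOp layer (avgMass layer m) :=
  Function.iterate_succ_apply' _ _ _

lemma avgMass_succ_le [Nonempty α] (layer : α → List (Fin n × Fin n)) (m : ℕ) (τ : Fin n → Bool) :
    avgMass layer (m + 1) τ ≤ avgMass layer m τ := by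
  induction m generalizing τ with
  | zero =>
    rw [avgMass_succ]
    change (∑ x, pullList (layer x) (fun _ => 1) τ) / (Fintype.card α : ℝ) ≤ 1
    have hc : (0 : ℝ) < Fintype.card α := by exact_mod_cast Fintype.card_pos
    rw [div_le_one hc]
    refine (Finset.sum_le_sum fun x _ => pullList_one_le (layer x) τ).trans ?_
    simp
  | succ m ih =>
    rw [avgMass_succ _ (m + 1), avgMass_succ _ m]
    refine avgOp_mono layer (fun σ => ?_) τ
    rw [← avgMass_succ]
    exact ih σ

lemma avgMass_antitone [Nonempty α] (layer : α → List (Fin n × Fin n)) {m m' : ℕ} (h : m ≤ m')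
    (τ : Fin n → Bool) : avgMass layer m' τ ≤ avgMass layer m τ :=
  antitone_nat_of_succ_le (f := fun m => avgMass layer m τ)
    (fun m => avgMass_succ_le layer m τ) h

lemma sum_pullList_eq [Nonempty α] (layer : α → List (Fin n × Fin n)) (m : ℕ) (τ : Fin n → Bool) :
    ∑ e : Fin m → α, pullList ((List.finRange m).flatMap fun t => layer (e t)) (fun _ => 1) τ =
      (Fintype.card α : ℝ) ^ m * avgMass layer m τ := by
  have hc : (Fintype.card α : ℝ) ≠ 0 := by exact_mod_cast Fintype.card_ne_zero
  induction m generalizing τ with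
  | zero => simp [pullList, avgMass]
  | succ m ih =>
    rw [← (Fin.consEquiv fun _ => α).sum_comp, Fintype.sum_prod_type]
    have h : ∀ (x : α) (e : Fin m → α),
        pullList ((List.finRange (m + 1)).flatMap fun t =>
          layer ((Fin.consEquiv fun _ => α) (x, e) t)) (fun _ => 1) τ =
        pullList (layer x) (pullList ((List.finRange m).flatMap fun t => layer (e t))
          fun _ => 1) τ := by
      intro x e
      rw [List.finRange_succ, List.flatMap_cons, pullList_append, List.flatMap_map]
      rfl
    simp only [h]
    have h2 : ∀ x : α, ∑ e : Fin m → α, pullList (layer x)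
        (pullList ((List.finRange m).flatMap fun t => layer (e t)) fun _ => 1) τ =
        (Fintype.card α : ℝ) ^ m * pullList (layer x) (avgMass layer m) τ := by
      intro x
      have := pullList_linear Finset.univ (layer x) (fun _ : Fin m → α => 1)
        (fun e => pullList ((List.finRange m).flatMap fun t => layer (e t)) fun _ => 1) τ
      simp only [one_mul] at this
      rw [← this, ← pullList_const_mul]
      congr 1
      ext1 σ
      exact ih σ
    rw [Finset.sum_congr rfl fun x _ => h2 x, avgMass_succ, avgOp, ← Finset.mul_sum, pow_succ]
    field_simp

/-- If the averaged operator maps `ψ t` below `c • ψ (t + 1)`, then the averaged mass is below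
`A • c ^ m • ψ m`. -/
lemma avgMass_le (layer : α → List (Fin n × Fin n)) (ψ : ℕ → (Fin n → Bool) → ℝ) {A c : ℝ}
    (hA : 0 ≤ A) (hc : 0 ≤ c) (h0 : ∀ τ, 1 ≤ A * ψ 0 τ)
    (hstep : ∀ t τ, avgOp layer (ψ t) τ ≤ c * ψ (t + 1) τ) (m : ℕ) (τ : Fin n → Bool) :
    avgMass layer m τ ≤ A * c ^ m * ψ m τ := by
  induction m generalizing τ with
  | zero => simpa [avgMass] using h0 τ
  | succ m ih =>
    rw [avgMass_succ]
    refine (avgOp_mono layer ih τ).trans ?_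
    rw [avgOp_const_mul, pow_succ]
    calc A * c ^ m * avgOp layer (ψ m) τ ≤ A * c ^ m * (c * ψ (m + 1) τ) :=
          mul_le_mul_of_nonneg_left (hstep m τ) (by positivity)
      _ = _ := by ring

end avgOp

/-! ### The potential -/

/-- The number of places with label `true`. -/
def count {n : ℕ} (τ : Fin n → Bool) : ℕ := (Finset.univ.filter fun k => τ k = true).card

lemma count_le {n : ℕ} (τ : Fin n → Bool) : count τ ≤ n := by
  simpa [count] using Finset.card_filter_le (Finset.univ : Finset (Fin n)) fun k => τ k = true

lemma prodWeight_eq {n : ℕ} (v : Bool → ℝ) (τ : Fin n → Bool) :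
    prodWeight v τ = v true ^ count τ * v false ^ (n - count τ) := by
  have h : ∀ k, v (τ k) = if τ k = true then v true else v false := by
    intro k; cases τ k <;> simp
  unfold prodWeight count
  rw [Finset.prod_congr rfl fun k _ => h k, Finset.prod_ite, Finset.prod_const, Finset.prod_const]
  congr 2
  have := Finset.card_filter_add_card_filter_not (s := Finset.univ) fun k => τ k = true
  rw [Finset.card_univ, Fintype.card_fin] at this
  omega

/-- The potential `a^k + a^(n-k)` of a configuration with `k` labels `true`. At `a = 1/2` it is
invariant under the adjoint evolution. -/
noncomputable def potential {n : ℕ} (a : ℝ) (τ : Fin n → Bool) : ℝ :=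
  a ^ count τ + a ^ (n - count τ)

lemma potential_eq {n : ℕ} (a : ℝ) (τ : Fin n → Bool) : potential a τ =
    prodWeight (fun b => if b then a else 1) τ + prodWeight (fun b => if b then 1 else a) τ := by
  simp [potential, prodWeight_eq]

lemma sum_potential {n : ℕ} (a : ℝ) : ∑ τ : Fin n → Bool, potential a τ = 2 * (1 + a) ^ n := by
  simp only [potential_eq, Finset.sum_add_distrib, sum_prodWeight]
  simp only [Bool.false_eq_true, if_false, if_true]
  ring

/-- The product over the pairs in `l` of `1` or `θ`, according to whether the labels at the pair
agree. -/
noncomputable def cutWeight {n : ℕ} (θ : ℝ) (l : List (Fin n × Fin n)) (τ : Fin n → Bool) : ℝ :=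
  (l.map fun p => if τ p.1 = τ p.2 then 1 else θ).prod

/-- Two pairs without a common element. -/
def DisjointPairs {n : ℕ} (p q : Fin n × Fin n) : Prop :=
  q.1 ≠ p.1 ∧ q.1 ≠ p.2 ∧ q.2 ≠ p.1 ∧ q.2 ≠ p.2

lemma cutWeight_setPair {n : ℕ} (θ : ℝ) {l : List (Fin n × Fin n)} {p : Fin n × Fin n}
    (h : ∀ q ∈ l, DisjointPairs p q) (τ : Fin n → Bool) (x : Bool × Bool) :
    cutWeight θ l (setPair p τ x) = cutWeight θ l τ := by
  unfold cutWeight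
  congr 1
  refine List.map_congr_left fun q hq => ?_
  obtain ⟨h1, h2, h3, h4⟩ := h q hq
  rw [setPair_of_ne _ _ _ h1 h2, setPair_of_ne _ _ _ h3 h4]

lemma pullList_prodWeight {n : ℕ} {l : List (Fin n × Fin n)} (hl : ∀ p ∈ l, p.1 ≠ p.2)
    (hd : l.Pairwise DisjointPairs) {v : Bool → ℝ} {θ : ℝ}
    (h : 2 / 5 * (v false ^ 2 + v true ^ 2) = θ * (v false * v true)) (τ : Fin n → Bool) :
    pullList l (prodWeight v) τ = cutWeight θ l τ * prodWeight v τ := by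
  induction l generalizing τ with
  | nil => simp [pullList, cutWeight]
  | cons p l ih =>
    rw [List.pairwise_cons] at hd
    have ih' : pullList l (prodWeight v) = fun τ => cutWeight θ l τ * prodWeight v τ :=
      funext fun σ => ih (fun q hq => hl q (List.mem_cons_of_mem _ hq)) hd.2 σ
    change pull p (pullList l (prodWeight v)) τ = _
    have e := pull_prodWeight (hl p (List.mem_cons_self ..)) h τ
    have ec : cutWeight θ (p :: l) τ = (if τ p.1 = τ p.2 then 1 else θ) * cutWeight θ l τ := by
      simp [cutWeight]
    rw [ih', ec, mul_right_comm, ← e]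
    unfold pull
    simp only [cutWeight_setPair θ hd.1]
    split_ifs <;> ring

lemma pullList_potential {n : ℕ} {l : List (Fin n × Fin n)} (hl : ∀ p ∈ l, p.1 ≠ p.2)
    (hd : l.Pairwise DisjointPairs) {a : ℝ} (ha : 0 < a) (τ : Fin n → Bool) :
    pullList l (potential a) τ = cutWeight (2 / 5 * (a + 1 / a)) l τ * potential a τ := by
  have e : (potential a : (Fin n → Bool) → ℝ) = fun τ =>
      prodWeight (fun b => if b then a else 1) τ + prodWeight (fun b => if b then 1 else a) τ :=
    funext fun τ => potential_eq a τ
  have h : 2 / 5 * (1 + a ^ 2) = 2 / 5 * (a + 1 / a) * a := by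
    field_simp; ring
  rw [e, pullList_add, pullList_prodWeight hl hd (θ := 2 / 5 * (a + 1 / a)),
    pullList_prodWeight hl hd (θ := 2 / 5 * (a + 1 / a))]
  · ring
  · simp only [Bool.false_eq_true, if_false, if_true]; linarith
  · simp only [Bool.false_eq_true, if_false, if_true]; linarith

lemma cutWeight_nonneg {n : ℕ} {θ : ℝ} (h : 0 ≤ θ) (l : List (Fin n × Fin n)) (τ : Fin n → Bool) :
    0 ≤ cutWeight θ l τ :=
  List.prod_nonneg fun x hx => by
    obtain ⟨p, _, rfl⟩ := List.mem_map.mp hx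
    split_ifs <;> [exact zero_le_one; exact h]

lemma cutWeight_mono {n : ℕ} {θ θ' : ℝ} (h0 : 0 ≤ θ) (h : θ ≤ θ') (l : List (Fin n × Fin n))
    (τ : Fin n → Bool) : cutWeight θ l τ ≤ cutWeight θ' l τ := by
  induction l with
  | nil => simp [cutWeight]
  | cons p l ih =>
    have ec : ∀ θ : ℝ, cutWeight θ (p :: l) τ =
        (if τ p.1 = τ p.2 then 1 else θ) * cutWeight θ l τ := by simp [cutWeight]
    rw [ec, ec]
    refine mul_le_mul ?_ ih (cutWeight_nonneg h0 l τ) ?_ <;> split_ifs <;> linarith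

lemma potential_pos {n : ℕ} {a : ℝ} (ha : 0 < a) (τ : Fin n → Bool) : 0 < potential a τ := by
  unfold potential; positivity

/-- The factor lost at a cut, `1 - 2/5 (a + 1/a)`, is at least `1/1000` for `a` slightly above
`1/2`. -/
lemma two_fifths_le {a : ℝ} (h1 : 0.501 ≤ a) (h2 : a ≤ 1) : 2 / 5 * (a + 1 / a) ≤ 999 / 1000 := by
  have ha : 0 < a := by linarith
  rw [show 2 / 5 * (a + 1 / a) = (2 / 5 * a ^ 2 + 2 / 5) / a by field_simp, div_le_iff₀ ha]
  nlinarith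

/-! ### Random pairs -/

lemma nat_mul_pow_le {a : ℝ} (ha : 0 < a) (ha' : a ≤ 0.9995) (y : ℕ) : y * a ^ y ≤ 2000 := by
  have h1 : a ^ y ≤ (0.9995 : ℝ) ^ y := by gcongr
  have h2 : 1 + (y : ℝ) * (1 / 1999) ≤ (1 + 1 / 1999) ^ y :=
    one_add_mul_le_pow (by norm_num) y
  have h3 : (0.9995 : ℝ) ^ y * (1 + 1 / 1999) ^ y = 1 := by
    rw [← mul_pow]; norm_num
  have hp : (0 : ℝ) < 0.9995 ^ y := by positivity
  have h4 : (y : ℝ) * 0.9995 ^ y ≤ 2000 := by nlinarith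
  calc (y : ℝ) * a ^ y ≤ y * 0.9995 ^ y := by gcongr
    _ ≤ 2000 := h4

/-- The decay of the potential under one random gate, up to a relative error of order `1 / n`. The
decay rate of `a ^ j`, for the larger exponent `j`, is not enough by itself; the defect is at most
`(j - k) a ^ (j - k) / n` relative to `a ^ k`, which is `O(1 / n)`. -/
lemma potential_step_aux {k j : ℕ} (hkj : k ≤ j) (hn : 0 < k + j) {a b η : ℝ} (ha : 0 < a)
    (ha' : a ≤ 0.9995) (hη : 0 ≤ η) (hη' : η ≤ 1) (hb : a * Real.exp (-(η / (k + j : ℝ))) ≤ b) :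
    (a ^ k + a ^ j) * Real.exp (-(2 * η * k * j / (k + j : ℝ) ^ 2)) ≤
      (1 + 2000 / (k + j : ℝ)) * (b ^ k + b ^ j) := by
  set N : ℝ := (k + j : ℝ) with hN
  have hN0 : 0 < N := by rw [hN]; exact_mod_cast hn
  obtain ⟨y, rfl⟩ := Nat.exists_eq_add_of_le hkj
  push_cast at hN
  set E := Real.exp (-(η * k / N)) with hE
  have hE0 : 0 < E := Real.exp_pos _
  have hX : 0 < a ^ k := by positivity
  have hb0 : 0 < a * Real.exp (-(η / N)) := by positivity
  have hbk : a ^ k * E ≤ b ^ k := by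
    calc a ^ k * E = (a * Real.exp (-(η / N))) ^ k := by
          rw [mul_pow, ← Real.exp_nat_mul, hE]; congr 2; ring
      _ ≤ b ^ k := by gcongr
  have hbj : a ^ (k + y) * (E * (1 - η * y / N)) ≤ b ^ (k + y) := by
    calc a ^ (k + y) * (E * (1 - η * y / N)) ≤ a ^ (k + y) * (E * Real.exp (-(η * y / N))) := by
          gcongr
          have := Real.add_one_le_exp (-(η * y / N))
          linarith
      _ = (a * Real.exp (-(η / N))) ^ (k + y) := by
          rw [mul_pow, ← Real.exp_nat_mul, hE, ← Real.exp_add]; congr 2; push_cast; ring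
      _ ≤ b ^ (k + y) := by gcongr
  have hexp : Real.exp (-(2 * η * k * (k + y : ℕ) / N ^ 2)) ≤ E := by
    rw [hE]
    apply Real.exp_le_exp.mpr
    rw [neg_le_neg_iff]
    have : 2 * η * k * ((k + y : ℕ) : ℝ) / N ^ 2 = η * k / N * (2 * (k + y : ℕ) / N) := by
      field_simp
    rw [this]
    apply le_mul_of_one_le_right (by positivity)
    rw [le_div_iff₀ hN0, hN]
    push_cast
    have : (0 : ℝ) ≤ y := by positivity
    linarith
  have hy := nat_mul_pow_le ha ha' y
  have hay : a ^ y ≤ 1 := pow_le_one₀ ha.le (by linarith)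
  have hyN : (y : ℝ) / N ≤ 1 := by
    rw [div_le_one hN0, hN]
    have : (0 : ℝ) ≤ k := by positivity
    linarith
  have hu : η * y / N ≤ 1 := by
    rw [mul_div_assoc]
    exact mul_le_one₀ hη' (by positivity) hyN
  have hay0 : 0 < a ^ y := by positivity
  calc (a ^ k + a ^ (k + y)) * Real.exp (-(2 * η * k * (k + y : ℕ) / N ^ 2))
      ≤ (a ^ k + a ^ (k + y)) * E := by gcongr
    _ = a ^ k * E * (1 + a ^ y) := by rw [pow_add]; ring
    _ ≤ a ^ k * E * ((1 + 2000 / N) * (1 + a ^ y * (1 - η * y / N))) := by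
        gcongr
        have h1 : a ^ y * (η * y / N) ≤ 2000 / N := by
          calc a ^ y * (η * y / N) = η * (y * a ^ y) / N := by ring
            _ ≤ 1 * 2000 / N := by gcongr
            _ = 2000 / N := by ring
        have h2 : 0 ≤ 2000 / N * (a ^ y * (1 - η * y / N)) :=
          mul_nonneg (by positivity) (mul_nonneg hay0.le (by linarith))
        linarith
    _ = (1 + 2000 / N) * (a ^ k * E + a ^ (k + y) * (E * (1 - η * y / N))) := by rw [pow_add]; ring
    _ ≤ _ := by gcongr

lemma potential_step {n : ℕ} (hn : 0 < n) {a b η : ℝ} (ha : 0 < a)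
    (ha' : a ≤ 0.9995) (hη : 0 ≤ η) (hη' : η ≤ 1) (hb : a * Real.exp (-(η / n)) ≤ b)
    (τ : Fin n → Bool) :
    potential a τ * Real.exp (-(2 * η * count τ * (n - count τ : ℕ) / (n : ℝ) ^ 2)) ≤
      (1 + 2000 / (n : ℝ)) * potential b τ := by
  have hc := count_le τ
  have e : (n : ℝ) = (count τ : ℝ) + (n - count τ : ℕ) := by
    rw [← Nat.cast_add, Nat.add_sub_cancel' hc]
  unfold potential
  rcases le_total (count τ) (n - count τ) with h | h
  · have := potential_step_aux (b := b) h (by omega) ha ha' hη hη' (by rw [← e]; exact hb)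
    rw [← e] at this
    exact this
  · have e' : (n : ℝ) = (n - count τ : ℕ) + (count τ : ℝ) := by rw [add_comm]; exact e
    have := potential_step_aux (b := b) h (by omega) ha ha' hη hη' (by rw [← e']; exact hb)
    rw [← e'] at this
    rw [add_comm (a ^ _), add_comm (b ^ _), mul_right_comm (2 * η)]
    exact this

/-- Ordered pairs of distinct qubits. -/
abbrev Pairs (n : ℕ) : Type := {p : Fin n × Fin n // p.1 ≠ p.2}

lemma card_pairs (n : ℕ) : Fintype.card (Pairs n) = n * (n - 1) := by
  have h : (Finset.univ.filter fun p : Fin n × Fin n => p.1 ≠ p.2) = Finset.univ.offDiag := by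
    ext p; simp
  rw [Fintype.card_subtype, h, Finset.offDiag_card, Finset.card_univ, Fintype.card_fin,
    Nat.mul_sub_one]

/-- The number of pairs at which a configuration takes different values. -/
lemma card_cut {n : ℕ} (τ : Fin n → Bool) :
    (Finset.univ.filter fun p : Pairs n => τ p.1.1 ≠ τ p.1.2).card = 2 * (count τ * (n - count τ)) := by
  have h1 : (Finset.univ.filter fun p : Pairs n => τ p.1.1 ≠ τ p.1.2).card =
      (Finset.univ.filter fun p : Fin n × Fin n => τ p.1 ≠ τ p.2).card := by
    refine Finset.card_nbij (fun p => p.1) (fun p hp => by simpa using hp) (fun a _ b _ h => Subtype.ext h) ?_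
    intro p hp
    simp only [Finset.coe_filter, Finset.mem_univ, true_and, Set.mem_ofPred_eq] at hp
    exact ⟨⟨p, fun h => hp (by rw [h])⟩, by simpa using hp, rfl⟩
  have hT : (Finset.univ.filter fun k => τ k = true).card = count τ := rfl
  have hF : (Finset.univ.filter fun k => ¬ τ k = true).card = n - count τ := by
    have := Finset.card_filter_add_card_filter_not (s := Finset.univ) fun k => τ k = true
    rw [Finset.card_univ, Fintype.card_fin] at this
    omega
  have h2 : (Finset.univ.filter fun p : Fin n × Fin n => τ p.1 ≠ τ p.2) =
      ((Finset.univ.filter fun k => τ k = true) ×ˢ (Finset.univ.filter fun k => ¬ τ k = true)) ∪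
      ((Finset.univ.filter fun k => ¬ τ k = true) ×ˢ (Finset.univ.filter fun k => τ k = true)) := by
    ext p
    simp only [Finset.mem_filter, Finset.mem_univ, true_and, Finset.mem_union, Finset.mem_product]
    cases τ p.1 <;> cases τ p.2 <;> simp
  rw [h1, h2, Finset.card_union_of_disjoint, Finset.card_product, Finset.card_product, hT, hF]
  · ring
  · rw [Finset.disjoint_left]
    intro p hp hp'
    simp only [Finset.mem_product, Finset.mem_filter, Finset.mem_univ, true_and] at hp hp'
    exact hp'.1 hp.1

lemma avgOp_pair_potential_le {n : ℕ} (hn : 2 ≤ n) {a b : ℝ} (ha : 0.501 ≤ a)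
    (ha' : a ≤ 0.9995) (hb : a * Real.exp (-(1 / 1000 / n)) ≤ b) (τ : Fin n → Bool) :
    avgOp (fun p : Pairs n => [p.1]) (potential a) τ ≤ (1 + 2000 / (n : ℝ)) * potential b τ := by
  have ha0 : 0 < a := by linarith
  refine le_trans ?_ (potential_step (by omega) ha0 ha' (by norm_num) (by norm_num) hb τ)
  set θ := 2 / 5 * (a + 1 / a) with hθ
  have hθ1 : θ ≤ 999 / 1000 := two_fifths_le ha (by linarith)
  have hsum : ∑ p : Pairs n, pullList [p.1] (potential a) τ =
      (∑ p : Pairs n, (if τ p.1.1 = τ p.1.2 then 1 else θ)) * potential a τ := by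
    rw [Finset.sum_mul]
    refine Finset.sum_congr rfl fun p _ => ?_
    rw [pullList_potential (by simpa using p.2) (List.pairwise_singleton _ _) ha0]
    simp [cutWeight, hθ]
  have hcut : ∑ p : Pairs n, (if τ p.1.1 = τ p.1.2 then 1 else θ) =
      Fintype.card (Pairs n) - (1 - θ) * (2 * (count τ * (n - count τ : ℕ))) := by
    have h1 : ∀ p : Pairs n, (if τ p.1.1 = τ p.1.2 then 1 else θ) =
        1 - (1 - θ) * (if τ p.1.1 ≠ τ p.1.2 then 1 else 0) := by
      intro p; by_cases h : τ p.1.1 = τ p.1.2 <;> simp [h]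
    rw [Finset.sum_congr rfl fun p _ => h1 p, Finset.sum_sub_distrib, ← Finset.mul_sum,
      Finset.sum_boole, card_cut]
    simp
  rw [avgOp, hsum, hcut, card_pairs]
  have hn1 : (1 : ℝ) ≤ (n - 1 : ℕ) := by exact_mod_cast (by omega : 1 ≤ n - 1)
  have hn2 : ((n - 1 : ℕ) : ℝ) ≤ n := by exact_mod_cast (by omega : n - 1 ≤ n)
  have hn0 : (0 : ℝ) < n := by positivity
  set C : ℝ := (count τ : ℝ) * (n - count τ : ℕ) with hC
  have hC0 : 0 ≤ C := by positivity
  have hpot := (potential_pos ha0 τ).le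
  rw [mul_comm _ (potential a τ), mul_div_assoc]
  apply mul_le_mul_of_nonneg_left _ hpot
  push_cast
  have hnn : (0 : ℝ) < n * (n - 1 : ℕ) := by positivity
  have h1 : ((n : ℝ) * (n - 1 : ℕ) - (1 - θ) * (2 * C)) / (n * (n - 1 : ℕ)) ≤
      1 - 2 * (1 / 1000) * C / (n : ℝ) ^ 2 := by
    rw [sub_div, div_self hnn.ne']
    apply sub_le_sub_left
    calc 2 * (1 / 1000) * C / (n : ℝ) ^ 2 ≤ 2 * (1 / 1000) * C / (n * (n - 1 : ℕ)) := by
          gcongr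
          nlinarith
      _ ≤ _ := by
          apply div_le_div_of_nonneg_right _ hnn.le
          nlinarith
  refine h1.trans ?_
  have h2 := Real.add_one_le_exp (-(2 * (1 / 1000) * C / (n : ℝ) ^ 2))
  have h3 : 2 * (1 / 1000) * C / (n : ℝ) ^ 2 =
      2 * (1 / 1000) * count τ * (n - count τ : ℕ) / (n : ℝ) ^ 2 := by rw [hC]; ring
  rw [← h3]
  linarith

/-- The averaged mass after linearly many random gates. -/
lemma avgMass_pair_le {n m : ℕ} (hn : 2 ≤ n) (hm : 1000 * n ≤ m) (τ : Fin n → Bool) :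
    avgMass (fun p : Pairs n => [p.1]) m τ ≤
      Real.exp 2000000 * (1 / 0.9995) ^ n * potential 0.501 τ := by
  have hn0 : (0 : ℝ) < n := by positivity
  have : Nonempty (Pairs n) := ⟨⟨(⟨0, by omega⟩, ⟨1, by omega⟩), by simp⟩⟩
  refine (avgMass_antitone _ hm τ).trans ?_
  let A : ℕ → ℝ := fun t => max 0.501 (0.9995 * Real.exp (-(t * (1 / 1000 / n))))
  have h := avgMass_le (fun p : Pairs n => [p.1]) (fun t => potential (A t))
    (A := (1 / 0.9995) ^ n) (c := 1 + 2000 / (n : ℝ)) (by positivity) (by positivity) ?_ ?_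
    (1000 * n) τ
  · refine h.trans ?_
    have e1 : A (1000 * n) = 0.501 := by
      have hexp : Real.exp (-(((1000 * n : ℕ) : ℝ) * (1 / 1000 / n))) = Real.exp (-1) := by
        congr 1; push_cast; field_simp
      have := Real.exp_neg_one_lt_half
      simp only [A, hexp]
      rw [max_eq_left]
      linarith
    rw [e1]
    have e2 : (1 + 2000 / (n : ℝ)) ^ (1000 * n) ≤ Real.exp 2000000 := by
      calc (1 + 2000 / (n : ℝ)) ^ (1000 * n) ≤ Real.exp (2000 / n) ^ (1000 * n) := by
            gcongr
            have := Real.add_one_le_exp (2000 / (n : ℝ))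
            linarith
        _ = Real.exp 2000000 := by
            rw [← Real.exp_nat_mul]; congr 1; push_cast; field_simp; norm_num
    have hpot := (potential_pos (a := 0.501) (by norm_num) τ).le
    calc _ ≤ (1 / 0.9995) ^ n * Real.exp 2000000 * potential 0.501 τ := by gcongr
      _ = _ := by ring
  · intro σ
    have e0 : A 0 = 0.9995 := by simp [A]; norm_num
    simp only [e0]
    have h1 : (0.9995 : ℝ) ^ n ≤ potential 0.9995 σ := by
      unfold potential
      have : (0.9995 : ℝ) ^ n ≤ 0.9995 ^ count σ :=
        pow_le_pow_of_le_one (by norm_num) (by norm_num) (count_le σ)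
      have : (0 : ℝ) < 0.9995 ^ (n - count σ) := by positivity
      linarith
    calc (1 : ℝ) = (1 / 0.9995) ^ n * 0.9995 ^ n := by rw [← mul_pow]; norm_num
      _ ≤ _ := by gcongr
  · intro t σ
    refine avgOp_pair_potential_le hn (le_max_left _ _) ?_ ?_ σ
    · apply max_le (by norm_num)
      have : Real.exp (-(t * (1 / 1000 / n))) ≤ 1 := Real.exp_le_one_iff.mpr (by
        rw [Left.neg_nonpos_iff]; positivity)
      linarith
    · simp only [A]
      have hE : Real.exp (-(1 / 1000 / n)) ≤ 1 := Real.exp_le_one_iff.mpr (by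
        rw [Left.neg_nonpos_iff]; positivity)
      rw [max_mul_of_nonneg _ _ (Real.exp_pos _).le]
      apply max_le_max
      · linarith
      · rw [mul_assoc, ← Real.exp_add]
        apply le_of_eq
        congr 2
        push_cast
        ring

/-! ### Random pairings -/

/-- Each disjoint pair contributes a fixed factor to the sum of a product weight. -/
lemma sum_prodWeight_mul_cutWeight {n : ℕ} {l : List (Fin n × Fin n)} (hl : ∀ p ∈ l, p.1 ≠ p.2)
    (hd : l.Pairwise DisjointPairs) (v : Bool → ℝ) (θ : ℝ) :
    (∑ τ : Fin n → Bool, prodWeight v τ * cutWeight θ l τ) * ((v false + v true) ^ 2) ^ l.length =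
      (v false + v true) ^ n *
        (v false ^ 2 + v true ^ 2 + 2 * θ * (v false * v true)) ^ l.length := by
  induction l with
  | nil => simp [cutWeight, sum_prodWeight]
  | cons p l ih =>
    rw [List.pairwise_cons] at hd
    have hp := hl p (List.mem_cons_self ..)
    have ih' := ih (fun q hq => hl q (List.mem_cons_of_mem _ hq)) hd.2
    have ec : ∀ τ : Fin n → Bool, cutWeight θ (p :: l) τ =
        (if τ p.1 = τ p.2 then 1 else θ) * cutWeight θ l τ := by simp [cutWeight]
    have key : (∑ τ : Fin n → Bool, prodWeight v τ * cutWeight θ (p :: l) τ) *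
        (v false + v true) ^ 2 = (∑ τ : Fin n → Bool, prodWeight v τ * cutWeight θ l τ) *
          (v false ^ 2 + v true ^ 2 + 2 * θ * (v false * v true)) := by
      rw [sum_eq_sum_setPair hp, sum_eq_sum_setPair hp (fun τ => prodWeight v τ * cutWeight θ l τ),
        mul_assoc, mul_assoc, Finset.sum_mul, Finset.sum_mul]
      congr 1
      refine Finset.sum_congr rfl fun τ _ => ?_
      simp only [ec, cutWeight_setPair θ hd.1, prodWeight_setPair hp, setPair_fst,
        setPair_snd _ _ _ hp]
      simp
      ring
    rw [List.length_cons, pow_succ ((v false + v true) ^ 2),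
      pow_succ (v false ^ 2 + v true ^ 2 + 2 * θ * (v false * v true))]
    linear_combination ((v false + v true) ^ 2) ^ l.length * key +
      (v false ^ 2 + v true ^ 2 + 2 * θ * (v false * v true)) * ih'

lemma card_count_eq (n k : ℕ) :
    (Finset.univ.filter fun τ : Fin n → Bool => count τ = k).card = n.choose k := by
  rw [← Fintype.card_fin n, ← Finset.card_univ, ← Finset.card_powersetCard, Finset.card_univ,
    Fintype.card_fin]
  refine Finset.card_nbij' (fun τ => Finset.univ.filter fun i => τ i = true)
    (fun s i => decide (i ∈ s)) ?_ ?_ ?_ ?_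
  · intro τ hτ
    exact Finset.mem_powersetCard.mpr ⟨Finset.subset_univ _, (Finset.mem_filter.mp hτ).2⟩
  · intro s hs
    refine Finset.mem_filter.mpr ⟨Finset.mem_univ _, ?_⟩
    simpa [count] using (Finset.mem_powersetCard.mp hs).2
  · intro τ _
    ext1 i
    simp
  · intro s _
    ext i
    simp

/-- The term `j = k` of the binomial expansion of `(k + (n - k))^n` is its largest. -/
lemma pow_le_choose_mul {n k : ℕ} (hk : k ≤ n) :
    n ^ n ≤ (n + 1) * (n.choose k * (k ^ k * (n - k) ^ (n - k))) := by
  obtain ⟨m, rfl⟩ := Nat.exists_eq_add_of_le hk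
  rw [Nat.add_sub_cancel_left]
  let t : ℕ → ℕ := fun j => (k + m).choose j * (k ^ j * m ^ (k + m - j))
  -- The ratio of consecutive terms is `(k + m - j) k / ((j + 1) m)`.
  have hratio : ∀ j, j < k + m → t (j + 1) * ((j + 1) * m) = t j * ((k + m - j) * k) := by
    intro j hj
    have h1 := Nat.choose_succ_right_eq (k + m) j
    have h2 : k + m - j = (k + m - (j + 1)) + 1 := by omega
    simp only [t]
    rw [h2, pow_succ, pow_succ, ← h2]
    calc _ = ((k + m).choose (j + 1) * (j + 1)) * (k ^ j * k * m ^ (k + m - (j + 1)) * m) := by ring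
      _ = _ := by rw [h1]; ring
  have hup : ∀ j, j < k → t j ≤ t (j + 1) := by
    intro j hj
    have h := hratio j (by omega)
    have hle : (j + 1) * m ≤ (k + m - j) * k := by
      obtain ⟨d, rfl⟩ := Nat.exists_eq_add_of_lt hj
      have : j + d + 1 + m - j = d + 1 + m := by omega
      rw [this]
      nlinarith
    by_contra hlt
    push Not at hlt
    have hpos : 0 < (k + m - j) * k := Nat.mul_pos (by omega) (by omega)
    nlinarith
  have hdown : ∀ j, k ≤ j → j < k + m → t (j + 1) ≤ t j := by
    intro j hj hj'
    have h := hratio j hj'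
    have hle : (k + m - j) * k ≤ (j + 1) * m := by
      obtain ⟨d, rfl⟩ := Nat.exists_eq_add_of_le hj
      obtain ⟨e, rfl⟩ : ∃ e, m = d + e := ⟨m - d, by omega⟩
      have : k + (d + e) - (k + d) = e := by omega
      rw [this]
      nlinarith
    have hpos : 0 < (j + 1) * m := Nat.mul_pos (by omega) (by omega)
    by_contra hlt
    push Not at hlt
    nlinarith
  have hmax1 : ∀ d, d ≤ k → t (k - d) ≤ t k := by
    intro d
    induction d with
    | zero => simp
    | succ d ih =>
      intro hd
      have := hup (k - (d + 1)) (by omega)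
      rw [show k - (d + 1) + 1 = k - d by omega] at this
      exact this.trans (ih (by omega))
  have hmax2 : ∀ d, d ≤ m → t (k + d) ≤ t k := by
    intro d
    induction d with
    | zero => simp
    | succ d ih =>
      intro hd
      exact (hdown (k + d) (by omega) (by omega)).trans (ih (by omega))
  have hmax : ∀ j ∈ Finset.range (k + m + 1), t j ≤ t k := by
    intro j hj
    rw [Finset.mem_range] at hj
    rcases le_total j k with h | h
    · have := hmax1 (k - j) (by omega)
      rwa [show k - (k - j) = j by omega] at this
    · have := hmax2 (j - k) (by omega)
      rwa [show k + (j - k) = j by omega] at this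
  have hsum : (k + m) ^ (k + m) = ∑ j ∈ Finset.range (k + m + 1), t j := by
    rw [add_pow]
    refine Finset.sum_congr rfl fun j _ => ?_
    simp only [t, Nat.cast_id]
    ring
  calc (k + m) ^ (k + m) = ∑ j ∈ Finset.range (k + m + 1), t j := hsum
    _ ≤ ∑ _j ∈ Finset.range (k + m + 1), t k := Finset.sum_le_sum hmax
    _ = (k + m + 1) * t k := by simp
    _ = _ := by simp only [t, Nat.add_sub_cancel_left]

/-- Two configurations with as many labels `true` differ by a permutation of the places. -/
lemma exists_perm_of_count_eq {n : ℕ} {τ σ : Fin n → Bool} (h : count τ = count σ) :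
    ∃ π : Equiv.Perm (Fin n), τ ∘ π = σ := by
  have hc : Fintype.card {i // σ i = true} = Fintype.card {i // τ i = true} := by
    rw [Fintype.card_subtype, Fintype.card_subtype]; exact h.symm
  let e := Fintype.equivOfCardEq hc
  refine ⟨e.extendSubtype, funext fun i => ?_⟩
  by_cases hi : σ i = true
  · rw [hi]; exact e.extendSubtype_mem i hi
  · have := e.extendSubtype_not_mem i hi
    simp only [Function.comp_apply]
    rw [Bool.not_eq_true] at this hi
    rw [this, hi]

lemma count_comp_perm {n : ℕ} (τ : Fin n → Bool) (π : Equiv.Perm (Fin n)) :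
    count (τ ∘ π) = count τ := by
  unfold count
  refine Finset.card_bij (fun i _ => π i) (by simp) (fun i _ j _ h => π.injective h) ?_
  intro i hi
  exact ⟨π.symm i, by simpa using hi, by simp⟩

/-- The average of a function of configurations over all permutations of the places, bounded by its
sum against a product weight whose mass concentrates near `count τ = k`. -/
lemma sum_perm_le {n : ℕ} (g : (Fin n → Bool) → ℝ) (hg : ∀ τ, 0 ≤ g τ) (τ : Fin n → Bool) :
    (n : ℝ) ^ n * ∑ σ : Equiv.Perm (Fin n), g (τ ∘ σ) ≤ (n + 1) * (n.factorial *
      ∑ τ', prodWeight (fun b => if b then (count τ : ℝ) else (n - count τ : ℕ)) τ' * g τ') := by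
  set k := count τ with hk
  set v : Bool → ℝ := fun b => if b then (k : ℝ) else (n - k : ℕ) with hv
  have hv0 : ∀ τ' : Fin n → Bool, 0 ≤ prodWeight v τ' := fun τ' =>
    Finset.prod_nonneg fun i _ => by simp only [hv]; split_ifs <;> positivity
  let A : (Fin n → Bool) → ℝ := fun τ' => ∑ σ : Equiv.Perm (Fin n), g (τ' ∘ σ)
  have hA0 : ∀ τ', 0 ≤ A τ' := fun τ' => Finset.sum_nonneg fun σ _ => hg _
  have hA : ∀ τ', count τ' = k → A τ' = A τ := by
    intro τ' h
    obtain ⟨π, hπ⟩ := exists_perm_of_count_eq (h.trans hk).symm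
    simp only [A]
    rw [← Equiv.sum_comp (Equiv.mulLeft π) fun σ : Equiv.Perm (Fin n) => g (τ ∘ σ)]
    refine Finset.sum_congr rfl fun σ _ => ?_
    rw [← hπ]
    rfl
  have hswap : (n.factorial : ℝ) * ∑ τ', prodWeight v τ' * g τ' = ∑ τ', prodWeight v τ' * A τ' := by
    have h1 : ∀ σ : Equiv.Perm (Fin n), ∑ τ', prodWeight v τ' * g τ' =
        ∑ τ' : Fin n → Bool, prodWeight v τ' * g (τ' ∘ σ) := by
      intro σ
      rw [← (Equiv.arrowCongr σ.symm (Equiv.refl Bool)).sum_comp fun τ' => prodWeight v τ' * g τ']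
      refine Finset.sum_congr rfl fun τ' _ => ?_
      have : (Equiv.arrowCongr σ.symm (Equiv.refl Bool)) τ' = τ' ∘ σ := rfl
      rw [this, prodWeight_eq, prodWeight_eq, count_comp_perm]
    simp only [A, Finset.mul_sum]
    rw [Finset.sum_comm]
    simp only [← Finset.mul_sum]
    rw [Finset.sum_congr rfl fun σ _ => (h1 σ).symm]
    simp [Fintype.card_perm]
  rw [hswap]
  have hle : (n.choose k : ℝ) * ((k : ℝ) ^ k * ((n - k : ℕ) : ℝ) ^ (n - k)) * A τ ≤
      ∑ τ', prodWeight v τ' * A τ' := by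
    calc _ = ∑ τ' ∈ Finset.univ.filter fun τ' : Fin n → Bool => count τ' = k,
          (k : ℝ) ^ k * ((n - k : ℕ) : ℝ) ^ (n - k) * A τ := by
          rw [Finset.sum_const, card_count_eq, nsmul_eq_mul]; ring
      _ = ∑ τ' ∈ Finset.univ.filter fun τ' : Fin n → Bool => count τ' = k,
          prodWeight v τ' * A τ' := by
          refine Finset.sum_congr rfl fun τ' h => ?_
          rw [Finset.mem_filter] at h
          rw [hA τ' h.2, prodWeight_eq, h.2]
          simp [hv]
      _ ≤ _ := Finset.sum_le_sum_of_subset_of_nonneg (Finset.filter_subset _ _) fun τ' _ _ =>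
          mul_nonneg (hv0 τ') (hA0 τ')
  have hch : (n : ℝ) ^ n ≤ (n + 1) * (n.choose k * ((k : ℝ) ^ k * ((n - k : ℕ) : ℝ) ^ (n - k))) := by
    exact_mod_cast pow_le_choose_mul (count_le τ)
  calc (n : ℝ) ^ n * A τ ≤
      ((n + 1) * (n.choose k * ((k : ℝ) ^ k * ((n - k : ℕ) : ℝ) ^ (n - k)))) * A τ :=
        mul_le_mul_of_nonneg_right hch (hA0 τ)
    _ = (n + 1) * ((n.choose k * ((k : ℝ) ^ k * ((n - k : ℕ) : ℝ) ^ (n - k))) * A τ) := by ring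
    _ ≤ _ := by gcongr

lemma matchingLayer_ne {n : ℕ} (σ : Equiv.Perm (Fin n)) : ∀ p ∈ matchingLayer σ, p.1 ≠ p.2 := by
  intro p hp
  obtain ⟨k, _, rfl⟩ := List.mem_map.mp hp
  simp

lemma matchingLayer_pairwise {n : ℕ} (σ : Equiv.Perm (Fin n)) :
    (matchingLayer σ).Pairwise DisjointPairs := by
  unfold matchingLayer
  rw [List.pairwise_map]
  refine List.Pairwise.imp (R := fun a b => a ≠ b) ?_ (List.nodup_finRange _)
  intro a b hab
  have := fun h => hab (Fin.ext h)
  refine ⟨?_, ?_, ?_, ?_⟩ <;> simp only [ne_eq, EmbeddingLike.apply_eq_iff_eq, Fin.mk.injEq] <;> omega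

lemma cutWeight_matchingLayer {n : ℕ} (θ : ℝ) (σ : Equiv.Perm (Fin n)) (τ : Fin n → Bool) :
    cutWeight θ (matchingLayer σ) τ = cutWeight θ (matchingLayer 1) (τ ∘ σ) := by
  simp [cutWeight, matchingLayer, List.map_map, Function.comp_def]

/-- The generating function of the number of pairs cut by a random pairing. -/
lemma sum_cutWeight_matchingLayer_le {n : ℕ} (hn : 2 ≤ n) (τ : Fin n → Bool) :
    ∑ σ : Equiv.Perm (Fin n), cutWeight (999 / 1000) (matchingLayer σ) τ ≤
      (n + 1) * n.factorial * Real.exp (-(1 / 2000 * count τ * (n - count τ : ℕ) / n)) := by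
  have hn0 : (0 : ℝ) < n := by positivity
  set k := count τ with hk
  have hkn : (k : ℝ) + (n - k : ℕ) = n := by
    rw [← Nat.cast_add, Nat.add_sub_cancel' (count_le τ)]
  rw [Finset.sum_congr rfl fun σ _ => cutWeight_matchingLayer _ σ τ]
  have h1 := sum_perm_le (cutWeight (999 / 1000) (matchingLayer 1))
    (cutWeight_nonneg (by norm_num) _) τ
  rw [← hk] at h1
  have h2 := sum_prodWeight_mul_cutWeight (matchingLayer_ne 1) (matchingLayer_pairwise (1 : Equiv.Perm (Fin n)))
    (fun b => if b then (k : ℝ) else (n - k : ℕ)) (999 / 1000)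
  have hlen : (matchingLayer (1 : Equiv.Perm (Fin n))).length = n / 2 := by simp [matchingLayer]
  simp only [if_true, Bool.false_eq_true, if_false] at h2
  rw [hlen, add_comm ((n - k : ℕ) : ℝ), hkn] at h2
  set S := ∑ τ' : Fin n → Bool, prodWeight (fun b => if b then (k : ℝ) else (n - k : ℕ)) τ' *
    cutWeight (999 / 1000) (matchingLayer 1) τ' with hS
  set x : ℝ := (k : ℝ) * (n - k : ℕ) / n ^ 2 with hx
  have hx0 : 0 ≤ x := by positivity
  have hbase : ((n - k : ℕ) : ℝ) ^ 2 + (k : ℝ) ^ 2 + 2 * (999 / 1000) * ((n - k : ℕ) * k) =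
      (n : ℝ) ^ 2 * (1 - 1 / 500 * x) := by
    rw [hx]
    field_simp
    rw [← hkn]
    ring
  rw [hbase, mul_pow] at h2
  have h3 : S = (n : ℝ) ^ n * (1 - 1 / 500 * x) ^ (n / 2) := by
    have : ((n : ℝ) ^ 2) ^ (n / 2) ≠ 0 := by positivity
    apply mul_right_cancel₀ this
    rw [h2]
    ring
  have hx1 : 0 ≤ 1 - 1 / 500 * x := by
    have h4 : 0 ≤ (n : ℝ) ^ 2 * (1 - 1 / 500 * x) := by rw [← hbase]; positivity
    exact nonneg_of_mul_nonneg_right h4 (by positivity)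
  have h5 : (1 - 1 / 500 * x) ^ (n / 2) ≤ Real.exp (-(1 / 2000 * k * (n - k : ℕ) / n)) := by
    calc (1 - 1 / 500 * x) ^ (n / 2) ≤ Real.exp (-(1 / 500 * x)) ^ (n / 2) := by
          gcongr
          have := Real.add_one_le_exp (-(1 / 500 * x))
          linarith
      _ = Real.exp (-((n / 2 : ℕ) * (1 / 500 * x))) := by
          rw [← Real.exp_nat_mul]; congr 1; ring
      _ ≤ _ := by
          apply Real.exp_le_exp.mpr
          rw [neg_le_neg_iff]
          have hfl : (n : ℝ) / 4 ≤ (n / 2 : ℕ) := by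
            rw [div_le_iff₀ (by norm_num)]
            exact_mod_cast (by omega : n ≤ n / 2 * 4)
          calc 1 / 2000 * (k : ℝ) * (n - k : ℕ) / n = n / 4 * (1 / 500 * x) := by
                rw [hx]; field_simp; ring
            _ ≤ _ := by gcongr
  have hnn : (0 : ℝ) < (n : ℝ) ^ n := by positivity
  refine le_of_mul_le_mul_left (h1.trans ?_) hnn
  rw [h3]
  calc ((n : ℝ) + 1) * (n.factorial * ((n : ℝ) ^ n * (1 - 1 / 500 * x) ^ (n / 2))) ≤
      ((n : ℝ) + 1) * (n.factorial * ((n : ℝ) ^ n *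
        Real.exp (-(1 / 2000 * k * (n - k : ℕ) / n)))) := by gcongr
    _ = _ := by ring

lemma potential_halving_aux {k j : ℕ} (hkj : k ≤ j) (hn : 0 < k + j) {a b : ℝ} (ha : 0 < a)
    (ha' : a ≤ 1) (hb : a * Real.exp (-(1 / 4000)) ≤ b) :
    (a ^ k + a ^ j) * Real.exp (-(1 / 2000 * k * j / (k + j : ℝ))) ≤ 2 * (b ^ k + b ^ j) := by
  have hN0 : (0 : ℝ) < k + j := by exact_mod_cast hn
  have hb0 : 0 < a * Real.exp (-(1 / 4000)) := by positivity
  have h1 : a ^ j ≤ a ^ k := pow_le_pow_of_le_one ha.le ha' hkj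
  have h2 : Real.exp (-(1 / 2000 * k * j / (k + j : ℝ))) ≤ Real.exp (-(1 / 4000)) ^ k := by
    rw [← Real.exp_nat_mul]
    apply Real.exp_le_exp.mpr
    rw [mul_neg, neg_le_neg_iff, le_div_iff₀ hN0]
    have : (k : ℝ) ≤ j := by exact_mod_cast hkj
    have hk0 : (0 : ℝ) ≤ k := by positivity
    nlinarith
  have h3 : 0 < b := hb0.trans_le hb
  calc _ ≤ (a ^ k + a ^ k) * Real.exp (-(1 / 4000)) ^ k := by gcongr
    _ = 2 * (a * Real.exp (-(1 / 4000))) ^ k := by rw [mul_pow]; ring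
    _ ≤ 2 * b ^ k := by gcongr
    _ ≤ _ := by have : 0 < b ^ j := by positivity
                linarith

lemma avgOp_matching_potential_le {n : ℕ} (hn : 2 ≤ n) {a b : ℝ} (ha : 0.501 ≤ a)
    (ha' : a ≤ 1) (hb : a * Real.exp (-(1 / 4000)) ≤ b) (τ : Fin n → Bool) :
    avgOp (fun σ : Equiv.Perm (Fin n) => matchingLayer σ) (potential a) τ ≤
      2 * (n + 1) * potential b τ := by
  have ha0 : 0 < a := by linarith
  have hθ1 := two_fifths_le ha ha'
  have hpot := (potential_pos ha0 τ).le
  have hn0 : (0 : ℝ) < n := by positivity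
  have hf : (0 : ℝ) < n.factorial := by exact_mod_cast n.factorial_pos
  have hsum : ∑ σ : Equiv.Perm (Fin n), pullList (matchingLayer σ) (potential a) τ ≤
      ((n + 1) * n.factorial * Real.exp (-(1 / 2000 * count τ * (n - count τ : ℕ) / n))) *
        potential a τ := by
    calc _ ≤ (∑ σ : Equiv.Perm (Fin n), cutWeight (999 / 1000) (matchingLayer σ) τ) *
          potential a τ := by
          rw [Finset.sum_mul]
          refine Finset.sum_le_sum fun σ _ => ?_
          rw [pullList_potential (matchingLayer_ne σ) (matchingLayer_pairwise σ) ha0]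
          exact mul_le_mul_of_nonneg_right (cutWeight_mono (by positivity) hθ1 _ _) hpot
      _ ≤ _ := mul_le_mul_of_nonneg_right (sum_cutWeight_matchingLayer_le hn τ) hpot
  have hdecay : potential a τ * Real.exp (-(1 / 2000 * count τ * (n - count τ : ℕ) / n)) ≤
      2 * potential b τ := by
    have hc := count_le τ
    have e : (n : ℝ) = (count τ : ℝ) + (n - count τ : ℕ) := by
      rw [← Nat.cast_add, Nat.add_sub_cancel' hc]
    unfold potential
    rcases le_total (count τ) (n - count τ) with h | h
    · have := potential_halving_aux h (by omega) ha0 ha' hb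
      rwa [← e] at this
    · have e' : (n : ℝ) = (n - count τ : ℕ) + (count τ : ℝ) := by rw [add_comm]; exact e
      have := potential_halving_aux h (by omega) ha0 ha' hb
      rw [← e'] at this
      rw [add_comm (a ^ _), add_comm (b ^ _), mul_right_comm (1 / 2000 : ℝ)]
      exact this
  rw [avgOp, Fintype.card_perm, Fintype.card_fin, div_le_iff₀ hf]
  refine hsum.trans ?_
  calc _ = (n + 1) * n.factorial * (potential a τ *
        Real.exp (-(1 / 2000 * count τ * (n - count τ : ℕ) / n))) := by ring
    _ ≤ (n + 1) * n.factorial * (2 * potential b τ) := by gcongr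
    _ = _ := by ring

/-- The averaged mass after a constant number of random pairings. -/
lemma exists_avgMass_matching_le : ∃ T : ℕ, ∀ n m : ℕ, 2 ≤ n → T ≤ m → ∀ τ : Fin n → Bool,
    avgMass (fun σ : Equiv.Perm (Fin n) => matchingLayer σ) m τ ≤
      (2 * (n + 1)) ^ T * potential 0.501 τ := by
  obtain ⟨T, hT⟩ : ∃ T : ℕ, (T : ℝ) * (1 / 4000) = 1 := ⟨4000, by norm_num⟩
  refine ⟨T, fun n m hn hm τ => (avgMass_antitone _ hm τ).trans ?_⟩
  let A : ℕ → ℝ := fun t => max 0.501 (Real.exp (-(t * (1 / 4000))))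
  have h := avgMass_le (fun σ : Equiv.Perm (Fin n) => matchingLayer σ) (fun t => potential (A t))
    (A := 1) (c := 2 * ((n : ℝ) + 1)) (by positivity) (by positivity) ?_ ?_ T τ
  · have e1 : A T = 0.501 := by
      have := Real.exp_neg_one_lt_half
      simp only [A, hT]
      rw [max_eq_left]
      linarith
    rw [e1, one_mul] at h
    exact h
  · intro σ
    have e0 : A 0 = 1 := by simp [A]; norm_num
    simp only [e0, potential, one_pow]
    norm_num
  · intro t σ
    refine avgOp_matching_potential_le hn (le_max_left _ _) ?_ ?_ σ
    · apply max_le (by norm_num)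
      exact Real.exp_le_one_iff.mpr (by rw [Left.neg_nonpos_iff]; positivity)
    · simp only [A]
      have hE : Real.exp (-(1 / 4000)) ≤ 1 := Real.exp_le_one_iff.mpr (by norm_num)
      rw [max_mul_of_nonneg _ _ (Real.exp_pos _).le]
      apply max_le_max
      · linarith
      · rw [← Real.exp_add]
        apply le_of_eq
        congr 1
        push_cast
        ring

/-! ### Peakedness for random placements -/

/-- A circuit made of random layers: it is `δ`-peaked either because more than `j` qubits are not
acted on, or with a probability bounded by the averaged mass. -/
lemma peakedProbAvg_le {n : ℕ} {α : Type} [Fintype α] [Nonempty α]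
    (layer : α → List (Fin n × Fin n)) (hne : ∀ x, ∀ p ∈ layer x, p.1 ≠ p.2) (m j : ℕ) {δ : ℝ}
    (hδ : 0 < δ) :
    peakedProbAvg δ (fun e : Fin m → α => (List.finRange m).flatMap fun t => layer (e t)) ≤
      ENNReal.ofReal (((Finset.univ.filter fun e : Fin m → α =>
          j < (untouched ((List.finRange m).flatMap fun t => layer (e t))).card).card : ℝ) /
            (Fintype.card α : ℝ) ^ m +
        (3 / 2) ^ j * (1 / 3) ^ n * (∑ τ, avgMass layer m τ) / δ ^ 2) := by
  set l : (Fin m → α) → List (Fin n × Fin n) := fun e =>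
    (List.finRange m).flatMap fun t => layer (e t) with hl
  have hlne : ∀ e, ∀ p ∈ l e, p.1 ≠ p.2 := by
    intro e p hp
    obtain ⟨t, _, ht⟩ := List.mem_flatMap.mp hp
    exact hne _ p ht
  have hc : (0 : ℝ) < Fintype.card α := by exact_mod_cast Fintype.card_pos
  have hmass : ∀ e, 0 ≤ ∑ τ, pullList (l e) (fun _ => 1) τ := by
    intro e
    rw [← sum_evolve_mul _ (hlne e)]
    exact Finset.sum_nonneg fun τ _ => by simpa using evolve_nonneg _ τ
  have h1 : ∀ e, peakedProb δ (l e) ≤ ENNReal.ofReal ((if j < (untouched (l e)).card then 1 else 0) +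
      (3 / 2) ^ j * (1 / 3) ^ n * (∑ τ, pullList (l e) (fun _ => 1) τ) / δ ^ 2) := by
    intro e
    have hm := hmass e
    split_ifs with hj
    · refine (peakedProb_le_one _ _).trans ?_
      rw [ENNReal.one_le_ofReal]
      have : 0 ≤ (3 / 2) ^ j * (1 / 3) ^ n * (∑ τ, pullList (l e) (fun _ => 1) τ) / δ ^ 2 := by
        positivity
      linarith
    · refine (peakedProb_le _ (hlne e) hδ).trans (ENNReal.ofReal_le_ofReal ?_)
      rw [zero_add, pushList_none _ (hlne e)]
      have e1 : ∑ τ, evolve (l e) τ = ∑ τ, pullList (l e) (fun _ => 1) τ := by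
        rw [← sum_evolve_mul _ (hlne e)]; simp
      rw [e1]
      push Not at hj
      gcongr
      norm_num
  have h2 : (∑ e, peakedProb δ (l e)) ≤ ENNReal.ofReal (∑ e, ((if j < (untouched (l e)).card then
      (1 : ℝ) else 0) + (3 / 2) ^ j * (1 / 3) ^ n * (∑ τ, pullList (l e) (fun _ => 1) τ) / δ ^ 2)) := by
    rw [ENNReal.ofReal_sum_of_nonneg]
    · exact Finset.sum_le_sum fun e _ => h1 e
    · intro e _
      have hm := hmass e
      have : (0 : ℝ) ≤ if j < (untouched (l e)).card then 1 else 0 := by split_ifs <;> norm_num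
      positivity
  unfold peakedProbAvg
  refine (ENNReal.div_le_div_right h2 _).trans ?_
  rw [Fintype.card_fun, Fintype.card_fin, ← ENNReal.ofReal_natCast,
    ← ENNReal.ofReal_div_of_pos (by positivity)]
  apply ENNReal.ofReal_le_ofReal
  have h3 : ∑ e, ∑ τ, pullList (l e) (fun _ => 1) τ =
      (Fintype.card α : ℝ) ^ m * ∑ τ, avgMass layer m τ := by
    rw [Finset.sum_comm, Finset.mul_sum]
    exact Finset.sum_congr rfl fun τ _ => sum_pullList_eq layer m τ
  rw [Finset.sum_add_distrib, Finset.sum_boole, ← Finset.sum_div, ← Finset.mul_sum, h3, add_div]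
  push_cast
  apply le_of_eq
  congr 1
  field_simp

lemma matchings_eq {n τ : ℕ} (σ : Fin τ → Equiv.Perm (Fin n)) :
    matchings n τ σ = (List.finRange τ).flatMap fun t => matchingLayer (σ t) := rfl

lemma completeGraph_eq {n m : ℕ} (e : Fin m → Pairs n) :
    completeGraph n m e = (List.finRange m).flatMap fun t => [(e t).1] := by
  rw [completeGraph, List.ofFn_eq_map, List.map_eq_flatMap]

/-- A pairing leaves at most one qubit idle. -/
lemma card_untouched_matchings_le {n τ : ℕ} (hτ : 0 < τ) (σ : Fin τ → Equiv.Perm (Fin n)) :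
    (untouched (matchings n τ σ)).card ≤ 1 := by
  rw [Finset.card_le_one]
  have last : ∀ k ∈ untouched (matchings n τ σ), ((σ ⟨0, hτ⟩).symm k).val + 1 = n := by
    intro k hk
    rw [mem_untouched] at hk
    by_contra hne
    set i := (σ ⟨0, hτ⟩).symm k with hi
    have hki : k = σ ⟨0, hτ⟩ i := by simp [hi]
    have hin := i.2
    have hmem : ∀ q : Fin (n / 2), ((σ ⟨0, hτ⟩ ⟨2 * q.val, by omega⟩, σ ⟨0, hτ⟩ ⟨2 * q.val + 1, by omega⟩) :
        Fin n × Fin n) ∈ matchings n τ σ := fun q =>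
      List.mem_flatMap.mpr ⟨⟨0, hτ⟩, List.mem_finRange _, List.mem_map.mpr ⟨q, List.mem_finRange _, rfl⟩⟩
    have h := hk _ (hmem ⟨i.val / 2, by omega⟩)
    rcases Nat.mod_two_eq_zero_or_one i.val with h2 | h2
    · apply h.1
      exact hki.trans (congrArg (σ ⟨0, hτ⟩) (Fin.ext (by simp only; omega)))
    · apply h.2
      exact hki.trans (congrArg (σ ⟨0, hτ⟩) (Fin.ext (by simp only; omega)))
  intro a ha b hb
  apply (σ ⟨0, hτ⟩).symm.injective
  exact Fin.ext (by have := last a ha; have := last b hb; omega)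

lemma exists_peakedProbAvg_matchings_le : ∃ T : ℕ, ∀ n τ : ℕ, 2 ≤ n → T + 1 ≤ τ → ∀ δ : ℝ, 0 < δ →
    peakedProbAvg δ (matchings n τ) ≤
      ENNReal.ofReal (3 * 2 ^ T * (n + 1) ^ T * 0.503 ^ n / δ ^ 2) := by
  obtain ⟨T, hT⟩ := exists_avgMass_matching_le
  refine ⟨T, fun n τ hn hτ δ hδ => ?_⟩
  have h := peakedProbAvg_le (fun σ : Equiv.Perm (Fin n) => matchingLayer σ)
    (fun σ => matchingLayer_ne σ) τ 1 hδ
  have h0 : (Finset.univ.filter fun e : Fin τ → Equiv.Perm (Fin n) =>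
      1 < (untouched ((List.finRange τ).flatMap fun t => matchingLayer (e t))).card) = ∅ := by
    refine Finset.filter_eq_empty_iff.mpr fun e _ => ?_
    rw [← matchings_eq, not_lt]
    exact card_untouched_matchings_le (by omega) e
  rw [h0, Finset.card_empty, Nat.cast_zero, zero_div, zero_add] at h
  refine h.trans (ENNReal.ofReal_le_ofReal ?_)
  apply div_le_div_of_nonneg_right _ (by positivity)
  have hsum : ∑ τ' : Fin n → Bool, avgMass (fun σ : Equiv.Perm (Fin n) => matchingLayer σ) τ τ' ≤
      (2 * ((n : ℝ) + 1)) ^ T * (2 * 1.501 ^ n) := by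
    calc _ ≤ ∑ τ' : Fin n → Bool, (2 * ((n : ℝ) + 1)) ^ T * potential 0.501 τ' :=
          Finset.sum_le_sum fun τ' _ => hT n τ hn (by omega) τ'
      _ = _ := by rw [← Finset.mul_sum, sum_potential]; norm_num
  calc _ ≤ (3 / 2) ^ 1 * (1 / 3) ^ n * ((2 * ((n : ℝ) + 1)) ^ T * (2 * 1.501 ^ n)) := by gcongr
    _ = 3 * 2 ^ T * (n + 1) ^ T * ((1 / 3) ^ n * 1.501 ^ n) := by rw [mul_pow 2]; ring
    _ = 3 * 2 ^ T * (n + 1) ^ T * (1 / 3 * 1.501) ^ n := by rw [mul_pow]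
    _ ≤ _ := by gcongr; norm_num

/-- The number of sequences of pairs that leave more than a thousandth of the qubits idle, by a
union bound over the set of idle qubits. -/
lemma card_idle_le {n : ℕ} (hn : 2 ≤ n) (m : ℕ) :
    ((Finset.univ.filter fun e : Fin m → Pairs n =>
      n / 1000 < (untouched ((List.finRange m).flatMap fun t => [(e t).1])).card).card : ℝ) ≤
      2 ^ n * (999 / 1000 * Fintype.card (Pairs n)) ^ m := by
  let avoid : Finset (Fin n) → Finset (Pairs n) := fun B =>
    Finset.univ.filter fun p => p.1.1 ∉ B ∧ p.1.2 ∉ B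
  have hsub : (Finset.univ.filter fun e : Fin m → Pairs n =>
      n / 1000 < (untouched ((List.finRange m).flatMap fun t => [(e t).1])).card) ⊆
      (Finset.univ.filter fun B : Finset (Fin n) => n / 1000 < B.card).biUnion
        fun B => Fintype.piFinset fun _ : Fin m => avoid B := by
    intro e he
    rw [Finset.mem_filter] at he
    refine Finset.mem_biUnion.mpr ⟨_, Finset.mem_filter.mpr ⟨Finset.mem_univ _, he.2⟩, ?_⟩
    rw [Fintype.mem_piFinset]
    intro t
    have hmem : (e t).1 ∈ (List.finRange m).flatMap fun t => [(e t).1] :=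
      List.mem_flatMap.mpr ⟨t, List.mem_finRange _, by simp⟩
    simp only [avoid, Finset.mem_filter, Finset.mem_univ, true_and, mem_untouched]
    exact ⟨fun h => (h _ hmem).1 rfl, fun h => (h _ hmem).2 rfl⟩
  have havoid : ∀ B : Finset (Fin n), n / 1000 < B.card →
      ((avoid B).card : ℝ) ≤ 999 / 1000 * Fintype.card (Pairs n) := by
    intro B hB
    have h1 : (avoid B).card ≤ Bᶜ.offDiag.card := by
      refine Finset.card_le_card_of_injOn (fun p => p.1) ?_ fun a _ b _ h => Subtype.ext h
      intro p hp
      have hp' := (Finset.mem_filter.mp (Finset.mem_coe.mp hp)).2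
      exact Finset.mem_coe.mpr (Finset.mem_offDiag.mpr
        ⟨Finset.mem_compl.mpr hp'.1, Finset.mem_compl.mpr hp'.2, p.2⟩)
    have hB' : B.card ≤ n := by simpa using Finset.card_le_univ B
    rw [Finset.offDiag_card, Finset.card_compl, Fintype.card_fin] at h1
    have h2 : (n - B.card) * (n - B.card) - (n - B.card) ≤ (n - B.card) * (n - 1) := by
      rw [← Nat.mul_sub_one]
      exact Nat.mul_le_mul_left _ (by omega)
    rw [card_pairs]
    have h3 : 1000 * (n - B.card) ≤ 999 * n := by omega
    have h4 : 1000 * (avoid B).card ≤ 999 * (n * (n - 1)) := by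
      calc 1000 * (avoid B).card ≤ 1000 * ((n - B.card) * (n - 1)) :=
            Nat.mul_le_mul_left _ (h1.trans h2)
        _ = 1000 * (n - B.card) * (n - 1) := by ring
        _ ≤ 999 * n * (n - 1) := Nat.mul_le_mul_right _ h3
        _ = _ := by ring
    have h5 : (1000 : ℝ) * (avoid B).card ≤ 999 * ((n * (n - 1) : ℕ) : ℝ) := by exact_mod_cast h4
    linarith
  calc _ ≤ (((Finset.univ.filter fun B : Finset (Fin n) => n / 1000 < B.card).biUnion
        fun B => Fintype.piFinset fun _ : Fin m => avoid B).card : ℝ) := by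
        exact_mod_cast Finset.card_le_card hsub
    _ ≤ ∑ B ∈ Finset.univ.filter fun B : Finset (Fin n) => n / 1000 < B.card,
        ((avoid B).card : ℝ) ^ m := by
        have hb := Finset.card_biUnion_le
          (s := Finset.univ.filter fun B : Finset (Fin n) => n / 1000 < B.card)
          (t := fun B => Fintype.piFinset fun _ : Fin m => avoid B)
        refine le_trans (Nat.cast_le.mpr hb) (le_of_eq ?_)
        push_cast
        simp
    _ ≤ ∑ B ∈ Finset.univ.filter fun B : Finset (Fin n) => n / 1000 < B.card,
        (999 / 1000 * (Fintype.card (Pairs n) : ℝ)) ^ m := by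
        refine Finset.sum_le_sum fun B hB => ?_
        have := havoid B (Finset.mem_filter.mp hB).2
        gcongr
    _ ≤ ∑ B : Finset (Fin n), (999 / 1000 * (Fintype.card (Pairs n) : ℝ)) ^ m :=
        Finset.sum_le_sum_of_subset_of_nonneg (Finset.filter_subset _ _) fun _ _ _ => by positivity
    _ = _ := by simp

lemma peakedProbAvg_completeGraph_le {n m : ℕ} (hn : 2 ≤ n) (hm : 2000 * n ≤ m) {δ : ℝ}
    (hδ : 0 < δ) : peakedProbAvg δ (completeGraph n m) ≤
      ENNReal.ofReal (Real.exp (-n) + 2 * Real.exp 2000000 * 0.503 ^ n / δ ^ 2) := by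
  have hne : Nonempty (Pairs n) := ⟨⟨(⟨0, by omega⟩, ⟨1, by omega⟩), by simp⟩⟩
  have hcard : (0 : ℝ) < Fintype.card (Pairs n) := by exact_mod_cast Fintype.card_pos
  have h := peakedProbAvg_le (fun p : Pairs n => [p.1]) (fun p => by simpa using p.2) m (n / 1000) hδ
  have he : completeGraph n m = fun e : Fin m → Pairs n =>
      (List.finRange m).flatMap fun t => [(e t).1] := funext fun e => completeGraph_eq e
  rw [he]
  refine h.trans (ENNReal.ofReal_le_ofReal (add_le_add ?_ ?_))
  · rw [div_le_iff₀ (by positivity)]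
    refine (card_idle_le hn m).trans ?_
    rw [mul_pow, ← mul_assoc]
    gcongr
    have h1 : (999 / 1000 : ℝ) ^ m ≤ Real.exp (-(2 * n)) := by
      calc (999 / 1000 : ℝ) ^ m ≤ (Real.exp (-(1 / 1000))) ^ m := by
            gcongr
            have := Real.add_one_le_exp (-(1 / 1000))
            linarith
        _ = Real.exp (-(m / 1000)) := by rw [← Real.exp_nat_mul]; congr 1; ring
        _ ≤ _ := by
            apply Real.exp_le_exp.mpr
            have : (2000 : ℝ) * n ≤ m := by exact_mod_cast hm
            linarith
    have h2 : (2 : ℝ) ^ n ≤ Real.exp n := by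
      calc (2 : ℝ) ^ n ≤ Real.exp 1 ^ n := by
            gcongr
            have := Real.add_one_le_exp (1 : ℝ)
            linarith
        _ = Real.exp n := by rw [← Real.exp_nat_mul, mul_one]
    calc (2 : ℝ) ^ n * (999 / 1000) ^ m ≤ Real.exp n * Real.exp (-(2 * n)) := by gcongr
      _ = Real.exp (-n) := by rw [← Real.exp_add]; congr 1; ring
  · apply div_le_div_of_nonneg_right _ (by positivity)
    have hsum : ∑ τ : Fin n → Bool, avgMass (fun p : Pairs n => [p.1]) m τ ≤
        Real.exp 2000000 * (1 / 0.9995) ^ n * (2 * 1.501 ^ n) := by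
      calc _ ≤ ∑ τ : Fin n → Bool, Real.exp 2000000 * (1 / 0.9995) ^ n * potential 0.501 τ :=
            Finset.sum_le_sum fun τ _ => avgMass_pair_le hn (by omega) τ
        _ = _ := by rw [← Finset.mul_sum, sum_potential]; norm_num
    have h32 : (3 / 2 : ℝ) ^ (n / 1000) ≤ 1.001 ^ n := by
      have hb : (3 / 2 : ℝ) ≤ 1.001 ^ 1000 := by
        have h := one_add_mul_le_pow (show (-2 : ℝ) ≤ 0.001 by norm_num) 1000
        rw [show (1 : ℝ) + 0.001 = 1.001 by norm_num] at h
        refine le_trans ?_ h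
        norm_num
      calc (3 / 2 : ℝ) ^ (n / 1000) ≤ (1.001 ^ 1000) ^ (n / 1000) := by gcongr
        _ = 1.001 ^ (1000 * (n / 1000)) := (pow_mul _ _ _).symm
        _ ≤ 1.001 ^ n := pow_le_pow_right₀ (by norm_num) (Nat.mul_div_le n 1000)
    calc _ ≤ (3 / 2) ^ (n / 1000) * (1 / 3) ^ n *
            (Real.exp 2000000 * (1 / 0.9995) ^ n * (2 * 1.501 ^ n)) :=
          mul_le_mul_of_nonneg_left hsum (by positivity)
      _ ≤ 1.001 ^ n * (1 / 3) ^ n * (Real.exp 2000000 * (1 / 0.9995) ^ n * (2 * 1.501 ^ n)) := by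
          gcongr
      _ = 2 * Real.exp 2000000 * (1.001 ^ n * (1 / 3) ^ n * (1 / 0.9995) ^ n * 1.501 ^ n) := by ring
      _ = 2 * Real.exp 2000000 * (1.001 * (1 / 3) * (1 / 0.9995) * 1.501) ^ n := by
          rw [mul_pow, mul_pow, mul_pow]
      _ ≤ _ := by gcongr; norm_num

lemma chain_ne {n : ℕ} (hn : 3 ≤ n) (τ : ℕ) : ∀ p ∈ chain n τ, p.1 ≠ p.2 := by
  rw [chain_eq]
  intro p hp
  obtain ⟨i, _, rfl⟩ := List.mem_map.mp hp
  exact (finRotate_ne_self hn i).symm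

lemma ring_ne {n : ℕ} (hn : 3 ≤ n) (τ : ℕ) : ∀ p ∈ ring n τ, p.1 ≠ p.2 := by
  rw [ring_eq]
  intro p hp
  obtain ⟨i, _, rfl⟩ := List.mem_map.mp hp
  exact (finRotate_ne_self hn i).symm

/-! ### Asymptotics -/

lemma two_rpow_le (n : ℕ) : (2 : ℝ) ^ (0.98 * (n : ℝ)) ≤ 1.974 ^ n := by
  have h : (2 : ℝ) ^ (0.98 : ℝ) ≤ 1.974 := by
    refine le_of_pow_le_pow_left₀ (n := 50) (by norm_num) (by norm_num) ?_
    rw [← Real.rpow_natCast, ← Real.rpow_mul (by norm_num),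
      show (0.98 : ℝ) * (50 : ℕ) = (49 : ℕ) by norm_num, Real.rpow_natCast]
    norm_num
  rw [Real.rpow_mul (by norm_num), Real.rpow_natCast]
  gcongr

/-- The bounds on the collision probability beat the peakedness threshold: `0.503` times
`2 ^ 0.98 ≤ 1.974` is less than `0.995 * 0.999`, and `0.995 ^ n` absorbs the polynomial factor. -/
lemma eventually_bound (K : ℝ) (hK : 0 < K) (C : ℝ) (hC : 0 ≤ C) (T : ℕ) :
    ∀ᶠ n : ℕ in Filter.atTop, ∀ δ : ℝ, K * (2 : ℝ) ^ (-(0.49 * (n : ℝ))) ≤ δ →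
      Real.exp (-n) + C * (n + 1) ^ T * 0.503 ^ n / δ ^ 2 ≤ Real.exp (-(1 / 1000 * n)) := by
  have h1 := tendsto_pow_const_mul_const_pow_of_abs_lt_one T
    (show |(0.995 : ℝ)| < 1 by rw [abs_of_pos] <;> norm_num)
  have h2 := (h1.const_mul (C * 2 ^ T / K ^ 2)).eventually_le_const (u := 1 / 2) (by norm_num)
  filter_upwards [h2, Filter.eventually_ge_atTop 1] with n hn2 hn1 δ hδ
  have hn1' : (1 : ℝ) ≤ n := by exact_mod_cast hn1
  set x : ℝ := (2 : ℝ) ^ (-(0.49 * (n : ℝ))) with hx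
  have hx0 : 0 < x := Real.rpow_pos_of_pos (by norm_num) _
  have hδ2 : (K * x) ^ 2 ≤ δ ^ 2 := by gcongr
  have hx2 : 1 / x ^ 2 ≤ 1.974 ^ n := by
    refine le_trans (le_of_eq ?_) (two_rpow_le n)
    rw [hx, ← Real.rpow_natCast, ← Real.rpow_mul (by norm_num), one_div, ← Real.rpow_neg (by norm_num)]
    congr 1
    push_cast
    ring
  have hA : C * (n + 1) ^ T * 0.503 ^ n / δ ^ 2 ≤ 1 / 2 * (0.999 : ℝ) ^ n := by
    calc C * ((n : ℝ) + 1) ^ T * 0.503 ^ n / δ ^ 2 ≤ C * (2 * n) ^ T * 0.503 ^ n / (K * x) ^ 2 := by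
          gcongr
          linarith
      _ = C * 2 ^ T / K ^ 2 * (n ^ T * (0.503 ^ n * (1 / x ^ 2))) := by
          rw [mul_pow, mul_pow]; field_simp
      _ ≤ C * 2 ^ T / K ^ 2 * (n ^ T * (0.503 ^ n * 1.974 ^ n)) := by gcongr
      _ ≤ C * 2 ^ T / K ^ 2 * (n ^ T * (0.995 ^ n * 0.999 ^ n)) := by
          have hq : (0.503 : ℝ) ^ n * 1.974 ^ n ≤ 0.995 ^ n * 0.999 ^ n := by
            rw [← mul_pow, ← mul_pow]
            exact pow_le_pow_left₀ (by norm_num) (by norm_num) n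
          exact mul_le_mul_of_nonneg_left (mul_le_mul_of_nonneg_left hq (by positivity))
            (by positivity)
      _ = C * 2 ^ T / K ^ 2 * (n ^ T * 0.995 ^ n) * 0.999 ^ n := by ring
      _ ≤ _ := by gcongr
  have hB : (0.999 : ℝ) ^ n ≤ Real.exp (-(1 / 1000 * n)) := by
    calc (0.999 : ℝ) ^ n ≤ Real.exp (-(1 / 1000)) ^ n := by
          gcongr
          have := Real.add_one_le_exp (-(1 / 1000) : ℝ)
          linarith
      _ = _ := by rw [← Real.exp_nat_mul]; congr 1; ring
  have hD : Real.exp (-n) ≤ 1 / 2 * Real.exp (-(1 / 1000 * n)) := by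
    have h3 : Real.exp (-n) = Real.exp (-(1 / 1000 * n)) * Real.exp (-(999 / 1000 * n)) := by
      rw [← Real.exp_add]; congr 1; ring
    have h4 : Real.exp (-(999 / 1000 * (n : ℝ))) ≤ 1 / 2 := by
      rw [Real.exp_neg, one_div]
      apply inv_anti₀ (by norm_num)
      have h5 := Real.quadratic_le_exp_of_nonneg (show (0 : ℝ) ≤ 999 / 1000 * n by positivity)
      nlinarith
    rw [h3]
    nlinarith [Real.exp_pos (-(1 / 1000 * (n : ℝ)))]
  linarith

end PeakedCircuits

open PeakedCircuits

theorem corollary2 (c K : ℝ) (hc : 0 < c) (hK : 0 < K) :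
    ∃ κ : ℝ, 0 < κ ∧ ∃ N : ℕ, 2 ≤ N ∧ ∀ n : ℕ, N ≤ n → ∀ δ : ℝ,
      K * (2 : ℝ) ^ (-(0.49 * (n : ℝ))) ≤ δ →
        (∀ τ : ℕ, c * Real.log n ≤ τ →
          PeakedCircuits.peakedProb δ (PeakedCircuits.chain n τ)
            ≤ ENNReal.ofReal (Real.exp (-(κ * n)))) ∧
        (Even n → ∀ τ : ℕ, c * Real.log n ≤ τ →
          PeakedCircuits.peakedProb δ (PeakedCircuits.ring n τ)
            ≤ ENNReal.ofReal (Real.exp (-(κ * n)))) ∧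
        (∀ τ : ℕ, c * Real.log n ≤ τ →
          PeakedCircuits.peakedProbAvg δ (PeakedCircuits.matchings n τ)
            ≤ ENNReal.ofReal (Real.exp (-(κ * n)))) ∧
        (∀ m : ℕ, c * Real.log n ≤ 2 * (m : ℝ) / n →
          PeakedCircuits.peakedProbAvg δ (PeakedCircuits.completeGraph n m)
            ≤ ENNReal.ofReal (Real.exp (-(κ * n)))) := by
  obtain ⟨T, hT⟩ := exists_peakedProbAvg_matchings_le
  -- Any lower bound on the depth that is a constant holds once `n` is large.
  have hlog : ∀ᶠ n : ℕ in Filter.atTop, (T : ℝ) + 4000 ≤ c * Real.log n :=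
    ((Real.tendsto_log_atTop.comp tendsto_natCast_atTop_atTop).const_mul_atTop hc).eventually_ge_atTop _
  have e1 := eventually_bound K hK 30 (by norm_num) 0
  have e2 := eventually_bound K hK (3 * 2 ^ T) (by positivity) T
  have e3 := eventually_bound K hK (2 * Real.exp 2000000) (by positivity) 0
  obtain ⟨N, hN⟩ := Filter.eventually_atTop.mp
    (hlog.and (e1.and (e2.and (e3.and (Filter.eventually_ge_atTop 3)))))
  refine ⟨1 / 1000, by norm_num, max N 3, by omega, fun n hn δ hδ => ?_⟩
  obtain ⟨g1, g2, g3, g4, g5⟩ := hN n (le_of_max_le_left hn)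
  have hδ0 : 0 < δ := (mul_pos hK (Real.rpow_pos_of_pos (by norm_num) _)).trans_le hδ
  have hexp : (0 : ℝ) ≤ Real.exp (-n) := (Real.exp_pos _).le
  have hT0 : (0 : ℝ) ≤ T := by positivity
  -- The wall ratio `9/5 (4/5)^t` is below `0.006` from `t = 26` on.
  have hwall : ∀ t : ℕ, 26 ≤ t → 30 * (1 / 2 : ℝ) ^ n * (1 + 9 / 5 * (4 / 5) ^ t) ^ n / δ ^ 2 ≤
      Real.exp (-(1 / 1000 * n)) := by
    intro t ht
    have h1 : (4 / 5 : ℝ) ^ t ≤ (4 / 5) ^ 26 :=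
      pow_le_pow_of_le_one (by norm_num) (by norm_num) ht
    have h2 : 1 + 9 / 5 * (4 / 5 : ℝ) ^ t ≤ 1.006 := by
      have : (4 / 5 : ℝ) ^ 26 ≤ 0.0033 := by norm_num
      linarith
    have h3 := g2 δ hδ
    rw [pow_zero, mul_one] at h3
    have h4 : 30 * (1 / 2 : ℝ) ^ n * (1 + 9 / 5 * (4 / 5) ^ t) ^ n / δ ^ 2 ≤ 30 * 0.503 ^ n / δ ^ 2 := by
      rw [mul_assoc, ← mul_pow]
      gcongr
      linarith
    linarith
  have hdepth : ∀ τ : ℕ, c * Real.log n ≤ τ → T + 4000 ≤ τ := by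
    intro τ hτ
    have : ((T + 4000 : ℕ) : ℝ) ≤ τ := by push_cast; linarith
    exact_mod_cast this
  refine ⟨fun τ hτ => ?_, fun heven τ hτ => ?_, fun τ hτ => ?_, fun m hm => ?_⟩
  · obtain ⟨t, rfl⟩ : ∃ t, τ = t + 1 := ⟨τ - 1, by have := hdepth τ hτ; omega⟩
    refine (peakedProb_le _ ?_ hδ0).trans (ENNReal.ofReal_le_ofReal ?_)
    · exact chain_ne g5 _
    · exact (div_le_div_of_nonneg_right (pushList_chain_le g5 t) (by positivity)).trans
        (hwall t (by have := hdepth _ hτ; omega))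
  · obtain ⟨t, rfl⟩ : ∃ t, τ = t + 1 := ⟨τ - 1, by have := hdepth τ hτ; omega⟩
    refine (peakedProb_le _ ?_ hδ0).trans (ENNReal.ofReal_le_ofReal ?_)
    · exact ring_ne g5 _
    · exact (div_le_div_of_nonneg_right (pushList_ring_le g5 heven t) (by positivity)).trans
        (hwall t (by have := hdepth _ hτ; omega))
  · refine (hT n τ (by omega) (by have := hdepth τ hτ; omega) δ hδ0).trans
      (ENNReal.ofReal_le_ofReal ?_)
    have := g3 δ hδ
    linarith
  · have hn0 : (0 : ℝ) < n := by exact_mod_cast (by omega : 0 < n)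
    have hm' : 2000 * n ≤ m := by
      have h1 : (4000 : ℝ) ≤ 2 * m / n := by linarith
      rw [le_div_iff₀ hn0] at h1
      have h2 : (2000 : ℝ) * n ≤ m := by linarith
      exact_mod_cast h2
    refine (peakedProbAvg_completeGraph_le (by omega) hm' hδ0).trans (ENNReal.ofReal_le_ofReal ?_)
    have := g4 δ hδ
    rwa [pow_zero, mul_one] at this
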